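/- **Setting.** An instance of online firefighting consists of a finite graph $G$, a fire source $r\in V(G)$ and a sequence $(f_i)_{i\ge1}$ of non-negative integers. At first only $r$ burns. In round $i$ the player learns $f_i$ and protects at most $f_i$ vertices that are not burning; then every unprotected neighbour of a burning vertex catches fire. A vertex is saved if it never burns. A deterministic online algorithm chooses the vertices protected in round $i$ as a function of $G,r,f_1,\dots,f_i$. Let $\mathrm{OPT}(\mathcal I)$ be the maximum number of vertices that can be saved on the instance $\mathcal I$ when the whole sequence is known. An algorithm is $c(n)$-competitive on a graph class if, on every instance $\mathcal I$ with a graph on $n$ vertices from the class, $\mathrm{OPT}(\mathcal I)\le c(n)\cdot \mathrm{ALG}(\mathcal I)$, where $\mathrm{ALG}(\mathcal I)$ is the number of vertices that the algorithm saves. A $1$-almost-tree is a connected graph with at most one cycle. A tadpole graph is a cycle together with a path with at least one further vertex, one end of which is joined by an edge to a vertex of the cycle. **The algorithm $\mathrm{ALG_A}$.** At any moment let $\widetilde G$ be the graph obtained from $G$ by contracting all burning vertices to $r$ and removing all protected and saved vertices. In $\widetilde G$, let $\kappa(S)$ be the set of vertices all of whose paths to $r$ meet $S\setminus\{r\}$,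 let $w(S)=|\kappa(S)|$ and $w(v)=w(\{v\})$, and let $N(r)$ be the neighbourhood of $r$. A root cycle is a cycle of $\widetilde G$ through $r$. For a root cycle $C$, a vertex $u\in C\setminus\{r\}$ and a real $m$, let $\mathrm{tol}(u,C,m)$ be the largest integer $d\ge 0$ such that at least $m$ vertices have distance at least $d$ from $r$ in the subgraph of $\widetilde G$ induced by $\{r\}\cup\kappa(C)\setminus\kappa(u)$. In each round $\mathrm{ALG_A}$ repeats the following step, updating $\widetilde G$ after each repetition, until none of the round's firefighters is left or $\widetilde G$ consists of $r$ only. Let $k$ be the number of firefighters left in the round. - If $\widetilde G$ has no root cycle, protect a vertex of $N(r)$ of maximum weight $w$. - If $\widetilde G$ has a root cycle $C$, let $v_1,v_2$ be a heaviest and a second heaviest vertex of $(N(r)\cup C)\setminus\{r\}$. - If $k\ge2$ and $w(v_1)+w(v_2)\ge w(C)$, protect $v_1$. - If $k\ge2$ and $w(v_1)+w(v_2)<w(C)$, protect both vertices of $N(r)\cap C$. - If $k=1$ and $w(v_1)\ge\sqrt{w(C)}$, protect $v_1$. - If $k=1$ and $w(v_1)<\sqrt{w(C)}$, protect a vertex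 $u\in N(r)\cap C$ with maximum $\mathrm{tol}(u,C,\sqrt{w(C)})$. **Theorem.** There is a deterministic online algorithm that plays according to $\mathrm{ALG_A}$ on all $1$-almost-trees, and every such algorithm (however ties are broken) is $(6\sqrt n+1)$-competitive on $1$-almost-trees. This is asymptotically optimal, already on tadpole graphs: every tadpole graph is a $1$-almost-tree, and there is a constant $\varepsilon>0$ such that, for every deterministic online algorithm that is $c(n)$-competitive on tadpole graphs, $c(n)\ge\varepsilon\sqrt n$ for all sufficiently large $n$. -/

import Mathlib

namespace Firefighting

variable {V : Type}

/-! ### The game -/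

/-- The vertices that received a firefighter in the rounds `0, …, i - 1` when the set `σ j` is
protected in round `j`. -/
def guarded (σ : ℕ → Finset V) (i : ℕ) : Set V := {v | ∃ j < i, v ∈ σ j}

/-- The vertices that burn at the beginning of round `i`. Rounds are numbered from `0`; in each
round the firefighters are placed first, and then the fire spreads from every burning vertex to all
its unprotected neighbours. -/
def burning (G : SimpleGraph V) (r : V) (σ : ℕ → Finset V) : ℕ → Set V
  | 0 => {r}
  | i + 1 => burning G r σ i ∪ {v | v ∉ guarded σ (i + 1) ∧ ∃ x ∈ burning G r σ i, G.Adj x v}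

/-- In round `i` at most `f i` vertices are protected, none of which is burning. -/
def IsLegal (G : SimpleGraph V) (r : V) (f : ℕ → ℕ) (σ : ℕ → Finset V) : Prop :=
  ∀ i, (σ i).card ≤ f i ∧ ∀ v ∈ σ i, v ∉ burning G r σ i

/-- The number of saved vertices, that is, of those that never burn. -/
noncomputable def profit (G : SimpleGraph V) (r : V) (σ : ℕ → Finset V) : ℕ :=
  {v | ∀ i, v ∉ burning G r σ i}.ncard

/-- The maximum number of vertices that can be saved, knowing the whole sequence `f`. -/
noncomputable def opt (G : SimpleGraph V) (r : V) (f : ℕ → ℕ) : ℕ :=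
  sSup {k | ∃ σ, IsLegal G r f σ ∧ profit G r σ = k}

/-- A deterministic online algorithm: on the instance `(G, r, f)` it protects `move V G r f i` in
round `i`, which may depend on `f 0, …, f i` but not on later values of `f`. -/
structure OnlineAlgorithm where
  move : (V : Type) → SimpleGraph V → V → (ℕ → ℕ) → ℕ → Finset V
  online : ∀ (V : Type) (G : SimpleGraph V) (r : V) (f f' : ℕ → ℕ) (i : ℕ),
    (∀ j ≤ i, f j = f' j) → move V G r f i = move V G r f' i
  legal : ∀ (V : Type) (G : SimpleGraph V) (r : V) (f : ℕ → ℕ), IsLegal G r f (move V G r f)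

/-- `A` is `c(n)`-competitive on the finite graphs of a class, `n` being the number of vertices. -/
def OnlineAlgorithm.IsCompetitiveOn (A : OnlineAlgorithm)
    (cls : (V : Type) → SimpleGraph V → Prop) (c : ℕ → ℝ) : Prop :=
  ∀ (V : Type) [Finite V] (G : SimpleGraph V), cls V G → ∀ (r : V) (f : ℕ → ℕ),
    (opt G r f : ℝ) ≤ c (Nat.card V) * profit G r (A.move V G r f)

/-! ### The graph classes -/

/-- A connected graph with at most one cycle. -/
def IsOneAlmostTree (G : SimpleGraph V) : Prop :=
  G.Connected ∧ ∀ (u v : V) (p : G.Walk u u) (q : G.Walk v v), p.IsCycle → q.IsCycle →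
    ∀ e, e ∈ p.edges ↔ e ∈ q.edges

/-- A cycle with `k + 3` vertices and a path with `l + 1` further vertices, one end of which is
joined by an edge to a vertex of the cycle. -/
def tadpoleGraph (k l : ℕ) : SimpleGraph (Fin (k + 3) ⊕ Fin (l + 1)) :=
  (SimpleGraph.cycleGraph (k + 3) ⊕g SimpleGraph.pathGraph (l + 1)) ⊔
    SimpleGraph.edge (Sum.inl 0) (Sum.inr 0)

def IsTadpole (G : SimpleGraph V) : Prop := ∃ k l : ℕ, Nonempty (G ≃g tadpoleGraph k l)

/-! ### The reduced graph, covered sets, weights and tolerance -/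

open Classical in
/-- The graph seen by the algorithm when the vertices of `B` burn and those of `P` are protected:
`P` is deleted and `B` is contracted to the fire source `r`. The graph keeps the vertex type `V`;
its actual vertices are those in the connected component of `r` (the vertices of `P`, those of `B`
other than `r`, and the saved vertices are not reachable from `r`). -/
def reduced (G : SimpleGraph V) (r : V) (B P : Set V) : SimpleGraph V where
  Adj a b := a ≠ b ∧ ∃ x y, G.Adj x y ∧ x ∉ P ∧ y ∉ P ∧
    (if x ∈ B then r else x) = a ∧ (if y ∈ B then r else y) = b
  symm := ⟨fun _ _ ⟨hne, x, y, h, hx, hy, hxa, hyb⟩ => ⟨hne.symm, y, x, h.symm, hy, hx, hyb, hxa⟩⟩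
  loopless := ⟨fun _ h => h.1 rfl⟩

/-- The covered set `κ(S \ {r})` in the component of `r` in `H`: the vertices all of whose paths to
`r` meet `S \ {r}`. -/
def covered (H : SimpleGraph V) (r : V) (S : Set V) : Set V :=
  {u | H.Reachable u r ∧ ∀ p : H.Walk u r, p.IsPath → ∃ x ∈ p.support, x ∈ S ∧ x ≠ r}

noncomputable def weight (H : SimpleGraph V) (r : V) (S : Set V) : ℕ := (covered H r S).ncard

/-- `C` is the vertex set of a cycle of `H` through `r`. -/
def IsRootCycle (H : SimpleGraph V) (r : V) (C : Set V) : Prop :=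
  ∃ p : H.Walk r r, p.IsCycle ∧ C = {v | v ∈ p.support}

/-- The vertex set of the subgraph that is induced by `{r} ∪ κ(C) \ κ(u)`. -/
def brokenVerts (H : SimpleGraph V) (r : V) (C : Set V) (u : V) : Set V :=
  {r} ∪ (covered H r C \ covered H r {u})

/-- The number of vertices at distance at least `d` from `r` in the subgraph induced by
`{r} ∪ κ(C) \ κ(u)`. -/
noncomputable def brokenCount (H : SimpleGraph V) (r : V) (C : Set V) (u : V) (d : ℕ) : ℕ :=
  {v ∈ brokenVerts H r C u |
    d ≤ (H.induce (brokenVerts H r C u)).spanningCoe.dist r v}.ncard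

/-- The tolerance of `u` with respect to `m`: the largest `d` for which at least `m` vertices are
at distance at least `d` from `r` after the root cycle `C` has been broken at `u`. -/
noncomputable def tol (H : SimpleGraph V) (r : V) (C : Set V) (u : V) (m : ℝ) : ℕ :=
  sSup {d : ℕ | m ≤ brokenCount H r C u d}

/-! ### The algorithm -/

/-- `v₁` and `v₂` are a heaviest and a second heaviest vertex of `(N(r) ∪ C) \ {r}`. -/
def AreHeaviest (H : SimpleGraph V) (r : V) (C : Set V) (v₁ v₂ : V) : Prop :=
  v₁ ∈ (H.neighborSet r ∪ C) \ {r} ∧ v₂ ∈ (H.neighborSet r ∪ C) \ {r} ∧ v₁ ≠ v₂ ∧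
    weight H r {v₂} ≤ weight H r {v₁} ∧
    ∀ u ∈ (H.neighborSet r ∪ C) \ {r}, u ≠ v₁ → weight H r {u} ≤ weight H r {v₂}

/-- `AlgAChoice H r k Q`: in one iteration, on the graph `H` with fire source `r` and with `k`
firefighters left, the algorithm may choose to protect `Q`. Ties are broken arbitrarily. -/
inductive AlgAChoice (H : SimpleGraph V) (r : V) : ℕ → Set V → Prop
  | noRootCycle (k : ℕ) (v : V) (hk : 1 ≤ k) (hC : ¬ ∃ C, IsRootCycle H r C)
      (hv : v ∈ H.neighborSet r)
      (hmax : ∀ u ∈ H.neighborSet r, weight H r {u} ≤ weight H r {v}) :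
      AlgAChoice H r k {v}
  | manyHeaviest (k : ℕ) (C : Set V) (v₁ v₂ : V) (hk : 2 ≤ k) (hC : IsRootCycle H r C)
      (hv : AreHeaviest H r C v₁ v₂)
      (hw : weight H r C ≤ weight H r {v₁} + weight H r {v₂}) :
      AlgAChoice H r k {v₁}
  | manyCycle (k : ℕ) (C : Set V) (v₁ v₂ : V) (hk : 2 ≤ k) (hC : IsRootCycle H r C)
      (hv : AreHeaviest H r C v₁ v₂)
      (hw : weight H r {v₁} + weight H r {v₂} < weight H r C) :
      AlgAChoice H r k (H.neighborSet r ∩ C)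
  | oneHeaviest (C : Set V) (v₁ v₂ : V) (hC : IsRootCycle H r C)
      (hv : AreHeaviest H r C v₁ v₂)
      (hw : √(weight H r C : ℝ) ≤ weight H r {v₁}) :
      AlgAChoice H r 1 {v₁}
  | breakCycle (C : Set V) (v₁ v₂ u : V) (hC : IsRootCycle H r C)
      (hv : AreHeaviest H r C v₁ v₂)
      (hw : (weight H r {v₁} : ℝ) < √(weight H r C : ℝ))
      (hu : u ∈ H.neighborSet r ∩ C)
      (hmax : ∀ u' ∈ H.neighborSet r ∩ C,
        tol H r C u' √(weight H r C : ℝ) ≤ tol H r C u √(weight H r C : ℝ)) :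
      AlgAChoice H r 1 {u}

/-- There is an available vertex, that is, one that is neither burning nor saved. -/
def HasAvailable (H : SimpleGraph V) (r : V) : Prop := ∃ v, v ≠ r ∧ H.Reachable r v

/-- `AlgARound G r B P k Q`: in a round (or the rest of one) in which `B` burns, `P` is protected
and `k` firefighters are left, the algorithm may protect `Q`. It iterates until no firefighter or
no available vertex is left. -/
inductive AlgARound (G : SimpleGraph V) (r : V) (B : Set V) : Set V → ℕ → Set V → Prop
  | finish (P : Set V) (k : ℕ) (h : k = 0 ∨ ¬ HasAvailable (reduced G r B P) r) :
      AlgARound G r B P k ∅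
  | step (P : Set V) (k : ℕ) (Q Q' : Set V) (hk : 0 < k) (h : HasAvailable (reduced G r B P) r)
      (hQ : AlgAChoice (reduced G r B P) r k Q)
      (hQ' : AlgARound G r B (P ∪ Q) (k - Q.ncard) Q') :
      AlgARound G r B P k (Q ∪ Q')

/-- `A` runs the algorithm on all finite `1`-almost-trees (with some way of breaking ties). -/
def OnlineAlgorithm.IsAlgA (A : OnlineAlgorithm) : Prop :=
  ∀ (V : Type) [Finite V] (G : SimpleGraph V), IsOneAlmostTree G →
    ∀ (r : V) (f : ℕ → ℕ) (i : ℕ),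
      AlgARound G r (burning G r (A.move V G r f) i) (guarded (A.move V G r f) i) (f i)
        (A.move V G r f i : Set V)

end Firefighting

/-!
Compare a play `σ` of `ALG_A` with an optimal play `ω`. A vertex that `ω` saves and `σ` loses is
called dominated if some single vertex that `ω` protects would have cut it off from the fire of `σ`
at that time. The dominated vertices are charged round by round: as long as fire can spread, each
firefighter of `ALG_A` cuts off at least a `1 / (2√n)` fraction of what any single vertex could.

A vertex that is not dominated lies behind the unique cycle, and `ω` saves it only by blocking both
ways around that cycle. Consider the first round in which `ω` blocks one of them. If `ALG_A` does
not break the cycle there, it cuts off at least a `1 / (2√n)` fraction of everything behind the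
cycle. If it breaks the cycle with its only firefighter, then every protected vertex on the
remaining way covers fewer than `√n` vertices, and by the choice of the tolerance the fire of `σ`
needs about as long to go around the broken cycle as `ω` can afford for its second block, while each
of these rounds in which firefighters arrive increases what `ALG_A` saves.

For the lower bound, the fire starts opposite the junction of a tadpole whose path has about `√n`
vertices. One firefighter arrives at once. An algorithm that spends it on the cycle away from the
junction loses the path and saves one vertex; otherwise a further firefighter arrives when the fire
is about to pass the junction, and half of the cycle could have been saved.
-/

namespace Firefighting

open SimpleGraph

/-! ### Reachability outside a set of vertices -/

section Region

variable {V : Type*} {G : SimpleGraph V} {r x y : V} {S T : Set V}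

/-- The graph `G` without the edges at the vertices of `S`. Deleted vertices stay as isolated
vertices, so that the vertex type does not change. -/
def deleteVerts (G : SimpleGraph V) (S : Set V) : SimpleGraph V := (G.induce Sᶜ).spanningCoe

/-- The vertices that can be reached from `r` outside `S`. -/
def region (G : SimpleGraph V) (r : V) (S : Set V) : Set V := {x | (deleteVerts G S).Reachable r x}

theorem deleteVerts_adj : (deleteVerts G S).Adj x y ↔ G.Adj x y ∧ x ∉ S ∧ y ∉ S := by
  simp [deleteVerts]

theorem deleteVerts_empty (G : SimpleGraph V) : deleteVerts G ∅ = G := by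
  ext
  simp [deleteVerts_adj]

theorem deleteVerts_le (G : SimpleGraph V) (S : Set V) : deleteVerts G S ≤ G :=
  fun _ _ h => (deleteVerts_adj.1 h).1

theorem deleteVerts_anti (G : SimpleGraph V) (h : S ⊆ T) : deleteVerts G T ≤ deleteVerts G S := by
  intro a b hab
  obtain ⟨hadj, ha, hb⟩ := deleteVerts_adj.1 hab
  exact deleteVerts_adj.2 ⟨hadj, fun haS => ha (h haS), fun hbS => hb (h hbS)⟩

theorem region_anti (G : SimpleGraph V) (r : V) (h : S ⊆ T) : region G r T ⊆ region G r S :=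
  fun _ hx => Reachable.mono (deleteVerts_anti G h) hx

theorem self_mem_region (G : SimpleGraph V) (r : V) (S : Set V) : r ∈ region G r S :=
  Reachable.refl _

theorem mem_region_empty : x ∈ region G r ∅ ↔ G.Reachable r x := by
  rw [region, deleteVerts_empty, Set.mem_ofPred_eq]

theorem mem_region_of_adj (hx : x ∈ region G r S) (hxS : x ∉ S) (h : G.Adj x y) (hy : y ∉ S) :
    y ∈ region G r S :=
  Reachable.trans hx (deleteVerts_adj.2 ⟨h, hxS, hy⟩).reachable

theorem mem_region_of_walk (w : G.Walk r x) (hw : ∀ v ∈ w.support, v ∉ S) : x ∈ region G r S := by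
  induction w with
  | nil => exact self_mem_region G _ S
  | cons h w ih =>
    have hadj := deleteVerts_adj.2 ⟨h, hw _ (by simp), hw _ (by simp)⟩
    exact hadj.reachable.trans (ih fun v hv => hw v (by simp [hv]))

theorem notMem_of_mem_support_deleteVerts (w : (deleteVerts G S).Walk r x) (hr : r ∉ S) :
    ∀ v ∈ w.support, v ∉ S := by
  induction w with
  | nil => simpa using hr
  | cons h w ih =>
    rintro v (_ | ⟨_, hv⟩)
    · exact hr
    · exact ih (deleteVerts_adj.1 h).2.2 v hv

theorem mem_region_iff_exists_isPath (hr : r ∉ S) :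
    x ∈ region G r S ↔ ∃ w : G.Walk r x, w.IsPath ∧ ∀ v ∈ w.support, v ∉ S := by
  classical
  refine ⟨fun hx => ?_, fun ⟨w, _, hw⟩ => mem_region_of_walk w hw⟩
  obtain ⟨w, hw⟩ := Reachable.exists_isPath hx
  refine ⟨w.mapLe (deleteVerts_le G S), hw.mapLe _, fun v hv => ?_⟩
  exact notMem_of_mem_support_deleteVerts w hr v (by simpa using hv)

end Region

section Covered

variable {V : Type} {H : SimpleGraph V} {r v x y : V}

theorem covered_eq_region_sdiff (H : SimpleGraph V) (r : V) (S : Set V) :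
    covered H r S = region H r ∅ \ region H r (S \ {r}) := by
  ext x
  simp only [covered, Set.mem_ofPred_eq, Set.mem_sdiff, mem_region_empty]
  refine and_congr reachable_comm ?_
  rw [mem_region_iff_exists_isPath (by simp)]
  constructor
  · rintro h ⟨w, hw, hwS⟩
    obtain ⟨y, hy, hyS, hyr⟩ := h w.reverse hw.reverse
    exact hwS y (by simpa using hy) ⟨hyS, hyr⟩
  · intro h p hp
    by_contra! hcon
    exact h ⟨p.reverse, hp.reverse, fun v hv hvS => hvS.2 (hcon v (by simpa using hv) hvS.1)⟩

theorem mem_covered_of_forall_isPath (hv : v ≠ r) (hx : H.Reachable r x)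
    (h : ∀ w : H.Walk r x, w.IsPath → v ∈ w.support) : x ∈ covered H r {v} :=
  ⟨hx.symm, fun q hq => ⟨v, by simpa using h _ hq.reverse, rfl, hv⟩⟩

theorem mem_support_of_mem_covered (hx : x ∈ covered H r {v}) {w : H.Walk r x} (hw : w.IsPath) :
    v ∈ w.support ∧ v ≠ r := by
  obtain ⟨y, hy, rfl, hyr⟩ := hx.2 w.reverse hw.reverse
  exact ⟨by simpa using hy, hyr⟩

theorem self_mem_covered (hv : v ≠ r) (h : H.Reachable r v) : v ∈ covered H r {v} :=
  mem_covered_of_forall_isPath hv h fun w _ => w.end_mem_support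

theorem covered_subset_of_mem (hy : y ∈ covered H r {v}) : covered H r {y} ⊆ covered H r {v} := by
  classical
  rintro x ⟨hx, hx'⟩
  refine ⟨hx, fun q hq => ?_⟩
  obtain ⟨z, hz, rfl, -⟩ := hx' q hq
  obtain ⟨u, hu, rfl, hur⟩ := hy.2 _ (hq.dropUntil hz)
  exact ⟨u, Walk.support_dropUntil_subset_support _ hz hu, rfl, hur⟩

theorem weight_mono [Finite V] {S T : Set V} (h : covered H r S ⊆ covered H r T) :
    weight H r S ≤ weight H r T :=
  Set.ncard_le_ncard h (Set.toFinite _)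

end Covered

/-! ### Graphs with at most one cycle -/

section AtMostOneCycle

variable {V : Type*} {H : SimpleGraph V} {r x : V}

/-- There is at most one cycle, up to the choice of its first vertex and of its direction: all
cycles have the same edges. -/
def AtMostOneCycle (G : SimpleGraph V) : Prop :=
  ∀ (u v : V) (p : G.Walk u u) (q : G.Walk v v), p.IsCycle → q.IsCycle →
    ∀ e, e ∈ p.edges ↔ e ∈ q.edges

theorem AtMostOneCycle.eq_of_notMem_edges (hH : AtMostOneCycle H) {u : V} {p : H.Walk u u}
    (hp : p.IsCycle) {e : Sym2 V} (he : e ∈ p.edges) {a b : V} {w w' : H.Walk a b}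
    (hw : w.IsPath) (hw' : w'.IsPath) (hwe : e ∉ w.edges) (hwe' : e ∉ w'.edges) : w = w' := by
  by_contra hne
  obtain ⟨_, _, q, q', hq, hq', hc⟩ := hw.exists_isCycle_of_ne hw' hne
  have hmem : e ∈ (q.append q'.reverse).edges := (hH _ _ p _ hp hc e).1 he
  rw [Walk.edges_append, Walk.edges_reverse, List.mem_append, List.mem_reverse] at hmem
  exact hmem.elim (fun h => hwe (hq.edges_subset h)) fun h => hwe' (hq'.edges_subset h)

theorem isPath_append {a b c : V} {p : H.Walk a b} {q : H.Walk b c} (hp : p.IsPath)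
    (hq : q.IsPath) (h : ∀ v ∈ p.support, v ∈ q.support → v = b) : (p.append q).IsPath := by
  have hq' := hq.support_nodup
  rw [← Walk.cons_tail_support, List.nodup_cons] at hq'
  rw [Walk.isPath_def, Walk.support_append, List.nodup_append]
  refine ⟨hp.support_nodup, hq'.2, ?_⟩
  rintro v hv _ hv' rfl
  exact hq'.1 (h v hv (List.mem_of_mem_tail hv') ▸ hv')

theorem getVert_injective_of_isCycle {p : H.Walk r r} (hp : p.IsCycle) {i j : ℕ}
    (hi : i < p.length) (hj : j < p.length) (h : p.getVert i = p.getVert j) : i = j :=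
  hp.getVert_injOn' (Nat.le_sub_one_of_lt hi) (Nat.le_sub_one_of_lt hj) h

theorem ncard_image_getVert_Ico {p : H.Walk r r} (hp : p.IsCycle) (a : ℕ) :
    (p.getVert '' Set.Ico a p.length).ncard = p.length - a := by
  rw [Set.InjOn.ncard_image, ← Finset.coe_Ico, Set.ncard_coe_finset, Nat.card_Ico]
  rintro i ⟨-, hi⟩ j ⟨-, hj⟩ heq
  exact getVert_injective_of_isCycle hp hi hj heq

theorem getVert_ne_root {p : H.Walk r r} (hp : p.IsCycle) {i : ℕ} (h0 : 0 < i)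
    (hi : i < p.length) : p.getVert i ≠ r := by
  rw [Ne, hp.getVert_endpoint_iff hi.le]
  omega

theorem snd_ne_root {p : H.Walk r r} (hp : p.IsCycle) : p.snd ≠ r :=
  (Walk.adj_snd hp.not_nil).ne'

theorem penultimate_ne_root {p : H.Walk r r} (hp : p.IsCycle) : p.penultimate ≠ r :=
  (Walk.adj_penultimate hp.not_nil).ne

theorem exists_getVert_eq_of_isCycle {p : H.Walk r r} (hp : p.IsCycle) {v : V}
    (hv : v ∈ p.support) : ∃ i < p.length, p.getVert i = v := by
  obtain ⟨n, rfl, hn⟩ := Walk.mem_support_iff_exists_getVert.1 hv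
  rcases hn.lt_or_eq with hlt | rfl
  · exact ⟨n, hlt, rfl⟩
  · exact ⟨0, by have := hp.three_le_length; omega, by simp⟩

theorem mem_support_take_iff {a b : V} {p : H.Walk a b} {n : ℕ} {v : V} :
    v ∈ (p.take n).support ↔ ∃ i ≤ n, p.getVert i = v := by
  rw [Walk.mem_support_iff_exists_getVert]
  simp only [Walk.take_getVert, Walk.take_length]
  constructor
  · rintro ⟨i, rfl, -⟩
    exact ⟨n ⊓ i, inf_le_left, rfl⟩
  · rintro ⟨i, hi, rfl⟩
    rcases le_total i p.length with h | h
    · exact ⟨i, by rw [min_eq_right hi], le_inf hi h⟩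
    · refine ⟨p.length, ?_, le_inf (h.trans hi) le_rfl⟩
      rw [min_eq_right (h.trans hi), p.getVert_of_length_le h, p.getVert_length]

theorem mem_support_drop_iff {a b : V} {p : H.Walk a b} {n : ℕ} {v : V} :
    v ∈ (p.drop n).support ↔ ∃ i, n ≤ i ∧ p.getVert i = v := by
  constructor
  · intro h
    obtain ⟨i, rfl, -⟩ := Walk.mem_support_iff_exists_getVert.1 h
    exact ⟨n + i, by omega, (p.drop_getVert n i).symm⟩
  · rintro ⟨i, hi, rfl⟩
    rw [← Nat.add_sub_cancel' hi, ← p.drop_getVert]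
    exact Walk.getVert_mem_support _ _

theorem reachable_getVert {a b : V} (p : H.Walk a b) (i : ℕ) : H.Reachable a (p.getVert i) :=
  ⟨p.take i⟩

theorem disjoint_edges_take_drop {a b : V} {p : H.Walk a b} (hp : p.IsTrail) (n : ℕ) :
    List.Disjoint (p.take n).edges (p.drop n).edges := by
  rw [Walk.edges_take, Walk.edges_drop]
  exact List.disjoint_take_drop hp.edges_nodup le_rfl

theorem mk_start_snd_mem_edges_take {a b : V} {p : H.Walk a b} (hp : ¬ p.Nil) {n : ℕ}
    (hn : 0 < n) : s(a, p.snd) ∈ (p.take n).edges := by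
  have hmem := Walk.mk_start_snd_mem_edges (p := p.take n)
    (by rw [Walk.nil_take_iff]; exact fun h => h.elim hp hn.ne')
  rwa [Walk.snd, Walk.take_getVert, min_eq_right (Nat.succ_le_of_lt hn)] at hmem

theorem mk_penultimate_end_mem_edges_drop {a b : V} {p : H.Walk a b} {n : ℕ}
    (hn : n < p.length) : s(p.penultimate, b) ∈ (p.drop n).edges := by
  have hmem := Walk.mk_penultimate_end_mem_edges (p := p.drop n)
    (by rw [Walk.nil_drop_iff]; omega)
  rwa [Walk.penultimate, Walk.drop_getVert, Walk.drop_length,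
    show n + (p.length - n - 1) = p.length - 1 by omega] at hmem

/-- `τ` is a path that starts at the vertex number `e` of the closed walk `p` and has no other
vertex in common with `p`. -/
structure IsTail (p : H.Walk r r) (e : ℕ) (τ : H.Walk (p.getVert e) x) : Prop where
  lt_length : e < p.length
  isPath : τ.IsPath
  eq_of_mem : ∀ v ∈ τ.support, v ∈ p.support → v = p.getVert e

theorem exists_walk_inter_support_subset {C : Set V} {a b : V} (w : H.Walk a b) (hb : b ∈ C) :
    ∃ c ∈ C, ∃ τ : H.Walk c a, ∀ v ∈ τ.support, v ∈ C → v = c := by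
  induction w with
  | nil => exact ⟨_, hb, Walk.nil, by simp⟩
  | @cons a _ _ h _ ih =>
    by_cases ha : a ∈ C
    · exact ⟨a, ha, Walk.nil, by simp⟩
    · obtain ⟨c, hc, τ, hτ⟩ := ih hb
      refine ⟨c, hc, τ.concat h.symm, fun v hv hvC => ?_⟩
      rw [Walk.support_concat, List.mem_append, List.mem_singleton] at hv
      rcases hv with hv | rfl
      · exact hτ v hv hvC
      · exact absurd hvC ha

theorem exists_isTail {p : H.Walk r r} (hp : p.IsCycle) (hx : H.Reachable r x) :
    ∃ e, ∃ τ : H.Walk (p.getVert e) x, IsTail p e τ := by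
  classical
  obtain ⟨w⟩ := hx.symm
  obtain ⟨c, hc, τ, hτ⟩ :=
    exists_walk_inter_support_subset (C := {v | v ∈ p.support}) w p.start_mem_support
  obtain ⟨e, he, rfl⟩ := exists_getVert_eq_of_isCycle hp hc
  exact ⟨e, τ.bypass, he, τ.bypass_isPath,
    fun v hv => hτ v (Walk.support_bypass_subset_support _ hv)⟩

/-- The walk from the root of the cycle `p` to the end of a tail that starts along `p`. -/
def leftPath (p : H.Walk r r) (e : ℕ) (τ : H.Walk (p.getVert e) x) : H.Walk r x :=
  (p.take e).append τ

/-- The walk from the root of the cycle `p` to the end of a tail that starts against the direction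
of `p`. -/
def rightPath (p : H.Walk r r) (e : ℕ) (τ : H.Walk (p.getVert e) x) : H.Walk r x :=
  (p.drop e).reverse.append τ

variable {p : H.Walk r r} {e : ℕ} {τ : H.Walk (p.getVert e) x} {v : V}

theorem isTail_nil (he : e < p.length) : IsTail p e (Walk.nil : H.Walk (p.getVert e) _) :=
  ⟨he, Walk.IsPath.nil, by simp⟩

theorem mem_support_leftPath_iff :
    v ∈ (leftPath p e τ).support ↔ (∃ i ≤ e, p.getVert i = v) ∨ v ∈ τ.support := by
  rw [leftPath, Walk.mem_support_append_iff, mem_support_take_iff]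

theorem mem_support_rightPath_iff :
    v ∈ (rightPath p e τ).support ↔ (∃ i, e ≤ i ∧ p.getVert i = v) ∨ v ∈ τ.support := by
  rw [rightPath, Walk.mem_support_append_iff, Walk.support_reverse, List.mem_reverse,
    mem_support_drop_iff]

namespace IsTail

theorem root_notMem_support (hτ : IsTail p e τ) (hp : p.IsCycle) (he : 0 < e) : r ∉ τ.support :=
  fun h => getVert_ne_root hp he hτ.lt_length (hτ.eq_of_mem r h p.start_mem_support).symm

theorem notMem_edges (hτ : IsTail p e τ) {a b : V} (ha : a ∈ p.support) (hb : b ∈ p.support) :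
    s(a, b) ∉ τ.edges := by
  intro h
  have ha' := hτ.eq_of_mem a (Walk.fst_mem_support_of_mem_edges _ h) ha
  have hb' := hτ.eq_of_mem b (Walk.snd_mem_support_of_mem_edges _ h) hb
  exact (Walk.adj_of_mem_edges _ h).ne (ha'.trans hb'.symm)

theorem isPath_leftPath (hτ : IsTail p e τ) (hp : p.IsCycle) : (leftPath p e τ).IsPath :=
  isPath_append (hp.isPath_take hτ.lt_length) hτ.isPath fun v hv hvτ =>
    hτ.eq_of_mem v hvτ ((Walk.isSubwalk_take p e).support_subset hv)

theorem isPath_rightPath (hτ : IsTail p e τ) (hp : p.IsCycle) (he : 0 < e) :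
    (rightPath p e τ).IsPath :=
  isPath_append (hp.isPath_drop he).reverse hτ.isPath fun v hv hvτ =>
    hτ.eq_of_mem v hvτ ((Walk.isSubwalk_drop p e).support_subset (by simpa using hv))

theorem mk_start_snd_notMem_edges_rightPath (hτ : IsTail p e τ) (hp : p.IsCycle) (he : 0 < e) :
    s(r, p.snd) ∉ (rightPath p e τ).edges := by
  rw [rightPath, Walk.edges_append, List.mem_append, Walk.edges_reverse, List.mem_reverse, not_or]
  exact ⟨fun h => disjoint_edges_take_drop hp.isTrail e
      (mk_start_snd_mem_edges_take hp.not_nil he) h,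
    hτ.notMem_edges p.start_mem_support (p.getVert_mem_support 1)⟩

theorem mk_penultimate_root_notMem_edges_leftPath (hτ : IsTail p e τ) (hp : p.IsCycle) :
    s(p.penultimate, r) ∉ (leftPath p e τ).edges := by
  rw [leftPath, Walk.edges_append, List.mem_append, not_or]
  exact ⟨fun h => disjoint_edges_take_drop hp.isTrail e h
      (mk_penultimate_end_mem_edges_drop hτ.lt_length),
    hτ.notMem_edges (Walk.getVert_mem_support _ _) p.start_mem_support⟩

theorem mk_start_snd_notMem_edges_leftPath_zero {τ : H.Walk (p.getVert 0) x} (hτ : IsTail p 0 τ) :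
    s(r, p.snd) ∉ (leftPath p 0 τ).edges := by
  simpa [leftPath] using hτ.notMem_edges p.start_mem_support (p.getVert_mem_support 1)

/-- A path cannot contain both edges of the cycle at the root, and two paths that avoid the same
edge of the only cycle are equal. -/
theorem eq_leftPath_or_eq_rightPath (hτ : IsTail p e τ) (hH : AtMostOneCycle H) (hp : p.IsCycle)
    {w : H.Walk r x} (hw : w.IsPath) :
    w = leftPath p e τ ∨ (0 < e ∧ w = rightPath p e τ) := by
  by_cases hlast : s(p.penultimate, r) ∈ w.edges
  · have hfirst : s(r, p.snd) ∉ w.edges := fun h =>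
      hp.snd_ne_penultimate ((hw.eq_snd_of_mem_edges h).trans
        (hw.eq_snd_of_mem_edges (by rwa [Sym2.eq_swap])).symm)
    have heq := fun {q : H.Walk r x} => hH.eq_of_notMem_edges hp
      (Walk.mk_start_snd_mem_edges hp.not_nil) hw (w' := q)
    rcases Nat.eq_zero_or_pos e with rfl | he
    · exact Or.inl (heq (hτ.isPath_leftPath hp) hfirst
        hτ.mk_start_snd_notMem_edges_leftPath_zero)
    · exact Or.inr ⟨he, heq (hτ.isPath_rightPath hp he) hfirst
        (hτ.mk_start_snd_notMem_edges_rightPath hp he)⟩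
  · exact Or.inl (hH.eq_of_notMem_edges hp (Walk.mk_penultimate_end_mem_edges hp.not_nil) hw
      (hτ.isPath_leftPath hp) hlast (hτ.mk_penultimate_root_notMem_edges_leftPath hp))

theorem support_subset (hτ : IsTail p e τ) (hH : AtMostOneCycle H) (hp : p.IsCycle)
    {w : H.Walk r x} (hw : w.IsPath) : τ.support ⊆ w.support := by
  intro v hv
  rcases hτ.eq_leftPath_or_eq_rightPath hH hp hw with rfl | ⟨-, rfl⟩
  · exact mem_support_leftPath_iff.2 (Or.inr hv)
  · exact mem_support_rightPath_iff.2 (Or.inr hv)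

theorem notMem_region_of_mem_support (hτ : IsTail p e τ) (hH : AtMostOneCycle H) (hp : p.IsCycle)
    {S : Set V} (hv : v ∈ τ.support) (hvS : v ∈ S) (hr : r ∉ S) : x ∉ region H r S := by
  rw [mem_region_iff_exists_isPath hr]
  rintro ⟨w, hw, hwS⟩
  exact hwS v (hτ.support_subset hH hp hw hv) hvS

end IsTail

theorem AtMostOneCycle.adj_root_iff (hH : AtMostOneCycle H) (hp : p.IsCycle)
    (hv : v ∈ p.support) : H.Adj r v ↔ v = p.snd ∨ v = p.penultimate := by
  refine ⟨fun h => ?_, ?_⟩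
  · obtain ⟨i, hi, rfl⟩ := exists_getVert_eq_of_isCycle hp hv
    have hlength : ∀ q : H.Walk r (p.getVert i), h.toWalk = q → q.length = 1 := by
      rintro _ rfl
      rfl
    rcases (isTail_nil hi).eq_leftPath_or_eq_rightPath hH hp (Walk.IsPath.of_adj h) with
      hleft | ⟨-, hright⟩
    · have := hlength _ hleft
      simp only [leftPath, Walk.append_nil, Walk.take_length] at this
      exact Or.inl (congrArg p.getVert (by omega))
    · have := hlength _ hright
      simp only [rightPath, Walk.append_nil, Walk.length_reverse, Walk.drop_length] at this
      exact Or.inr (congrArg p.getVert (by omega))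
  · rintro (rfl | rfl)
    · exact Walk.adj_snd hp.not_nil
    · exact (Walk.adj_penultimate hp.not_nil).symm

theorem AtMostOneCycle.neighborSet_inter_support (hH : AtMostOneCycle H) (hp : p.IsCycle) :
    H.neighborSet r ∩ {v | v ∈ p.support} = {p.snd, p.penultimate} := by
  ext v
  constructor
  · rintro ⟨hadj, hv⟩
    exact (hH.adj_root_iff hp hv).1 hadj
  · intro h
    have hv : v ∈ p.support := by rcases h with rfl | rfl <;> exact Walk.getVert_mem_support _ _
    exact ⟨(hH.adj_root_iff hp hv).2 h, hv⟩

end AtMostOneCycle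

section RootCycleCovered

variable {V : Type} {H : SimpleGraph V} {r x : V} {p : H.Walk r r} {e : ℕ}
  {τ : H.Walk (p.getVert e) x}

theorem IsTail.mem_covered_support_iff (hτ : IsTail p e τ) (hH : AtMostOneCycle H)
    (hp : p.IsCycle) : x ∈ covered H r {v | v ∈ p.support} ↔ 0 < e := by
  have hx : H.Reachable r x := (reachable_getVert p e).trans ⟨τ⟩
  rw [covered_eq_region_sdiff, Set.mem_sdiff, mem_region_empty, and_iff_right hx]
  constructor
  · intro h
    by_contra! h0
    obtain rfl : e = 0 := by omega
    refine h (mem_region_of_walk (leftPath p 0 τ) fun v hv hvS => hvS.2 ?_)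
    rcases mem_support_leftPath_iff.1 hv with ⟨i, hi, rfl⟩ | hv
    · obtain rfl : i = 0 := by omega
      simp
    · simpa using hτ.eq_of_mem v hv hvS.1
  · intro h
    exact hτ.notMem_region_of_mem_support hH hp τ.start_mem_support
      ⟨p.getVert_mem_support e, getVert_ne_root hp h hτ.lt_length⟩ (by simp)

theorem IsTail.mem_covered_of_mem_support (hτ : IsTail p e τ) (hH : AtMostOneCycle H)
    (hp : p.IsCycle) (he : 0 < e) {v : V} (hv : v ∈ τ.support) : x ∈ covered H r {v} :=
  mem_covered_of_forall_isPath (fun h => hτ.root_notMem_support hp he (h ▸ hv))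
    ((reachable_getVert p e).trans ⟨τ⟩) fun _ hw => hτ.support_subset hH hp hw hv

theorem covered_neighborSet_inter_support (hH : AtMostOneCycle H) (hp : p.IsCycle) :
    covered H r (H.neighborSet r ∩ {v | v ∈ p.support}) = covered H r {v | v ∈ p.support} := by
  ext x
  constructor
  · rintro ⟨hx, h⟩
    refine ⟨hx, fun q hq => ?_⟩
    obtain ⟨y, hy, hyS, hyr⟩ := h q hq
    exact ⟨y, hy, hyS.2, hyr⟩
  · intro h
    obtain ⟨e, τ, hτ⟩ := exists_isTail hp h.1.symm
    have he := (hτ.mem_covered_support_iff hH hp).1 h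
    refine ⟨h.1, fun q hq => ?_⟩
    rw [hH.neighborSet_inter_support hp]
    have hsupport {v : V} : v ∈ q.support ↔ v ∈ q.reverse.support := by simp
    rcases hτ.eq_leftPath_or_eq_rightPath hH hp hq.reverse with hw | ⟨-, hw⟩
    · refine ⟨p.snd, ?_, by simp, snd_ne_root hp⟩
      rw [hsupport, hw]
      exact mem_support_leftPath_iff.2 (Or.inl ⟨1, he, rfl⟩)
    · refine ⟨p.penultimate, ?_, by simp, penultimate_ne_root hp⟩
      rw [hsupport, hw]
      exact mem_support_rightPath_iff.2 (Or.inl ⟨_, Nat.le_sub_one_of_lt hτ.lt_length, rfl⟩)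

theorem exists_mem_covered_of_isCycle (hH : AtMostOneCycle H) (hp : p.IsCycle) {y : V}
    (hy : y ≠ r) (hry : H.Reachable r y) :
    ∃ v ∈ (H.neighborSet r ∪ {v | v ∈ p.support}) \ {r}, y ∈ covered H r {v} := by
  obtain ⟨e, τ, hτ⟩ := exists_isTail hp hry
  rcases Nat.eq_zero_or_pos e with rfl | he
  · have hadj := Walk.adj_snd (p := leftPath p 0 τ) (Walk.not_nil_of_ne hy.symm)
    refine ⟨(leftPath p 0 τ).snd, ⟨Or.inl hadj, hadj.ne'⟩,
      mem_covered_of_forall_isPath hadj.ne' hry fun w hw => ?_⟩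
    rw [(hτ.eq_leftPath_or_eq_rightPath hH hp hw).resolve_right fun h => h.1.false]
    exact Walk.getVert_mem_support _ _
  · exact ⟨p.getVert e, ⟨Or.inr (p.getVert_mem_support e), getVert_ne_root hp he hτ.lt_length⟩,
      hτ.mem_covered_of_mem_support hH hp he τ.start_mem_support⟩

end RootCycleCovered

section Bypassed

variable {V : Type*} {H : SimpleGraph V} {r x y : V}

/-- `y` lies on a path from `r` to `x`, but `x` can also be reached without passing through `y`.
On such vertices the protection of `y` helps to save `x` only together with a further vertex. -/
def Bypassed (H : SimpleGraph V) (r y x : V) : Prop :=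
  y ≠ r ∧ x ∈ region H r {y} ∧ ∃ w : H.Walk r x, w.IsPath ∧ y ∈ w.support

namespace Bypassed

theorem exists_isPath (h : Bypassed H r y x) :
    ∃ w w' : H.Walk r x, w.IsPath ∧ w'.IsPath ∧ y ∈ w.support ∧ y ∉ w'.support := by
  obtain ⟨hyr, hx, w, hw, hy⟩ := h
  obtain ⟨w', hw', h'⟩ := (mem_region_iff_exists_isPath (by simpa using hyr.symm)).1 hx
  exact ⟨w, w', hw, hw', hy, fun h => h' y h rfl⟩

theorem reachable (h : Bypassed H r y x) : H.Reachable r x := by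
  obtain ⟨-, -, w, -⟩ := h
  exact ⟨w⟩

theorem pos_of_isTail {p : H.Walk r r} {e : ℕ} {τ : H.Walk (p.getVert e) x}
    (h : Bypassed H r y x) (hτ : IsTail p e τ) (hH : AtMostOneCycle H) (hp : p.IsCycle) :
    0 < e := by
  obtain ⟨w, w', hw, hw', hy, hy'⟩ := h.exists_isPath
  by_contra! he
  have hleft {q : H.Walk r x} (hq : q.IsPath) : q = leftPath p e τ :=
    (hτ.eq_leftPath_or_eq_rightPath hH hp hq).resolve_right fun h => h.1.not_ge he
  exact hy' (hleft hw' ▸ hleft hw ▸ hy)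

theorem exists_getVert_eq_of_mem_leftPath {p : H.Walk r r} {e : ℕ} {τ : H.Walk (p.getVert e) x}
    (h : Bypassed H r y x) (hτ : IsTail p e τ) (hH : AtMostOneCycle H) (hp : p.IsCycle)
    (hy : y ∈ (leftPath p e τ).support) : ∃ a, 0 < a ∧ a < e ∧ p.getVert a = y := by
  obtain ⟨-, w', -, hw', -, hy'⟩ := h.exists_isPath
  have hyτ : y ∉ τ.support := fun hy => hy' (hτ.support_subset hH hp hw' hy)
  obtain ⟨a, hae, rfl⟩ := (mem_support_leftPath_iff.1 hy).resolve_right hyτ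
  exact ⟨a, Nat.pos_of_ne_zero fun h0 => h.1 (by simp [h0]),
    hae.lt_of_ne (by rintro rfl; exact hyτ τ.start_mem_support), rfl⟩

end Bypassed

end Bypassed

/-! ### Graphs without a root cycle -/

section NoRootCycle

variable {V : Type} {H : SimpleGraph V} {r x y z : V}

theorem exists_isRootCycle_of_ne {v v' : V} (h : H.Adj r v) (h' : H.Adj r v') (hne : v ≠ v')
    {q : H.Walk v y} {q' : H.Walk v' y} (hq : r ∉ q.support) (hq' : r ∉ q'.support) :
    ∃ C, IsRootCycle H r C := by
  classical
  have hreach : (H.deleteEdges {s(r, v)}).Reachable r v := by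
    refine reachable_deleteEdges_iff_exists_walk.2
      ⟨Walk.cons h' (q'.append q.reverse), fun hmem => ?_⟩
    simp only [Walk.edges_cons, List.mem_cons, Walk.edges_append, List.mem_append,
      Walk.edges_reverse, List.mem_reverse] at hmem
    rcases hmem with hmem | hmem | hmem
    · rcases Sym2.eq_iff.1 hmem with ⟨-, hv⟩ | ⟨hr, -⟩
      exacts [hne hv, h'.ne hr]
    · exact hq' (Walk.fst_mem_support_of_mem_edges _ hmem)
    · exact hq (Walk.fst_mem_support_of_mem_edges _ hmem)
  obtain ⟨u, c, hc, hce⟩ := adj_and_reachable_delete_edges_iff_exists_cycle.1 ⟨h, hreach⟩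
  have hr := Walk.fst_mem_support_of_mem_edges _ hce
  exact ⟨_, c.rotate r hr, hc.rotate hr, rfl⟩

theorem snd_eq_of_no_rootCycle (hno : ¬ ∃ C, IsRootCycle H r C) (hy : y ≠ r)
    {w w' : H.Walk r y} (hw : w.IsPath) (hw' : w'.IsPath) : w.snd = w'.snd := by
  cases w with
  | nil => exact absurd rfl hy
  | cons h q =>
    cases w' with
    | nil => exact absurd rfl hy
    | cons h' q' =>
      rw [Walk.cons_isPath_iff] at hw hw'
      by_contra hne
      exact hno (exists_isRootCycle_of_ne h h' (by simpa using hne) hw.2 hw'.2)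

theorem mem_covered_snd_of_no_rootCycle (hno : ¬ ∃ C, IsRootCycle H r C) (hy : y ≠ r)
    {w : H.Walk r y} (hw : w.IsPath) : y ∈ covered H r {w.snd} := by
  have hadj := Walk.adj_snd (p := w) (Walk.not_nil_of_ne hy.symm)
  refine mem_covered_of_forall_isPath hadj.ne' ⟨w⟩ fun w' hw' => ?_
  rw [snd_eq_of_no_rootCycle hno hy hw hw']
  exact Walk.getVert_mem_support _ _

theorem exists_mem_covered_of_no_rootCycle (hno : ¬ ∃ C, IsRootCycle H r C) (hy : y ≠ r)
    (hry : H.Reachable r y) : ∃ v ∈ H.neighborSet r, y ∈ covered H r {v} := by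
  obtain ⟨w, hw⟩ := hry.exists_isPath
  exact ⟨w.snd, Walk.adj_snd (Walk.not_nil_of_ne hy.symm),
    mem_covered_snd_of_no_rootCycle hno hy hw⟩

theorem AtMostOneCycle.exists_mem_support_of_bypassed (hH : AtMostOneCycle H)
    (hex : ∃ y x, Bypassed H r y x) :
    ∃ a ≠ r, ∀ y x, Bypassed H r y x → ∃ w : H.Walk r x, w.IsPath ∧ a ∈ w.support := by
  obtain ⟨y, x, h⟩ := hex
  obtain ⟨w, w', hw, hw', hy, hy'⟩ := h.exists_isPath
  obtain ⟨u, v, q, q', -, -, hc⟩ := hw.exists_isCycle_of_ne hw' (fun h => hy' (h ▸ hy))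
  obtain ⟨f, hf, a, haf, har⟩ : ∃ f ∈ (q.append q'.reverse).edges, ∃ a ∈ f, a ≠ r := by
    have hadj := Walk.adj_snd hc.not_nil
    refine ⟨_, Walk.mk_start_snd_mem_edges hc.not_nil, ?_⟩
    by_cases hu : u = r
    · exact ⟨_, Sym2.mem_mk_right _ _, hu ▸ hadj.ne'⟩
    · exact ⟨u, Sym2.mem_mk_left _ _, hu⟩
  refine ⟨a, har, fun y x h => ?_⟩
  obtain ⟨w, w', hw, hw', hy, hy'⟩ := h.exists_isPath
  by_cases hfw : f ∈ w.edges
  · exact ⟨w, hw, Walk.mem_support_of_mem_edges hfw haf⟩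
  by_cases hfw' : f ∈ w'.edges
  · exact ⟨w', hw', Walk.mem_support_of_mem_edges hfw' haf⟩
  · exact absurd (hH.eq_of_notMem_edges hc hf hw hw' hfw hfw' ▸ hy) hy'

/-- The only cycle does not pass through `r`, so all vertices with two paths from `r` lie behind
the first vertex of a path to the cycle. -/
theorem exists_covered_of_bypassed (hH : AtMostOneCycle H) (hno : ¬ ∃ C, IsRootCycle H r C) :
    ∃ z, ∀ y x, Bypassed H r y x → z ∈ H.neighborSet r ∧ x ∈ covered H r {z} := by
  classical
  by_cases hex : ∃ y x, Bypassed H r y x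
  swap
  · exact ⟨r, fun y x h => absurd ⟨y, x, h⟩ hex⟩
  obtain ⟨a, har, hpath⟩ := hH.exists_mem_support_of_bypassed hex
  obtain ⟨y₀, x₀, h₀⟩ := hex
  obtain ⟨w₀, hw₀, ha₀⟩ := hpath y₀ x₀ h₀
  refine ⟨(w₀.takeUntil a ha₀).snd, fun y x h => ?_⟩
  obtain ⟨w, hw, haw⟩ := hpath y x h
  have hxr : x ≠ r := by
    rintro rfl
    rw [(Walk.isPath_iff_nil.1 hw).eq_nil] at haw
    exact har (by simpa using haw)
  rw [snd_eq_of_no_rootCycle hno har (hw₀.takeUntil ha₀) (hw.takeUntil haw),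
    Walk.snd_takeUntil har]
  exact ⟨Walk.adj_snd (Walk.not_nil_of_ne hxr.symm), mem_covered_snd_of_no_rootCycle hno hxr hw⟩

end NoRootCycle

theorem AtMostOneCycle.isAcyclic_deleteEdges {V : Type*} {G : SimpleGraph V}
    (hG : AtMostOneCycle G) {u : V} {p : G.Walk u u} (hp : p.IsCycle) {e : Sym2 V}
    (he : e ∈ p.edges) : (G.deleteEdges {e}).IsAcyclic := by
  intro v q hq
  have hmem := (hG _ _ p _ hp (hq.mapLe (deleteEdges_le _)) e).1 he
  rw [Walk.edges_mapLe_eq_edges] at hmem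
  simpa using Walk.edges_subset_edgeSet _ hmem

theorem atMostOneCycle_of_isAcyclic_deleteEdges {V : Type*} {G : SimpleGraph V}
    (h : ∀ (u : V) (p : G.Walk u u), p.IsCycle → ∀ e ∈ p.edges, (G.deleteEdges {e}).IsAcyclic) :
    AtMostOneCycle G := by
  have hsubset : ∀ (u v : V) (p : G.Walk u u) (q : G.Walk v v), p.IsCycle → q.IsCycle →
      ∀ e ∈ p.edges, e ∈ q.edges := by
    intro u v p q hp hq e he
    by_contra heq
    exact h u p hp e he _ (hq.toDeleteEdges (G := G) {e} fun f hf hfe => heq (hfe ▸ hf))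
  exact fun u v p q hp hq e => ⟨hsubset u v p q hp hq e, hsubset v u q p hq hp e⟩

/-! ### The reduced graph -/

section Reduced

variable {V : Type} {G : SimpleGraph V} {r : V} {B P : Set V}

open Classical in
/-- The contraction of `B` to `r`. -/
noncomputable def contract (B : Set V) (r x : V) : V := if x ∈ B then r else x

theorem contract_of_mem {x : V} (h : x ∈ B) : contract B r x = r := if_pos h

theorem contract_of_notMem {x : V} (h : x ∉ B) : contract B r x = x := if_neg h

theorem reduced_adj {a b : V} :
    (reduced G r B P).Adj a b ↔ a ≠ b ∧ ∃ x y, G.Adj x y ∧ x ∉ P ∧ y ∉ P ∧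
      contract B r x = a ∧ contract B r y = b :=
  Iff.rfl

theorem exists_map_contract_eq {e : Sym2 V} (he : e ∈ (reduced G r B P).edgeSet) :
    ∃ f ∈ G.edgeSet, f.map (contract B r) = e := by
  induction e with
  | _ a b =>
    obtain ⟨-, x, y, hxy, -, -, rfl, rfl⟩ := reduced_adj.1 he
    exact ⟨s(x, y), hxy, rfl⟩

theorem reduced_adj_of_notMem {a b : V} (hab : G.Adj a b) (ha : a ∉ B) (hb : b ∉ B)
    (haP : a ∉ P) (hbP : b ∉ P) : (reduced G r B P).Adj a b :=
  reduced_adj.2 ⟨hab.ne, a, b, hab, haP, hbP, contract_of_notMem ha, contract_of_notMem hb⟩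

theorem notMem_of_reduced_adj {a b : V} (hab : (reduced G r B P).Adj a b) (ha : a ≠ r) :
    a ∉ B ∧ a ∉ P := by
  obtain ⟨-, x, -, -, hx, -, rfl, -⟩ := reduced_adj.1 hab
  by_cases hxB : x ∈ B
  · exact absurd (contract_of_mem hxB) ha
  · rw [contract_of_notMem hxB]
    exact ⟨hxB, hx⟩

theorem notMem_of_reduced_reachable {a : V} (hra : (reduced G r B P).Reachable r a)
    (ha : a ≠ r) : a ∉ B ∧ a ∉ P := by
  obtain ⟨w⟩ := hra.symm
  cases w with
  | nil => exact absurd rfl ha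
  | cons hab _ => exact notMem_of_reduced_adj hab ha

/-- The sets `B` of burning and `P` of protected vertices can occur during a play with fire source
`r`: `B` contains `r`, is connected, and is disjoint from `P`. -/
structure IsState (G : SimpleGraph V) (r : V) (B P : Set V) : Prop where
  root : r ∈ B
  disjoint : ∀ v ∈ B, v ∉ P
  connected : ∀ b ∈ B, b ∈ region G r Bᶜ

namespace IsState

variable {S : Set V}

theorem union (h : IsState G r B P) (hS : ∀ v ∈ S, v ∉ B) : IsState G r B (P ∪ S) :=
  ⟨h.root, fun v hv hvP => hvP.elim (h.disjoint v hv) fun hvS => hS v hvS hv, h.connected⟩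

theorem eq_or_mem_of_contract_eq (h : IsState G r B P) {x y : V}
    (hxy : contract B r x = contract B r y) : x = y ∨ (x ∈ B ∧ y ∈ B) := by
  by_cases hx : x ∈ B <;> by_cases hy : y ∈ B
  · exact Or.inr ⟨hx, hy⟩
  · rw [contract_of_mem hx, contract_of_notMem hy] at hxy
    exact absurd (hxy ▸ h.root) hy
  · rw [contract_of_notMem hx, contract_of_mem hy] at hxy
    exact absurd (hxy ▸ h.root) hx
  · rw [contract_of_notMem hx, contract_of_notMem hy] at hxy
    exact Or.inl hxy

theorem subset_region (h : IsState G r B P) : B ⊆ region G r P := fun b hb =>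
  region_anti G r (fun v hv hvB => h.disjoint v hvB hv) (h.connected b hb)

theorem root_adj (h : IsState G r B P) {a b : V} (hab : G.Adj a b) (ha : a ∈ B)
    (hb : b ∉ B) (hbP : b ∉ P) : (reduced G r B P).Adj r b :=
  reduced_adj.2 ⟨fun hrb => hb (hrb ▸ h.root), a, b, hab, h.disjoint a ha, hbP,
    contract_of_mem ha, contract_of_notMem hb⟩

theorem mem_region_of_walk_contract (h : IsState G r B P) {a d : V}
    (w : (reduced G r B P).Walk a d) (hd : d = r) {x : V} (hx : contract B r x = a)
    (hxP : x ∉ P) : x ∈ region G r P := by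
  induction w generalizing x with
  | nil =>
    apply h.subset_region
    by_contra hxB
    rw [contract_of_notMem hxB] at hx
    exact hxB (hx.trans hd ▸ h.root)
  | cons hab _ ih =>
    obtain ⟨-, y, z, hyz, hy, hz, hya, hzb⟩ := reduced_adj.1 hab
    rcases h.eq_or_mem_of_contract_eq (hx.trans hya.symm) with rfl | ⟨hxB, -⟩
    · exact mem_region_of_adj (ih hd hzb hz) hz hyz.symm hy
    · exact h.subset_region hxB

theorem reachable_contract_of_walk (h : IsState G r B P) {a d : V}
    (w : (deleteVerts G P).Walk a d) (hd : d = r) :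
    (reduced G r B P).Reachable r (contract B r a) := by
  induction w with
  | nil => rw [hd, contract_of_mem h.root]
  | @cons a b _ hab _ ih =>
    obtain ⟨hadj, ha, hb⟩ := deleteVerts_adj.1 hab
    by_cases heq : contract B r a = contract B r b
    · exact heq ▸ ih hd
    · exact (ih hd).trans
        (reduced_adj.2 ⟨Ne.symm heq, b, a, hadj.symm, hb, ha, rfl, rfl⟩ :
          (reduced G r B P).Adj _ _).reachable

theorem reachable_iff (h : IsState G r B P) {x : V} (hx : x ∉ B) :
    (reduced G r B P).Reachable r x ↔ x ∈ region G r P := by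
  constructor
  · intro hrx
    have hxr : x ≠ r := fun hxr => hx (hxr ▸ h.root)
    obtain ⟨w⟩ := hrx.symm
    exact h.mem_region_of_walk_contract w rfl (contract_of_notMem hx)
      (notMem_of_reduced_reachable hrx hxr).2
  · intro hrx
    obtain ⟨w⟩ := Reachable.symm hrx
    simpa only [contract_of_notMem hx] using h.reachable_contract_of_walk w rfl

theorem deleteVerts_reduced (h : IsState G r B P) (hS : ∀ v ∈ S, v ∉ B) :
    deleteVerts (reduced G r B P) S = reduced G r B (P ∪ S) := by
  have hcontract : ∀ x, x ∉ P → (contract B r x ∉ S ↔ x ∉ P ∪ S) := by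
    intro x hx
    by_cases hxB : x ∈ B
    · rw [contract_of_mem hxB]
      exact iff_of_true (fun hr => hS r hr h.root) fun hx' => hx'.elim hx fun hxS => hS x hxS hxB
    · rw [contract_of_notMem hxB]
      simp [hx]
  ext a b
  rw [deleteVerts_adj]
  constructor
  · rintro ⟨hab, ha, hb⟩
    obtain ⟨hne, x, y, hxy, hx, hy, rfl, rfl⟩ := reduced_adj.1 hab
    exact reduced_adj.2
      ⟨hne, x, y, hxy, (hcontract x hx).1 ha, (hcontract y hy).1 hb, rfl, rfl⟩
  · intro hab
    obtain ⟨hne, x, y, hxy, hx, hy, rfl, rfl⟩ := reduced_adj.1 hab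
    have hx' := fun h => hx (Or.inl h)
    have hy' := fun h => hy (Or.inl h)
    exact ⟨reduced_adj.2 ⟨hne, x, y, hxy, hx', hy', rfl, rfl⟩, (hcontract x hx').2 hx,
      (hcontract y hy').2 hy⟩

theorem mem_region_reduced (h : IsState G r B P) (hS : ∀ v ∈ S, v ∉ B) {x : V} (hx : x ∉ B) :
    x ∈ region (reduced G r B P) r S ↔ x ∈ region G r (P ∪ S) := by
  rw [region, Set.mem_ofPred_eq, h.deleteVerts_reduced hS]
  exact (h.union hS).reachable_iff hx

theorem covered_reduced_sdiff (h : IsState G r B P) (hS : ∀ v ∈ S \ {r}, v ∉ B) :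
    covered (reduced G r B P) r S = region G r P \ region G r (P ∪ S \ {r}) := by
  rw [covered_eq_region_sdiff]
  ext x
  rw [Set.mem_sdiff, Set.mem_sdiff, mem_region_empty]
  by_cases hx : x ∈ B
  · refine iff_of_false (fun hx' => ?_) fun hx' => hx'.2 ((h.union hS).subset_region hx)
    by_cases hxr : x = r
    · exact hx'.2 (hxr ▸ self_mem_region _ _ _)
    · exact (notMem_of_reduced_reachable hx'.1 hxr).1 hx
  · rw [h.reachable_iff hx, h.mem_region_reduced hS hx]

theorem covered_reduced (h : IsState G r B P) (hS : ∀ v ∈ S, v ∉ B) :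
    covered (reduced G r B P) r S = region G r P \ region G r (P ∪ S) := by
  rw [h.covered_reduced_sdiff fun v hv => hS v hv.1, Set.sdiff_singleton_eq_self]
  exact fun hr => hS r hr h.root

/-- Walks in the reduced graph lift to `G`, since two vertices with the same image are connected
by edges that are contracted to `r`. -/
theorem reachable_deleteEdges_preimage (h : IsState G r B P) {F : Set (Sym2 V)}
    (hF : ∀ f ∈ F, ¬ f.IsDiag) {a c : V}
    (hac : ((reduced G r B P).deleteEdges F).Reachable a c) {x y : V}
    (hx : contract B r x = a) (hy : contract B r y = c) :
    (G.deleteEdges (Sym2.map (contract B r) ⁻¹' F)).Reachable x y := by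
  have hburning : ∀ b ∈ B, (G.deleteEdges (Sym2.map (contract B r) ⁻¹' F)).Reachable r b := by
    intro b hb
    refine Reachable.mono (fun u v huv => ?_) (h.connected b hb)
    obtain ⟨hadj, hu, hv⟩ := deleteVerts_adj.1 huv
    refine deleteEdges_adj.2 ⟨hadj, fun hmem => hF _ hmem ?_⟩
    rw [Sym2.map_mk, contract_of_mem (not_not.1 hu), contract_of_mem (not_not.1 hv)]
    exact Sym2.mk_isDiag_iff.2 rfl
  have hfibre : ∀ u v, contract B r u = contract B r v →
      (G.deleteEdges (Sym2.map (contract B r) ⁻¹' F)).Reachable u v := by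
    intro u v huv
    rcases h.eq_or_mem_of_contract_eq huv with rfl | ⟨hu, hv⟩
    · exact Reachable.refl _
    · exact (hburning u hu).symm.trans (hburning v hv)
  obtain ⟨w⟩ := hac
  induction w generalizing x with
  | nil => exact hfibre x y (hx.trans hy.symm)
  | cons hab _ ih =>
    obtain ⟨hab, habF⟩ := deleteEdges_adj.1 hab
    obtain ⟨-, u, v, huv, -, -, hua, hvb⟩ := reduced_adj.1 hab
    refine (hfibre x u (hx.trans hua.symm)).trans ((Adj.reachable ?_).trans (ih hvb hy))
    refine deleteEdges_adj.2 ⟨huv, fun hmem => habF ?_⟩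
    rwa [Set.mem_preimage, Sym2.map_mk, hua, hvb] at hmem

theorem exists_isCycle_deleteEdges_preimage (h : IsState G r B P) {F : Set (Sym2 V)}
    (hF : ∀ f ∈ F, ¬ f.IsDiag) {u : V} {c : ((reduced G r B P).deleteEdges F).Walk u u}
    (hc : c.IsCycle) {f : Sym2 V} (hf : f ∈ G.edgeSet) (hfc : f.map (contract B r) ∈ c.edges) :
    ∃ v, ∃ c' : (G.deleteEdges (Sym2.map (contract B r) ⁻¹' F)).Walk v v,
      c'.IsCycle ∧ f ∈ c'.edges := by
  induction f with
  | _ x y =>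
    rw [Sym2.map_mk] at hfc
    obtain ⟨hadj, hreach⟩ := adj_and_reachable_delete_edges_iff_exists_cycle.2 ⟨u, c, hc, hfc⟩
    obtain ⟨hadj, hnotMem⟩ := deleteEdges_adj.1 hadj
    rw [deleteEdges_deleteEdges] at hreach
    refine adj_and_reachable_delete_edges_iff_exists_cycle.1
      ⟨deleteEdges_adj.2 ⟨hf, hnotMem⟩, ?_⟩
    rw [deleteEdges_deleteEdges]
    refine Reachable.mono (deleteEdges_anti (Set.union_subset_union_right _ ?_))
      (h.reachable_deleteEdges_preimage ?_ hreach rfl rfl)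
    · rintro _ rfl
      rfl
    · rintro g (hg | rfl)
      · exact hF g hg
      · exact Sym2.mk_isDiag_iff.not.2 hadj.ne

theorem atMostOneCycle_reduced (h : IsState G r B P) (hG : AtMostOneCycle G) :
    AtMostOneCycle (reduced G r B P) := by
  refine atMostOneCycle_of_isAcyclic_deleteEdges fun u p hp e he v q hq => ?_
  have he' := p.edges_subset_edgeSet he
  obtain ⟨f, hf, rfl⟩ := exists_map_contract_eq he'
  obtain ⟨u', p', hp', hfp'⟩ := h.exists_isCycle_deleteEdges_preimage (F := ∅) (by simp)
    (hp.toDeleteEdges (G := reduced G r B P) ∅ (by simp)) hf (by rwa [Walk.edges_transfer])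
  have hacyclic := hG.isAcyclic_deleteEdges (hp'.mapLe (deleteEdges_le _))
    (by rwa [Walk.edges_mapLe_eq_edges])
  have hmem := Walk.mk_start_snd_mem_edges hq.not_nil
  obtain ⟨g, hg, hgq⟩ := exists_map_contract_eq (e := s(v, q.snd))
    (deleteEdges_le _ (Walk.adj_snd hq.not_nil))
  obtain ⟨v', q', hq', -⟩ := h.exists_isCycle_deleteEdges_preimage
    (by rintro _ rfl; exact not_isDiag_of_mem_edgeSet _ he') hq hg (hgq ▸ hmem)
  refine hacyclic _ (hq'.mapLe (deleteEdges_anti ?_))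
  rintro _ rfl
  rfl

end IsState

end Reduced

/-! ### A single iteration of the algorithm -/

section Iteration

variable {V : Type} {H : SimpleGraph V} {r : V} {C Q X : Set V}

theorem le_two_mul_sqrt_card_mul [Finite V] [Nonempty V] {a b : ℝ} (hb : 0 ≤ b)
    (h : a ≤ 2 * b) : a ≤ 2 * √(Nat.card V : ℝ) * b := by
  have hcard : (1 : ℝ) ≤ √(Nat.card V : ℝ) := by
    rw [Real.one_le_sqrt]
    exact_mod_cast Nat.card_pos
  nlinarith

theorem sqrt_weight_le [Finite V] (H : SimpleGraph V) (r : V) (S : Set V) :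
    √(weight H r S : ℝ) ≤ √(Nat.card V : ℝ) :=
  Real.sqrt_le_sqrt (Nat.cast_le.2 (Set.ncard_le_card _))

theorem subset_covered (hQ : ∀ v ∈ Q, H.Reachable r v ∧ v ≠ r) : Q ⊆ covered H r Q :=
  fun v hv => ⟨(hQ v hv).1.symm, fun q _ => ⟨v, q.start_mem_support, hv, (hQ v hv).2⟩⟩

theorem ncard_le_weight [Finite V] (hQ : ∀ v ∈ Q, H.Reachable r v ∧ v ≠ r) :
    Q.ncard ≤ weight H r Q :=
  Set.ncard_le_ncard (subset_covered hQ) (Set.toFinite _)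

theorem weight_le_of_no_rootCycle [Finite V] (hno : ¬ ∃ C, IsRootCycle H r C) {v y : V}
    (hmax : ∀ u ∈ H.neighborSet r, weight H r {u} ≤ weight H r {v}) (hy : y ≠ r)
    (hry : H.Reachable r y) : weight H r {y} ≤ weight H r {v} := by
  obtain ⟨u, hu, hyu⟩ := exists_mem_covered_of_no_rootCycle hno hy hry
  exact (weight_mono (covered_subset_of_mem hyu)).trans (hmax u hu)

theorem ncard_le_weight_of_no_rootCycle [Finite V] (hH : AtMostOneCycle H)
    (hno : ¬ ∃ C, IsRootCycle H r C) {v : V}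
    (hmax : ∀ u ∈ H.neighborSet r, weight H r {u} ≤ weight H r {v})
    (hX : ∀ x ∈ X, ∃ y, Bypassed H r y x) : X.ncard ≤ weight H r {v} := by
  rcases X.eq_empty_or_nonempty with rfl | ⟨x₀, hx₀⟩
  · simp
  obtain ⟨z, hz⟩ := exists_covered_of_bypassed hH hno
  obtain ⟨y₀, hy₀⟩ := hX x₀ hx₀
  have hXz : X ⊆ covered H r {z} := fun x hx => (hX x hx).elim fun y hy => (hz y x hy).2
  exact (Set.ncard_le_ncard hXz (Set.toFinite _)).trans (hmax z (hz y₀ x₀ hy₀).1)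

theorem neighborSet_inter_subset (H : SimpleGraph V) (r : V) (C : Set V) :
    H.neighborSet r ∩ C ⊆ (H.neighborSet r ∪ C) \ {r} :=
  fun _ hv => ⟨Or.inl hv.1, fun h => H.loopless.irrefl r (Set.mem_singleton_iff.1 h ▸ hv.1)⟩

theorem AreHeaviest.weight_le {v₁ v₂ u : V} (h : AreHeaviest H r C v₁ v₂)
    (hu : u ∈ (H.neighborSet r ∪ C) \ {r}) : weight H r {u} ≤ weight H r {v₁} := by
  obtain ⟨-, -, -, hle, hmax⟩ := h
  by_cases huv : u = v₁
  · rw [huv]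
  · exact (hmax u hu huv).trans hle

namespace IsRootCycle

theorem reachable (hC : IsRootCycle H r C) {v : V} (hv : v ∈ (H.neighborSet r ∪ C) \ {r}) :
    H.Reachable r v ∧ v ≠ r := by
  classical
  obtain ⟨p, -, rfl⟩ := hC
  refine ⟨?_, hv.2⟩
  rcases hv.1 with h | h
  · exact Adj.reachable h
  · exact ⟨p.takeUntil v h⟩

theorem exists_neighborSet_inter_eq (hC : IsRootCycle H r C) (hH : AtMostOneCycle H) :
    ∃ a b, a ≠ b ∧ H.neighborSet r ∩ C = {a, b} := by
  obtain ⟨p, hp, rfl⟩ := hC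
  exact ⟨_, _, hp.snd_ne_penultimate, hH.neighborSet_inter_support hp⟩

theorem weight_neighborSet_inter (hC : IsRootCycle H r C) (hH : AtMostOneCycle H) :
    weight H r (H.neighborSet r ∩ C) = weight H r C := by
  obtain ⟨p, hp, rfl⟩ := hC
  rw [weight, covered_neighborSet_inter_support hH hp, weight]

theorem ncard_le_weight_of_bypassed [Finite V] (hC : IsRootCycle H r C) (hH : AtMostOneCycle H)
    (hX : ∀ x ∈ X, ∃ y, Bypassed H r y x) : X.ncard ≤ weight H r C := by
  obtain ⟨p, hp, rfl⟩ := hC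
  refine Set.ncard_le_ncard (fun x hx => ?_) (Set.toFinite _)
  obtain ⟨y, hy⟩ := hX x hx
  obtain ⟨e, τ, hτ⟩ := exists_isTail hp hy.reachable
  exact (hτ.mem_covered_support_iff hH hp).2 (hy.pos_of_isTail hτ hH hp)

theorem weight_le [Finite V] (hC : IsRootCycle H r C) (hH : AtMostOneCycle H) {v₁ v₂ y : V}
    (hv : AreHeaviest H r C v₁ v₂) (hy : y ≠ r) (hry : H.Reachable r y) :
    weight H r {y} ≤ weight H r {v₁} := by
  obtain ⟨p, hp, rfl⟩ := hC
  obtain ⟨v, hvS, hyv⟩ := exists_mem_covered_of_isCycle hH hp hy hry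
  exact (weight_mono (covered_subset_of_mem hyv)).trans (hv.weight_le hvS)

theorem exists_areHeaviest [Finite V] (hC : IsRootCycle H r C) (hH : AtMostOneCycle H) :
    ∃ v₁ v₂, AreHeaviest H r C v₁ v₂ := by
  obtain ⟨a, b, hab, heq⟩ := hC.exists_neighborSet_inter_eq hH
  have ha : a ∈ H.neighborSet r ∩ C := heq ▸ Set.mem_insert a {b}
  have hb : b ∈ H.neighborSet r ∩ C := heq ▸ Set.mem_insert_of_mem a rfl
  replace ha := neighborSet_inter_subset H r C ha
  replace hb := neighborSet_inter_subset H r C hb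
  obtain ⟨v₁, hv₁, hmax₁⟩ := Set.exists_max_image ((H.neighborSet r ∪ C) \ {r})
    (fun v => weight H r {v}) (Set.toFinite _) ⟨a, ha⟩
  have hnonempty : (((H.neighborSet r ∪ C) \ {r}) \ {v₁}).Nonempty := by
    by_cases h : a = v₁
    · exact ⟨b, hb, fun hbv => hab (h.trans hbv.symm)⟩
    · exact ⟨a, ha, h⟩
  obtain ⟨v₂, hv₂, hmax₂⟩ := Set.exists_max_image (((H.neighborSet r ∪ C) \ {r}) \ {v₁})
    (fun v => weight H r {v}) (Set.toFinite _) hnonempty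
  exact ⟨v₁, v₂, hv₁, hv₂.1, Ne.symm hv₂.2, hmax₁ v₂ hv₂.1, fun u hu hne => hmax₂ u ⟨hu, hne⟩⟩

end IsRootCycle

/-- The root cycle `C` may be broken at its vertex `u`: this is the situation in which the last
firefighter of a round is not used for a heaviest vertex. -/
structure Breaks (H : SimpleGraph V) (r : V) (C : Set V) (u : V) : Prop where
  isRootCycle : IsRootCycle H r C
  weight_lt : ∀ y, y ≠ r → H.Reachable r y → (weight H r {y} : ℝ) < √(weight H r C : ℝ)
  mem : u ∈ H.neighborSet r ∩ C
  tol_le : ∀ u' ∈ H.neighborSet r ∩ C,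
    tol H r C u' √(weight H r C : ℝ) ≤ tol H r C u √(weight H r C : ℝ)

namespace AlgAChoice

variable {k : ℕ}

theorem reachable (h : AlgAChoice H r k Q) : ∀ v ∈ Q, H.Reachable r v ∧ v ≠ r := by
  cases h with
  | noRootCycle _ v _ _ hv =>
    rintro _ rfl
    exact ⟨Adj.reachable hv, (Adj.ne hv).symm⟩
  | manyHeaviest _ _ _ _ _ hC hv | oneHeaviest _ _ _ hC hv =>
    rintro _ rfl
    exact hC.reachable hv.1
  | manyCycle _ C _ _ _ hC =>
    exact fun v hv => hC.reachable (neighborSet_inter_subset H r C hv)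
  | breakCycle C _ _ _ hC _ _ hu =>
    rintro _ rfl
    exact hC.reachable (neighborSet_inter_subset H r C hu)

theorem ncard_pos_and_ncard_le (h : AlgAChoice H r k Q) (hH : AtMostOneCycle H) :
    0 < Q.ncard ∧ Q.ncard ≤ k := by
  cases h with
  | noRootCycle _ v hk => simpa using hk
  | manyHeaviest _ _ _ _ hk => exact ⟨by simp, by simpa using (Nat.le_of_succ_le hk)⟩
  | manyCycle _ _ _ _ hk hC =>
    obtain ⟨a, b, hab, heq⟩ := hC.exists_neighborSet_inter_eq hH
    rw [heq, Set.ncard_pair hab]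
    exact ⟨two_pos, hk⟩
  | oneHeaviest => simp
  | breakCycle => simp

theorem ncard_mul_weight_le [Finite V] (h : AlgAChoice H r k Q) (hH : AtMostOneCycle H) {y : V}
    (hy : y ≠ r) (hry : H.Reachable r y) :
    (Q.ncard : ℝ) * weight H r {y} ≤ 2 * √(Nat.card V : ℝ) * weight H r Q := by
  have : Nonempty V := ⟨r⟩
  have hsingleton : ∀ v : V, weight H r {y} ≤ weight H r {v} →
      (({v} : Set V).ncard : ℝ) * weight H r {y} ≤
        2 * √(Nat.card V : ℝ) * weight H r {v} := by
    intro v hv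
    refine le_two_mul_sqrt_card_mul (Nat.cast_nonneg _) ?_
    rw [Set.ncard_singleton]
    exact_mod_cast (by omega : 1 * weight H r {y} ≤ 2 * weight H r {v})
  have hreach := h.reachable
  cases h with
  | noRootCycle _ v _ hno _ hmax => exact hsingleton v (weight_le_of_no_rootCycle hno hmax hy hry)
  | manyHeaviest _ _ _ _ _ hC hv | oneHeaviest _ _ _ hC hv =>
    exact hsingleton _ (hC.weight_le hH hv hy hry)
  | manyCycle _ C v₁ v₂ _ hC hv hw =>
    obtain ⟨a, b, hab, heq⟩ := hC.exists_neighborSet_inter_eq hH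
    have hle := hC.weight_le hH hv hy hry
    rw [hC.weight_neighborSet_inter hH, heq, Set.ncard_pair hab]
    refine le_two_mul_sqrt_card_mul (Nat.cast_nonneg _) ?_
    exact_mod_cast (by omega : 2 * weight H r {y} ≤ 2 * weight H r C)
  | breakCycle C v₁ v₂ u hC hv hw =>
    have hle : (weight H r {y} : ℝ) ≤ weight H r {v₁} := by
      exact_mod_cast hC.weight_le hH hv hy hry
    have hpos : (1 : ℝ) ≤ weight H r {u} := by
      simpa using (Nat.cast_le (α := ℝ)).2 (ncard_le_weight hreach)
    have hsqrt := sqrt_weight_le H r C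
    rw [Set.ncard_singleton, Nat.cast_one, one_mul]
    nlinarith [Real.sqrt_nonneg (Nat.card V)]

theorem weight_le [Finite V] (h : AlgAChoice H r k Q) (hno : ¬ ∃ C, IsRootCycle H r C) {y : V}
    (hy : y ≠ r) (hry : H.Reachable r y) : weight H r {y} ≤ weight H r Q := by
  cases h with
  | noRootCycle _ v _ _ _ hmax => exact weight_le_of_no_rootCycle hno hmax hy hry
  | manyHeaviest _ _ _ _ _ hC | manyCycle _ _ _ _ _ hC | oneHeaviest _ _ _ hC
  | breakCycle _ _ _ _ hC => exact absurd ⟨_, hC⟩ hno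

theorem ncard_le_or_breaks [Finite V] (h : AlgAChoice H r k Q) (hH : AtMostOneCycle H)
    (hX : ∀ x ∈ X, ∃ y, Bypassed H r y x) :
    (X.ncard : ℝ) ≤ 2 * √(Nat.card V : ℝ) * weight H r Q ∨
      k = 1 ∧ ∃ C u, Breaks H r C u ∧ Q = {u} := by
  have : Nonempty V := ⟨r⟩
  have htwice : ∀ w : ℕ, X.ncard ≤ 2 * w → (X.ncard : ℝ) ≤ 2 * √(Nat.card V : ℝ) * w :=
    fun w hw => le_two_mul_sqrt_card_mul (Nat.cast_nonneg _) (by exact_mod_cast hw)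
  cases h with
  | noRootCycle _ v _ hno _ hmax =>
    have hle := ncard_le_weight_of_no_rootCycle hH hno hmax hX
    exact Or.inl (htwice _ (by omega))
  | manyHeaviest _ C v₁ v₂ _ hC hv hw =>
    have hle := hC.ncard_le_weight_of_bypassed hH hX
    have hsecond := hv.2.2.2.1
    exact Or.inl (htwice _ (by omega))
  | manyCycle _ C v₁ v₂ _ hC =>
    have hle := hC.ncard_le_weight_of_bypassed hH hX
    rw [hC.weight_neighborSet_inter hH]
    exact Or.inl (htwice _ (by omega))
  | oneHeaviest C v₁ v₂ hC _ hw =>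
    have hle : (X.ncard : ℝ) ≤ weight H r C := by
      exact_mod_cast hC.ncard_le_weight_of_bypassed hH hX
    have hsq := Real.mul_self_sqrt (Nat.cast_nonneg (α := ℝ) (weight H r C))
    have hsqrt := sqrt_weight_le H r C
    exact Or.inl (by nlinarith [Real.sqrt_nonneg (weight H r C)])
  | breakCycle C v₁ v₂ u hC hv hw hu hmax =>
    refine Or.inr ⟨rfl, C, u, ⟨hC, fun y hy hry => lt_of_le_of_lt ?_ hw, hu, hmax⟩, rfl⟩
    exact_mod_cast hC.weight_le hH hv hy hry

theorem exists_of_isRootCycle [Finite V] (hC : IsRootCycle H r C) (hH : AtMostOneCycle H)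
    (hk : 0 < k) : ∃ Q, AlgAChoice H r k Q := by
  obtain ⟨v₁, v₂, hv⟩ := hC.exists_areHeaviest hH
  rcases Nat.eq_or_lt_of_le hk with rfl | hk
  · by_cases hw : √(weight H r C : ℝ) ≤ weight H r {v₁}
    · exact ⟨_, oneHeaviest C v₁ v₂ hC hv hw⟩
    · obtain ⟨a, b, -, heq⟩ := hC.exists_neighborSet_inter_eq hH
      obtain ⟨u, hu, hmax⟩ := Set.exists_max_image (H.neighborSet r ∩ C)
        (fun v => tol H r C v √(weight H r C : ℝ)) (Set.toFinite _) (heq ▸ Set.insert_nonempty a _)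
      exact ⟨_, breakCycle C v₁ v₂ u hC hv (not_le.1 hw) hu hmax⟩
  · by_cases hw : weight H r C ≤ weight H r {v₁} + weight H r {v₂}
    · exact ⟨_, manyHeaviest k C v₁ v₂ hk hC hv hw⟩
    · exact ⟨_, manyCycle k C v₁ v₂ hk hC hv (not_le.1 hw)⟩

theorem exists_of_hasAvailable [Finite V] (hH : AtMostOneCycle H) (hk : 0 < k)
    (hav : HasAvailable H r) : ∃ Q, AlgAChoice H r k Q := by
  by_cases hC : ∃ C, IsRootCycle H r C
  · exact hC.elim fun C hC => exists_of_isRootCycle hC hH hk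
  · obtain ⟨y, hy, hry⟩ := hav
    obtain ⟨v₀, hv₀, -⟩ := exists_mem_covered_of_no_rootCycle hC hy hry
    obtain ⟨v, hv, hmax⟩ := Set.exists_max_image (H.neighborSet r)
      (fun v => weight H r {v}) (Set.toFinite _) ⟨v₀, hv₀⟩
    exact ⟨_, noRootCycle k v hk hC hv hmax⟩

end AlgAChoice

end Iteration

/-! ### A round of the algorithm -/

section Round

variable {V : Type} {G : SimpleGraph V} {r y : V} {B P Q : Set V} {k : ℕ}

theorem AlgAChoice.notMem (hQ : AlgAChoice (reduced G r B P) r k Q) : ∀ v ∈ Q, v ∉ B :=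
  fun v hv => (notMem_of_reduced_reachable (hQ.reachable v hv).1 (hQ.reachable v hv).2).1

theorem IsState.weight_reduced (h : IsState G r B P) (hQ : ∀ v ∈ Q, v ∉ B) :
    weight (reduced G r B P) r Q = (region G r P \ region G r (P ∪ Q)).ncard := by
  rw [weight, h.covered_reduced hQ]

theorem IsState.hasAvailable_iff (h : IsState G r B P) :
    HasAvailable (reduced G r B P) r ↔ ∃ y, y ∉ B ∧ y ∈ region G r P := by
  constructor
  · rintro ⟨y, hy, hry⟩
    have hyB := (notMem_of_reduced_reachable hry hy).1
    exact ⟨y, hyB, (h.reachable_iff hyB).1 hry⟩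
  · rintro ⟨y, hy, hry⟩
    exact ⟨y, fun hyr => hy (hyr ▸ h.root), (h.reachable_iff hy).2 hry⟩

theorem ncard_region_sdiff [Finite V] (G : SimpleGraph V) (r : V) {P₁ P₂ P₃ : Set V}
    (h₁ : P₁ ⊆ P₂) (h₂ : P₂ ⊆ P₃) : (region G r P₁ \ region G r P₃).ncard =
      (region G r P₁ \ region G r P₂).ncard + (region G r P₂ \ region G r P₃).ncard := by
  rw [← Set.ncard_union_eq (Set.disjoint_left.2 fun x hx hx' => hx.2 hx'.1) (Set.toFinite _)
    (Set.toFinite _), Set.sdiff_union_sdiff_cancel (region_anti G r h₁) (region_anti G r h₂)]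

theorem ncard_region_sdiff_mono [Finite V] (G : SimpleGraph V) (r : V) {P₁ P₁' P₂ P₂' : Set V}
    (h₁ : P₁ ⊆ P₁') (h₂ : P₂ ⊆ P₂') :
    (region G r P₁' \ region G r P₂).ncard ≤ (region G r P₁ \ region G r P₂').ncard :=
  Set.ncard_le_ncard (Set.sdiff_subset_sdiff (region_anti G r h₁) (region_anti G r h₂))
    (Set.toFinite _)

namespace AlgARound

theorem ncard_le_and_notMem (hG : AtMostOneCycle G) (hR : AlgARound G r B P k Q)
    (h : IsState G r B P) : Q.ncard ≤ k ∧ ∀ v ∈ Q, v ∉ B := by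
  induction hR with
  | finish => simp
  | step P k Q Q' _ _ hQ _ ih =>
    obtain ⟨hcard', hB'⟩ := ih (h.union hQ.notMem)
    have hcard := (hQ.ncard_pos_and_ncard_le (h.atMostOneCycle_reduced hG)).2
    have hunion := Set.ncard_union_le Q Q'
    exact ⟨by omega, fun v hv => hv.elim (hQ.notMem v) (hB' v)⟩

theorem mul_ncard_le [Finite V] (hG : AtMostOneCycle G) (hR : AlgARound G r B P k Q)
    (h : IsState G r B P) (hyB : y ∉ B) (hy : y ∈ region G r (P ∪ Q)) :
    (k : ℝ) * (region G r (P ∪ Q) \ region G r (P ∪ {y})).ncard ≤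
      2 * √(Nat.card V : ℝ) * (region G r P \ region G r (P ∪ Q)).ncard := by
  induction hR with
  | finish P k hk =>
    rcases hk with rfl | hk
    · simp only [Nat.cast_zero, zero_mul]
      positivity
    · exact absurd (h.hasAvailable_iff.2 ⟨y, hyB, by simpa using hy⟩) hk
  | step P k Q Q' _ _ hQ _ ih =>
    have hH := h.atMostOneCycle_reduced hG
    have hyr : y ≠ r := fun hyr => hyB (hyr ▸ h.root)
    have hyP : y ∈ region G r P := region_anti G r Set.subset_union_left hy
    rw [← Set.union_assoc] at hy ⊢
    have hfirst := hQ.ncard_mul_weight_le hH hyr ((h.reachable_iff hyB).2 hyP)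
    rw [h.weight_reduced hQ.notMem, h.weight_reduced (by rintro _ rfl; exact hyB)] at hfirst
    have hrest := ih (h.union hQ.notMem) hy
    have hcard := (hQ.ncard_pos_and_ncard_le hH).2
    rw [Nat.cast_sub hcard] at hrest
    have hle : ((region G r (P ∪ Q ∪ Q') \ region G r (P ∪ {y})).ncard : ℝ) ≤
        (region G r P \ region G r (P ∪ {y})).ncard :=
      Nat.cast_le.2 (ncard_region_sdiff_mono G r
        (Set.subset_union_left.trans Set.subset_union_left) le_rfl)
    have hle' : ((region G r (P ∪ Q ∪ Q') \ region G r (P ∪ {y})).ncard : ℝ) ≤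
        (region G r (P ∪ Q ∪ Q') \ region G r (P ∪ Q ∪ {y})).ncard :=
      Nat.cast_le.2 (ncard_region_sdiff_mono G r le_rfl
        (Set.union_subset_union_left _ Set.subset_union_left))
    rw [ncard_region_sdiff G r (P₂ := P ∪ Q) Set.subset_union_left Set.subset_union_left]
    push_cast
    linarith [mul_le_mul_of_nonneg_left hle (Nat.cast_nonneg (α := ℝ) Q.ncard),
      mul_le_mul_of_nonneg_left hle' (sub_nonneg.2 (Nat.cast_le (α := ℝ).2 hcard))]

theorem le_ncard_region_sdiff [Finite V] (hR : AlgARound G r B P k Q) (h : IsState G r B P)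
    (hyB : y ∉ B) (hy : y ∈ region G r (P ∪ Q)) :
    k ≤ (region G r P \ region G r (P ∪ Q)).ncard := by
  induction hR with
  | finish P k hk =>
    rcases hk with rfl | hk
    · simp
    · exact absurd (h.hasAvailable_iff.2 ⟨y, hyB, by simpa using hy⟩) hk
  | step P k Q Q' _ _ hQ _ ih =>
    rw [← Set.union_assoc] at hy ⊢
    have hrest := ih (h.union hQ.notMem) hy
    have hfirst := ncard_le_weight hQ.reachable
    rw [h.weight_reduced hQ.notMem] at hfirst
    rw [ncard_region_sdiff G r (P₂ := P ∪ Q) Set.subset_union_left Set.subset_union_left]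
    omega

theorem exists_first_choice [Finite V] (hR : AlgARound G r B P k Q) (h : IsState G r B P)
    (hk : 0 < k) (hyB : y ∉ B) (hy : y ∈ region G r P) :
    ∃ Q₁ ⊆ Q, AlgAChoice (reduced G r B P) r k Q₁ ∧
      weight (reduced G r B P) r Q₁ ≤ (region G r P \ region G r (P ∪ Q)).ncard := by
  cases hR with
  | finish _ _ h0 =>
    exact h0.elim (fun h0 => absurd h0 hk.ne')
      fun h0 => absurd (h.hasAvailable_iff.2 ⟨y, hyB, hy⟩) h0
  | step _ _ Q₁ Q₂ _ _ hQ =>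
    refine ⟨Q₁, Set.subset_union_left, hQ, ?_⟩
    rw [h.weight_reduced hQ.notMem]
    exact ncard_region_sdiff_mono G r le_rfl
      (Set.union_subset_union_right _ Set.subset_union_left)

theorem exists_of_isState [Finite V] (hG : AtMostOneCycle G) (h : IsState G r B P) (k : ℕ) :
    ∃ Q, AlgARound G r B P k Q := by
  induction k using Nat.strong_induction_on generalizing P with
  | _ k ih =>
    by_cases hk : k = 0 ∨ ¬ HasAvailable (reduced G r B P) r
    · exact ⟨∅, finish P k hk⟩
    · push Not at hk
      have hpos := Nat.pos_of_ne_zero hk.1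
      have hH := h.atMostOneCycle_reduced hG
      obtain ⟨Q, hQ⟩ := AlgAChoice.exists_of_hasAvailable hH hpos hk.2
      have hcard := hQ.ncard_pos_and_ncard_le hH
      obtain ⟨Q', hQ'⟩ := ih (k - Q.ncard) (by omega) (h.union hQ.notMem)
      exact ⟨Q ∪ Q', step P k Q Q' hpos hk.2 hQ hQ'⟩

end AlgARound

end Round

/-! ### Properties of the game -/

section Game

variable {V : Type} {G : SimpleGraph V} {r : V} {f : ℕ → ℕ} {σ : ℕ → Finset V}

theorem guarded_mono (σ : ℕ → Finset V) {i j : ℕ} (h : i ≤ j) : guarded σ i ⊆ guarded σ j :=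
  fun _ ⟨k, hk, hv⟩ => ⟨k, hk.trans_le h, hv⟩

theorem guarded_succ (σ : ℕ → Finset V) (i : ℕ) :
    guarded σ (i + 1) = guarded σ i ∪ (σ i : Set V) := by
  ext v
  simp only [guarded, Set.mem_ofPred_eq, Set.mem_union, Finset.mem_coe]
  exact Nat.exists_lt_succ_right

theorem burning_mono (G : SimpleGraph V) (r : V) (σ : ℕ → Finset V) {i j : ℕ} (h : i ≤ j) :
    burning G r σ i ⊆ burning G r σ j :=
  monotone_nat_of_le_succ (f := burning G r σ) (fun _ => Set.subset_union_left) h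

theorem root_mem_burning (G : SimpleGraph V) (r : V) (σ : ℕ → Finset V) (i : ℕ) :
    r ∈ burning G r σ i :=
  burning_mono G r σ (Nat.zero_le i) rfl

theorem mem_burning_succ {i : ℕ} {x v : V} (hx : x ∈ burning G r σ i) (h : G.Adj x v)
    (hv : v ∉ guarded σ (i + 1)) : v ∈ burning G r σ (i + 1) :=
  Or.inr ⟨hv, x, hx, h⟩

theorem IsLegal.notMem_guarded (hσ : IsLegal G r f σ) {i j : ℕ} {v : V}
    (hv : v ∈ burning G r σ i) : v ∉ guarded σ j := by
  rintro ⟨k, -, hk⟩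
  have hvk := (hσ k).2 v hk
  induction i with
  | zero => exact hvk (burning_mono G r σ (Nat.zero_le k) hv)
  | succ i ih =>
    rcases hv with hv | ⟨hv, hx⟩
    · exact ih hv
    · rcases lt_or_ge k (i + 1) with hki | hki
      · exact hv ⟨k, hki, hk⟩
      · exact hvk (burning_mono G r σ hki (Or.inr ⟨hv, hx⟩))

theorem burning_subset_region_compl (G : SimpleGraph V) (r : V) (σ : ℕ → Finset V) {i j : ℕ}
    (hij : i ≤ j) : burning G r σ i ⊆ region G r (burning G r σ j)ᶜ := by
  induction i with
  | zero =>
    rintro _ rfl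
    exact self_mem_region _ _ _
  | succ i ih =>
    rintro v (hv | ⟨hvg, x, hx, hxv⟩)
    · exact ih (by omega) hv
    · refine mem_region_of_adj (ih (by omega) hx) (fun h => h ?_) hxv fun h => h ?_
      · exact burning_mono G r σ (by omega) hx
      · exact burning_mono G r σ hij (Or.inr ⟨hvg, x, hx, hxv⟩)

theorem IsLegal.isState (hσ : IsLegal G r f σ) (i : ℕ) :
    IsState G r (burning G r σ i) (guarded σ i) where
  root := root_mem_burning G r σ i
  disjoint := fun _ hv => hσ.notMem_guarded hv
  connected := burning_subset_region_compl G r σ le_rfl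

theorem IsLegal.burning_subset_region (hσ : IsLegal G r f σ) (i j : ℕ) :
    burning G r σ i ⊆ region G r (guarded σ j) :=
  (burning_subset_region_compl G r σ le_rfl).trans
    (region_anti G r fun _ hv hv' => hσ.notMem_guarded hv' hv)

theorem guarded_congr {σ' : ℕ → Finset V} {i : ℕ} (h : ∀ j < i, σ j = σ' j) :
    guarded σ i = guarded σ' i := by
  ext v
  exact exists_congr fun j => and_congr_right fun hj => by rw [h j hj]

theorem burning_congr {σ' : ℕ → Finset V} {i : ℕ} (h : ∀ j < i, σ j = σ' j) :
    burning G r σ i = burning G r σ' i := by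
  induction i with
  | zero => rfl
  | succ i ih => rw [burning, burning, ih fun j hj => h j (by omega), guarded_congr h]

end Game

/-! ### Existence of the algorithm -/

section Existence

variable {V : Type} (G : SimpleGraph V) (r : V) (f : ℕ → ℕ)

/-- `Q` may be protected in round `i` after the moves `σ` of the previous rounds. -/
def IsAlgAMove (σ : ℕ → Finset V) (i k : ℕ) (Q : Finset V) : Prop :=
  (Q.card ≤ k ∧ ∀ v ∈ Q, v ∉ burning G r σ i) ∧
    AlgARound G r (burning G r σ i) (guarded σ i) k (Q : Set V)

open Classical in
/-- A move of the algorithm in round `i` after the moves `σ` of the previous rounds, and `∅` if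
there is none. -/
noncomputable def algAMove (σ : ℕ → Finset V) (i k : ℕ) : Finset V :=
  if h : ∃ Q, IsAlgAMove G r σ i k Q then h.choose else ∅

/-- The moves of the first `n` rounds; the later moves are `∅`. -/
noncomputable def algAHistory : ℕ → ℕ → Finset V
  | 0 => fun _ => ∅
  | n + 1 => Function.update (algAHistory n) n (algAMove G r (algAHistory n) n (f n))

/-- All moves of the algorithm, with some way of breaking ties. -/
noncomputable def algAPlay (i : ℕ) : Finset V := algAMove G r (algAHistory G r f i) i (f i)

theorem algAMove_legal (σ : ℕ → Finset V) (i k : ℕ) :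
    (algAMove G r σ i k).card ≤ k ∧ ∀ v ∈ algAMove G r σ i k, v ∉ burning G r σ i := by
  rw [algAMove]
  split_ifs with h
  · exact h.choose_spec.1
  · simp

theorem algAHistory_eq {n j : ℕ} (h : j < n) : algAHistory G r f n j = algAPlay G r f j := by
  induction n with
  | zero => omega
  | succ n ih =>
    rw [algAHistory]
    rcases (Nat.lt_succ_iff.1 h).lt_or_eq with h | rfl
    · rw [Function.update_of_ne h.ne, ih h]
    · rw [Function.update_self, algAPlay]

theorem algAHistory_congr {f f' : ℕ → ℕ} {n : ℕ} (h : ∀ j < n, f j = f' j) :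
    algAHistory G r f n = algAHistory G r f' n := by
  induction n with
  | zero => rfl
  | succ n ih => rw [algAHistory, algAHistory, ih fun j hj => h j (by omega), h n (by omega)]

theorem burning_algAHistory (i : ℕ) :
    burning G r (algAHistory G r f i) i = burning G r (algAPlay G r f) i :=
  burning_congr fun _ hj => algAHistory_eq G r f hj

theorem guarded_algAHistory (i : ℕ) :
    guarded (algAHistory G r f i) i = guarded (algAPlay G r f) i :=
  guarded_congr fun _ hj => algAHistory_eq G r f hj

theorem isLegal_algAPlay : IsLegal G r f (algAPlay G r f) := fun i => by
  rw [← burning_algAHistory]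
  exact algAMove_legal G r (algAHistory G r f i) i (f i)

variable {G} in
theorem algARound_algAPlay [Finite V] (hG : AtMostOneCycle G) (i : ℕ) :
    AlgARound G r (burning G r (algAPlay G r f) i) (guarded (algAPlay G r f) i) (f i)
      (algAPlay G r f i : Set V) := by
  have hstate := (isLegal_algAPlay G r f).isState i
  have hmove : ∃ Q, IsAlgAMove G r (algAHistory G r f i) i (f i) Q := by
    obtain ⟨Q, hQ⟩ := AlgARound.exists_of_isState hG hstate (f i)
    obtain ⟨hcard, hB⟩ := hQ.ncard_le_and_notMem hG hstate
    lift Q to Finset V using Q.toFinite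
    refine ⟨Q, ?_⟩
    rw [IsAlgAMove, burning_algAHistory, guarded_algAHistory]
    exact ⟨⟨by rwa [← Set.ncard_coe_finset], hB⟩, hQ⟩
  have hround := hmove.choose_spec.2
  rw [burning_algAHistory, guarded_algAHistory] at hround
  rwa [algAPlay, algAMove, dif_pos hmove]

theorem exists_isAlgA : ∃ A : OnlineAlgorithm, A.IsAlgA :=
  ⟨{ move := fun _ G r f => algAPlay G r f
     online := fun V G r f f' i h => by
      rw [algAPlay, algAPlay, algAHistory_congr G r fun j hj => h j hj.le, h i le_rfl]
     legal := fun _ => isLegal_algAPlay },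
    fun _ _ _ hG r f i => algARound_algAPlay r f hG.2 i⟩

end Existence

/-! ### Fire routes -/

section FireRoute

variable {V : Type} {G : SimpleGraph V} {r x : V} {f : ℕ → ℕ} {σ : ℕ → Finset V} {i m : ℕ}

/-- The graph that the algorithm sees at the beginning of round `i`. -/
abbrev roundGraph (G : SimpleGraph V) (r : V) (σ : ℕ → Finset V) (i : ℕ) : SimpleGraph V :=
  reduced G r (burning G r σ i) (guarded σ i)

/-- The fire runs along the first `m` edges of the path `w`, one edge per round and as early as
possible, and the rest of `w` consists of vertices that the fire can still take in round `i`. The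
case `m = w.length` describes a path along which the fire reaches the end of `w`. -/
structure IsFireRoute (G : SimpleGraph V) (r : V) (σ : ℕ → Finset V) (i m : ℕ) (w : G.Walk r x) :
    Prop where
  isPath : w.IsPath
  mem_burning : ∀ j ≤ m, w.getVert j ∈ burning G r σ j
  notMem_burning : ∀ j < m, w.getVert (j + 1) ∉ burning G r σ j
  free : ∀ j, m < j → j ≤ w.length → w.getVert j ∉ burning G r σ i ∧ w.getVert j ∉ guarded σ i

theorem IsState.exists_contracted_path {B P : Set V} (h : IsState G r B P) {w : G.Walk r x}
    (hw : w.IsPath) (hm : m < w.length) (hmB : w.getVert m ∈ B)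
    (hfree : ∀ j, m < j → j ≤ w.length → w.getVert j ∉ B ∧ w.getVert j ∉ P) :
    ∃ w' : (reduced G r B P).Walk r x, w'.IsPath ∧ w'.length = w.length - m ∧
      ∀ j, 0 < j → w'.getVert j = w.getVert (m + j) := by
  have hadj := w.adj_getVert_succ hm
  set q := w.drop (m + 1) with hq_def
  have hq : ∀ v ∈ q.support, v ∉ B ∧ v ∉ P := by
    intro v hv
    obtain ⟨n, rfl, hn⟩ := Walk.mem_support_iff_exists_getVert.1 hv
    rw [hq_def, Walk.drop_length] at hn
    rw [hq_def, Walk.drop_getVert]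
    exact hfree _ (by omega) (by omega)
  have hstart := hq _ q.start_mem_support
  have hedge : ∀ e ∈ q.edges, e ∈ (reduced G r B P).edgeSet := by
    intro e he
    induction e with
    | _ c d =>
    have hc := hq c (q.fst_mem_support_of_mem_edges he)
    have hd := hq d (q.snd_mem_support_of_mem_edges he)
    exact reduced_adj_of_notMem (q.adj_of_mem_edges he) hc.1 hd.1 hc.2 hd.2
  refine ⟨Walk.cons (h.root_adj hadj hmB hstart.1 hstart.2) (q.transfer _ hedge), ?_, ?_, ?_⟩
  · refine Walk.cons_isPath_iff _ _ |>.2 ⟨(hw.drop _).transfer _, fun hr => ?_⟩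
    rw [Walk.support_transfer] at hr
    exact (hq r hr).1 h.root
  · rw [Walk.length_cons, Walk.length_transfer, hq_def, Walk.drop_length]
    omega
  · intro j hj
    obtain ⟨j, rfl⟩ := Nat.exists_eq_add_of_lt hj
    rw [Nat.zero_add, Walk.getVert_cons_succ, Walk.getVert_eq_getD_support, Walk.support_transfer,
      ← Walk.getVert_eq_getD_support, hq_def, Walk.drop_getVert]
    congr 1
    omega

theorem getVert_append_of_le {u v w : V} (p : G.Walk u v) (q : G.Walk v w) {j : ℕ}
    (hj : j ≤ p.length) : (p.append q).getVert j = p.getVert j := by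
  rw [Walk.getVert_append', if_pos hj]

theorem getVert_append_length_add {u v w : V} (p : G.Walk u v) (q : G.Walk v w) (j : ℕ) :
    (p.append q).getVert (p.length + j) = q.getVert j := by
  rw [Walk.getVert_append, if_neg (by omega), Nat.add_sub_cancel_left]

namespace IsFireRoute

theorem mem_burning_of_mem_support {w : G.Walk r x} (h : IsFireRoute G r σ i w.length w) {v : V}
    (hv : v ∈ w.support) : v ∈ burning G r σ w.length := by
  obtain ⟨n, rfl, hn⟩ := Walk.mem_support_iff_exists_getVert.1 hv
  exact burning_mono G r σ hn (h.mem_burning n hn)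

theorem concat {u v : V} {w : G.Walk r u} (h : IsFireRoute G r σ i w.length w) (huv : G.Adj u v)
    (hv : v ∉ guarded σ (w.length + 1)) (hvB : v ∉ burning G r σ w.length) :
    IsFireRoute G r σ i (w.length + 1) (w.concat huv) := by
  have hget {j : ℕ} (hj : j ≤ w.length) : (w.concat huv).getVert j = w.getVert j := by
    rw [Walk.concat_eq_append, getVert_append_of_le _ _ hj]
  have hlast : (w.concat huv).getVert (w.length + 1) = v := by
    rw [Walk.concat_eq_append, getVert_append_length_add]
    rfl
  refine ⟨h.isPath.concat (fun hvw => hvB (h.mem_burning_of_mem_support hvw)) huv,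
    fun j hj => ?_, fun j hj => ?_, fun j hj hj' => ?_⟩
  · rcases Nat.le_succ_iff.1 hj with hj | rfl
    · exact hget hj ▸ h.mem_burning j hj
    · have hu := h.mem_burning_of_mem_support w.end_mem_support
      rw [hlast]
      exact mem_burning_succ hu huv hv
  · rcases (Nat.lt_succ_iff.1 hj).lt_or_eq with hj | rfl
    · exact hget hj ▸ h.notMem_burning j hj
    · rwa [hlast]
  · rw [Walk.length_concat] at hj'
    omega

theorem notMem_burning_of_le {w : G.Walk r x} (h : IsFireRoute G r σ i m w) {k j : ℕ}
    (hki : k ≤ i) (hj : k ⊓ m < j) (hjw : j ≤ w.length) : w.getVert j ∉ burning G r σ k := by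
  rcases le_or_gt j m with hjm | hjm
  · obtain ⟨j, rfl⟩ := Nat.exists_eq_succ_of_ne_zero (by omega : j ≠ 0)
    exact fun hB => h.notMem_burning j hjm (burning_mono G r σ (by omega) hB)
  · exact fun hB => (h.free j hjm hjw).1 (burning_mono G r σ hki hB)

theorem notMem_guarded_of_le (hσ : IsLegal G r f σ) {w : G.Walk r x}
    (h : IsFireRoute G r σ i m w) {k j : ℕ} (hki : k ≤ i) (hjw : j ≤ w.length) :
    w.getVert j ∉ guarded σ k := by
  rcases le_or_gt j m with hjm | hjm
  · exact hσ.notMem_guarded (h.mem_burning j hjm)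
  · exact fun hg => (h.free j hjm hjw).2 (guarded_mono σ hki hg)

theorem exists_path_roundGraph (hσ : IsLegal G r f σ) {w : G.Walk r x}
    (h : IsFireRoute G r σ i m w) {k : ℕ} (hki : k ≤ i) (hkw : k ⊓ m < w.length) :
    ∃ w' : (roundGraph G r σ k).Walk r x, w'.IsPath ∧ w'.length = w.length - k ⊓ m ∧
      ∀ j, 0 < j → w'.getVert j = w.getVert (k ⊓ m + j) :=
  (hσ.isState k).exists_contracted_path h.isPath hkw
    (burning_mono G r σ inf_le_left (h.mem_burning _ inf_le_right))
    fun _ hj hjw => ⟨h.notMem_burning_of_le hki hj hjw, h.notMem_guarded_of_le hσ hki hjw⟩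

theorem exists_burning_path_roundGraph (hσ : IsLegal G r f σ) {w : G.Walk r x}
    (h : IsFireRoute G r σ i w.length w) (hi : i < w.length) :
    ∃ w' : (roundGraph G r σ i).Walk r x, w'.IsPath ∧ w'.length = w.length - i ∧
      (∀ j, 0 < j → w'.getVert j = w.getVert (i + j)) ∧
      ∀ v ∈ w'.support, v ∈ burning G r σ w.length := by
  obtain ⟨w', hw', hlength, hget⟩ := h.exists_path_roundGraph hσ le_rfl (inf_le_left.trans_lt hi)
  rw [inf_eq_left.2 hi.le] at hlength hget
  refine ⟨w', hw', hlength, hget, fun v hv => ?_⟩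
  obtain ⟨j, rfl, -⟩ := Walk.mem_support_iff_exists_getVert.1 hv
  rcases j.eq_zero_or_pos with rfl | hj
  · rw [Walk.getVert_zero]
    exact root_mem_burning G r σ _
  · rw [hget j hj]
    exact h.mem_burning_of_mem_support (w.getVert_mem_support _)

end IsFireRoute

theorem exists_isFireRoute {n : ℕ} (hx : x ∈ burning G r σ n) :
    ∃ w : G.Walk r x, w.length ≤ n ∧ ∀ i, IsFireRoute G r σ i w.length w := by
  induction n generalizing x with
  | zero =>
    obtain rfl : x = r := hx
    refine ⟨Walk.nil, le_rfl, fun i => ⟨Walk.IsPath.nil, fun j _ => root_mem_burning G x σ j,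
      fun j hj => absurd hj (Nat.not_lt_zero j), fun j hj hj' => absurd hj hj'.not_gt⟩⟩
  | succ n ih =>
    by_cases hxn : x ∈ burning G r σ n
    · obtain ⟨w, hwn, hw⟩ := ih hxn
      exact ⟨w, hwn.trans n.le_succ, hw⟩
    · obtain ⟨hxg, u, hu, hux⟩ := hx.resolve_left hxn
      obtain ⟨w, hwn, hw⟩ := ih hu
      refine ⟨w.concat hux, by simpa using hwn, fun i => ?_⟩
      rw [Walk.length_concat]
      exact (hw i).concat hux (fun hg => hxg (guarded_mono σ (by omega) hg))
        fun hB => hxn (burning_mono G r σ hwn hB)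

theorem exists_adj_of_reduced_adj {B P : Set V} {c d : V} (hcd : (reduced G r B P).Adj c d)
    (hd : d ≠ r) : ∃ x, G.Adj x d ∧ contract B r x = c := by
  obtain ⟨_, x, y, hxy, _, _, hx, hy⟩ := reduced_adj.1 hcd
  have hyB : y ∉ B := fun hyB => hd (hy.symm.trans (contract_of_mem hyB))
  rw [contract_of_notMem hyB] at hy
  exact ⟨x, hy ▸ hxy, hx⟩

theorem adj_of_reduced_adj {B P : Set V} {c d : V} (hcd : (reduced G r B P).Adj c d) (hc : c ≠ r)
    (hd : d ≠ r) : G.Adj c d := by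
  obtain ⟨x, hxd, hx⟩ := exists_adj_of_reduced_adj hcd hd
  have hxB : x ∉ B := fun hxB => hc (hx.symm.trans (contract_of_mem hxB))
  rw [contract_of_notMem hxB] at hx
  exact hx ▸ hxd

theorem IsState.exists_lifted_path {B P : Set V} (h : IsState G r B P)
    {w : (reduced G r B P).Walk r x} (hw : w.IsPath) (hx : x ≠ r) :
    ∃ a ∈ B, ∃ w' : G.Walk a x, w'.IsPath ∧ w'.length = w.length ∧
      ∀ j, 0 < j → w'.getVert j = w.getVert j := by
  cases w with
  | nil => exact absurd rfl hx
  | @cons _ b _ hrb q =>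
    rw [Walk.cons_isPath_iff] at hw
    have hqr : ∀ v ∈ q.support, v ≠ r := fun v hv hvr => hw.2 (hvr ▸ hv)
    have hqB : ∀ v ∈ q.support, v ∉ B := by
      classical
      exact fun v hv => (notMem_of_reduced_reachable
        (hrb.reachable.trans ⟨q.takeUntil v hv⟩) (hqr v hv)).1
    obtain ⟨a, hab, ha⟩ := exists_adj_of_reduced_adj hrb (hqr b q.start_mem_support)
    have haB : a ∈ B := by
      by_contra haB
      rw [contract_of_notMem haB] at ha
      exact haB (ha ▸ h.root)
    have hedge : ∀ e ∈ q.edges, e ∈ G.edgeSet := by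
      intro e he
      induction e with
      | _ c d =>
      exact adj_of_reduced_adj (q.adj_of_mem_edges he) (hqr c (q.fst_mem_support_of_mem_edges he))
        (hqr d (q.snd_mem_support_of_mem_edges he))
    refine ⟨a, haB, Walk.cons hab (q.transfer G hedge), ?_, ?_, fun j hj => ?_⟩
    · rw [Walk.cons_isPath_iff, Walk.support_transfer]
      exact ⟨hw.1.transfer _, fun haq => hqB a haq haB⟩
    · rw [Walk.length_cons, Walk.length_cons, Walk.length_transfer]
    · obtain ⟨j, rfl⟩ := Nat.exists_eq_add_of_lt hj
      rw [Nat.zero_add, Walk.getVert_cons_succ, Walk.getVert_cons_succ,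
        Walk.getVert_eq_getD_support, Walk.support_transfer, ← Walk.getVert_eq_getD_support]

/-- A path of the reduced graph starts with an edge from a contracted vertex, which the fire has
reached along a path of its own. -/
theorem IsLegal.exists_isFireRoute_of_path (hσ : IsLegal G r f σ)
    {w : (roundGraph G r σ i).Walk r x} (hw : w.IsPath) (hx : x ≠ r) :
    ∃ m ≤ i, ∃ w' : G.Walk r x, IsFireRoute G r σ i m w' ∧ w'.length = m + w.length ∧
      ∀ j, 0 < j → w'.getVert (m + j) = w.getVert j := by
  obtain ⟨a, haB, q, hq, hlength, hget⟩ := (hσ.isState i).exists_lifted_path hw hx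
  obtain ⟨c, hci, hc⟩ := exists_isFireRoute haB
  have hfree : ∀ j, 0 < j → j ≤ q.length →
      q.getVert j ∉ burning G r σ i ∧ q.getVert j ∉ guarded σ i := by
    classical
    intro j hj hjq
    rw [hget j hj]
    refine notMem_of_reduced_reachable ⟨w.take j⟩ fun hr => ?_
    have hzero := hw.getVert_injOn (hjq.trans hlength.le) (Nat.zero_le _)
      (hr.trans w.getVert_zero.symm)
    omega
  have hinter : ∀ v ∈ c.support, v ∈ q.support → v = a := by
    intro v hv hvq
    obtain ⟨j, rfl, hj⟩ := Walk.mem_support_iff_exists_getVert.1 hvq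
    rcases j.eq_zero_or_pos with rfl | hj0
    · exact q.getVert_zero
    · exact absurd (burning_mono G r σ hci ((hc i).mem_burning_of_mem_support hv))
        (hfree j hj0 hj).1
  refine ⟨c.length, hci, c.append q, ⟨isPath_append (hc i).isPath hq hinter,
    fun j hj => ?_, fun j hj => ?_, fun j hj hj' => ?_⟩, by rw [Walk.length_append, hlength],
    fun j hj => by rw [getVert_append_length_add, hget j hj]⟩
  · rw [getVert_append_of_le _ _ hj]
    exact (hc i).mem_burning j hj
  · rw [getVert_append_of_le _ _ hj]
    exact (hc i).notMem_burning j hj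
  · obtain ⟨k, rfl⟩ := Nat.exists_eq_add_of_lt hj
    rw [Walk.length_append] at hj'
    rw [Nat.add_assoc, getVert_append_length_add]
    exact hfree _ k.succ_pos (by omega)

theorem exists_getVert_mem_of_forall_notMem_burning (hx : ∀ i, x ∉ burning G r σ i)
    (w : G.Walk r x) : ∃ j i, i < j ∧ j ≤ w.length ∧ w.getVert j ∈ σ i := by
  by_contra! hunprotected
  have hburning : ∀ j ≤ w.length, w.getVert j ∈ burning G r σ j := by
    intro j hj
    induction j with
    | zero => rw [Walk.getVert_zero]; exact root_mem_burning G r σ 0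
    | succ j ih =>
      refine mem_burning_succ (ih (by omega)) (w.adj_getVert_succ (by omega)) ?_
      rintro ⟨i, hi, hmem⟩
      exact hunprotected (j + 1) i hi hj hmem
  have hend := hburning w.length le_rfl
  rw [Walk.getVert_length] at hend
  exact hx _ hend

theorem IsLegal.exists_short_path (hσ : IsLegal G r f σ) {t : ℕ}
    (hx : x ∈ burning G r σ (i + t)) (hxi : x ∉ burning G r σ i) :
    ∃ w : (roundGraph G r σ i).Walk r x, w.IsPath ∧ w.length ≤ t ∧
      ∀ v ∈ w.support, ∀ j, v ∉ guarded σ j := by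
  obtain ⟨w, hwlength, hw⟩ := exists_isFireRoute hx
  have hi : i < w.length := by
    by_contra hi
    exact hxi (burning_mono G r σ (by omega) ((hw i).mem_burning_of_mem_support w.end_mem_support))
  obtain ⟨w', hw', hlength, -, hburning⟩ := (hw i).exists_burning_path_roundGraph hσ hi
  exact ⟨w', hw', by omega, fun v hv _ => hσ.notMem_guarded (hburning v hv)⟩

end FireRoute

/-! ### Comparison of two plays -/

section Comparison

variable {V : Type} {G : SimpleGraph V} {r x y : V} {f : ℕ → ℕ} {σ ω : ℕ → Finset V}

/-- On a graph with at most one cycle, `σ` is a play of the algorithm and `ω` is an arbitrary play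
on the same instance. -/
structure Compared (G : SimpleGraph V) (r : V) (f : ℕ → ℕ) (σ ω : ℕ → Finset V) : Prop where
  atMostOneCycle : AtMostOneCycle G
  legal : IsLegal G r f σ
  legal' : IsLegal G r f ω
  round : ∀ i, AlgARound G r (burning G r σ i) (guarded σ i) (f i) (σ i : Set V)

/-- The vertices that are saved by `ω` and not by `σ`. -/
def lost (G : SimpleGraph V) (r : V) (σ ω : ℕ → Finset V) : Set V :=
  {x | (∀ i, x ∉ burning G r ω i) ∧ ∃ i, x ∈ burning G r σ i}

/-- The number of vertices that the moves of round `i` cut off from the fire. -/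
noncomputable def gain (G : SimpleGraph V) (r : V) (σ : ℕ → Finset V) (i : ℕ) : ℕ :=
  (region G r (guarded σ i) \ region G r (guarded σ (i + 1))).ncard

/-- The lost vertices that `σ` would have saved by protecting, in round `i` and in addition to its
earlier choices, a single vertex of `ω i`. -/
def dominatedAt (G : SimpleGraph V) (r : V) (σ ω : ℕ → Finset V) (i : ℕ) : Set V :=
  {x ∈ lost G r σ ω | ∃ y ∈ ω i, y ∉ burning G r σ i ∧ x ∉ region G r (guarded σ i ∪ {y})}

/-- The lost vertices that are charged to the gain of `σ` in some round, see `dominatedAt`. -/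
def dominated (G : SimpleGraph V) (r : V) (σ ω : ℕ → Finset V) : Set V :=
  ⋃ i, dominatedAt G r σ ω i

theorem mem_region_of_notMem_region_union_singleton {P P' : Set V} (hP : P ⊆ P')
    (hr : r ∉ P') (hx : x ∈ region G r P') (hxy : x ∉ region G r (P ∪ {y})) :
    y ∈ region G r P' := by
  classical
  obtain ⟨w, -, hw⟩ := (mem_region_iff_exists_isPath hr).1 hx
  by_contra hy
  refine hxy (mem_region_of_walk w fun v hv hvP => ?_)
  rcases hvP with hvP | rfl
  · exact hw v hv (hP hvP)
  · exact hy (mem_region_of_walk (w.takeUntil _ hv) fun u hu =>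
      hw u (w.support_takeUntil_subset_support hv hu))

theorem IsLegal.lost_subset_region (hσ : IsLegal G r f σ) (i : ℕ) :
    lost G r σ ω ⊆ region G r (guarded σ i) := by
  rintro x ⟨-, j, hj⟩
  exact hσ.burning_subset_region j i hj

section Gain

variable [Finite V]

theorem profit_le_add (G : SimpleGraph V) (r : V) (σ ω : ℕ → Finset V) :
    profit G r ω ≤ profit G r σ + (lost G r σ ω).ncard := by
  refine (Set.ncard_le_ncard (t := {v | ∀ i, v ∉ burning G r σ i} ∪ lost G r σ ω) ?_
    (Set.toFinite _)).trans (Set.ncard_union_le _ _)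
  intro x hx
  by_cases hburns : ∃ i, x ∈ burning G r σ i
  · exact Or.inr ⟨hx, hburns⟩
  · exact Or.inl (not_exists.1 hburns)

theorem IsLegal.ncard_compl_region_le (hσ : IsLegal G r f σ) (i : ℕ) :
    (region G r (guarded σ i))ᶜ.ncard ≤ profit G r σ :=
  Set.ncard_le_ncard (fun _ hx j hj => hx (hσ.burning_subset_region j i hj)) (Set.toFinite _)

theorem ncard_compl_region_guarded_succ (G : SimpleGraph V) (r : V) (σ : ℕ → Finset V) (i : ℕ) :
    (region G r (guarded σ (i + 1)))ᶜ.ncard =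
      (region G r (guarded σ i))ᶜ.ncard + gain G r σ i := by
  rw [gain, add_comm (Set.ncard _), ← compl_sdiff_compl, Set.ncard_sdiff_add_ncard_of_subset
    (Set.compl_subset_compl.2 (region_anti G r (guarded_mono σ i.le_succ)))]

theorem IsLegal.sum_gain_le (hσ : IsLegal G r f σ) (n : ℕ) :
    ∑ i ∈ Finset.range n, gain G r σ i ≤ profit G r σ := by
  refine le_trans ?_ (hσ.ncard_compl_region_le n)
  induction n with
  | zero => simp
  | succ n ih =>
    rw [Finset.sum_range_succ, ncard_compl_region_guarded_succ]
    omega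

theorem IsLegal.gain_le (hσ : IsLegal G r f σ) (i : ℕ) : gain G r σ i ≤ profit G r σ :=
  (Finset.single_le_sum (fun _ _ => Nat.zero_le _) (Finset.self_mem_range_succ i)).trans
    (hσ.sum_gain_le (i + 1))

theorem exists_forall_burning_subset (G : SimpleGraph V) (r : V) (σ : ℕ → Finset V) :
    ∃ n, ∀ i, burning G r σ i ⊆ burning G r σ n := by
  obtain ⟨n, hn⟩ := WellFoundedGT.monotone_chain_condition
    ⟨burning G r σ, fun _ _ hij => burning_mono G r σ hij⟩
  refine ⟨n, fun i => ?_⟩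
  rcases le_total i n with hin | hni
  · exact burning_mono G r σ hin
  · exact (hn i hni).ge

namespace Compared

theorem mul_ncard_notMem_region_le (h : Compared G r f σ ω) {i : ℕ}
    (hyB : y ∉ burning G r σ i) :
    (f i : ℝ) * {x ∈ lost G r σ ω | x ∉ region G r (guarded σ i ∪ {y})}.ncard ≤
      2 * √(Nat.card V : ℝ) * gain G r σ i := by
  rcases Set.eq_empty_or_nonempty {x ∈ lost G r σ ω | x ∉ region G r (guarded σ i ∪ {y})}
    with hempty | ⟨x, hx, hxy⟩
  · rw [hempty, Set.ncard_empty, Nat.cast_zero, mul_zero]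
    positivity
  · have hy := mem_region_of_notMem_region_union_singleton (guarded_mono σ i.le_succ)
      (h.legal.notMem_guarded (root_mem_burning G r σ 0)) (h.legal.lost_subset_region _ hx) hxy
    rw [guarded_succ] at hy
    have hround := (h.round i).mul_ncard_le h.atMostOneCycle (h.legal.isState i) hyB hy
    rw [← guarded_succ] at hround
    refine le_trans ?_ hround
    gcongr
    · exact Set.toFinite _
    · exact fun z hz => ⟨h.legal.lost_subset_region _ hz.1, hz.2⟩

theorem ncard_dominatedAt_le (h : Compared G r f σ ω) (i : ℕ) :
    ((dominatedAt G r σ ω i).ncard : ℝ) ≤ 2 * √(Nat.card V : ℝ) * gain G r σ i := by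
  classical
  have hcard := (h.legal' i).1
  set cutOff : V → Set V := fun y => {x ∈ lost G r σ ω | x ∉ region G r (guarded σ i ∪ {y})}
  set guards := (ω i).filter (· ∉ burning G r σ i)
  have hguards : guards.card ≤ f i := (Finset.card_filter_le _ _).trans hcard
  have hsubset : dominatedAt G r σ ω i ⊆ ⋃ y ∈ guards, cutOff y := by
    rintro x ⟨hx, y, hy, hyB, hxy⟩
    exact Set.mem_biUnion (Finset.mem_coe.2 (Finset.mem_filter.2 ⟨hy, hyB⟩)) ⟨hx, hxy⟩
  have hunion : ((dominatedAt G r σ ω i).ncard : ℝ) ≤ ∑ y ∈ guards, ((cutOff y).ncard : ℝ) := by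
    exact_mod_cast (Set.ncard_le_ncard hsubset (Set.toFinite _)).trans
      (Finset.set_ncard_biUnion_le _ _)
  rcases Nat.eq_zero_or_pos (f i) with hzero | hpos
  · rw [Finset.card_eq_zero.1 (by omega : guards.card = 0), Finset.sum_empty] at hunion
    exact hunion.trans (by positivity)
  refine le_of_mul_le_mul_left ?_ (Nat.cast_pos.2 hpos : (0 : ℝ) < f i)
  calc (f i : ℝ) * (dominatedAt G r σ ω i).ncard
      ≤ f i * ∑ y ∈ guards, ((cutOff y).ncard : ℝ) := by gcongr
    _ = ∑ y ∈ guards, (f i : ℝ) * (cutOff y).ncard := Finset.mul_sum _ _ _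
    _ ≤ ∑ _y ∈ guards, 2 * √(Nat.card V : ℝ) * gain G r σ i :=
        Finset.sum_le_sum fun y hy => h.mul_ncard_notMem_region_le (Finset.mem_filter.1 hy).2
    _ = guards.card * (2 * √(Nat.card V : ℝ) * gain G r σ i) := by
        rw [Finset.sum_const, nsmul_eq_mul]
    _ ≤ f i * (2 * √(Nat.card V : ℝ) * gain G r σ i) := by gcongr

/-- Once the fire of `σ` has stopped spreading, no lost vertex can be dominated any more. -/
theorem exists_dominated_subset (h : Compared G r f σ ω) :
    ∃ n, dominated G r σ ω ⊆ ⋃ i ∈ Finset.range n, dominatedAt G r σ ω i := by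
  obtain ⟨n, hn⟩ := exists_forall_burning_subset G r σ
  refine ⟨n, fun x hx => ?_⟩
  obtain ⟨i, hxi⟩ := Set.mem_iUnion.1 hx
  refine Set.mem_biUnion (x := i) ?_ hxi
  obtain ⟨⟨-, j, hj⟩, y, -, hyB, hxy⟩ := hxi
  by_contra hi
  have hni : n ≤ i := by simpa using hi
  exact hxy (((h.legal.isState i).union (by rintro _ rfl; exact hyB)).subset_region
    (burning_mono G r σ hni (hn j hj)))

theorem ncard_dominated_le (h : Compared G r f σ ω) :
    ((dominated G r σ ω).ncard : ℝ) ≤ 2 * √(Nat.card V : ℝ) * profit G r σ := by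
  obtain ⟨n, hn⟩ := h.exists_dominated_subset
  calc ((dominated G r σ ω).ncard : ℝ)
      ≤ ∑ i ∈ Finset.range n, ((dominatedAt G r σ ω i).ncard : ℝ) := by
        exact_mod_cast (Set.ncard_le_ncard hn (Set.toFinite _)).trans
          (Finset.set_ncard_biUnion_le _ _)
    _ ≤ ∑ i ∈ Finset.range n, 2 * √(Nat.card V : ℝ) * (gain G r σ i : ℝ) :=
        Finset.sum_le_sum fun i _ => h.ncard_dominatedAt_le i
    _ = 2 * √(Nat.card V : ℝ) * ((∑ i ∈ Finset.range n, gain G r σ i : ℕ) : ℝ) := by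
        rw [← Finset.mul_sum, Nat.cast_sum]
    _ ≤ 2 * √(Nat.card V : ℝ) * profit G r σ := by
        gcongr
        exact h.legal.sum_gain_le n

end Compared

end Gain

namespace IsState

variable {B P B' P' C : Set V}

theorem reduced_deleteVerts (G : SimpleGraph V) (r : V) (B P : Set V) :
    reduced (deleteVerts G P) r B ∅ = reduced G r B P := by
  ext
  simp only [reduced_adj, deleteVerts_adj, Set.mem_empty_iff_false, not_false_eq_true, true_and,
    and_assoc]

theorem deleteVerts (h : IsState G r B P) : IsState (deleteVerts G P) r B ∅ := by
  refine ⟨h.root, by simp, fun b hb => (h.connected b hb).mono fun u v huv => ?_⟩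
  obtain ⟨huv, hu, hv⟩ := deleteVerts_adj.1 huv
  exact deleteVerts_adj.2 ⟨deleteVerts_adj.2 ⟨huv, h.disjoint u (not_not.1 hu),
    h.disjoint v (not_not.1 hv)⟩, hu, hv⟩

theorem exists_isCycle_map_contract_eq (h : IsState G r B P) {u : V}
    {p : (reduced G r B P).Walk u u} (hp : p.IsCycle) {e : Sym2 V} (he : e ∈ p.edges) :
    ∃ v, ∃ q : G.Walk v v, q.IsCycle ∧ ∃ e' ∈ q.edges, e'.map (contract B r) = e := by
  obtain ⟨e', he', rfl⟩ := exists_map_contract_eq (p.edges_subset_edgeSet he)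
  obtain ⟨v, q, hq, heq⟩ := h.exists_isCycle_deleteEdges_preimage (F := ∅) (by simp)
    (hp.toDeleteEdges (G := reduced G r B P) ∅ (by simp)) he' (by rwa [Walk.edges_transfer])
  exact ⟨v, q.mapLe (deleteEdges_le _), hq.mapLe _, e',
    by rwa [Walk.edges_mapLe_eq_edges], rfl⟩

theorem exists_isCycle_deleteVerts (h : IsState G r B P) {u : V}
    {p : (reduced G r B P).Walk u u} (hp : p.IsCycle) {e : Sym2 V} (he : e ∈ p.edges) :
    ∃ v, ∃ q : (Firefighting.deleteVerts G P).Walk v v, q.IsCycle ∧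
      ∃ e' ∈ q.edges, e'.map (contract B r) = e :=
  h.deleteVerts.exists_isCycle_map_contract_eq (hp.mapLe (reduced_deleteVerts G r B P).ge)
    (by rwa [Walk.edges_mapLe_eq_edges])

/-- The graph has only one cycle, and a later root cycle would have to avoid the vertex `x`. -/
theorem not_exists_isRootCycle (hG : AtMostOneCycle G) (h : IsState G r B P)
    (h' : IsState G r B' P') (hC : IsRootCycle (reduced G r B P) r C) (hx : x ∈ C) (hxr : x ≠ r)
    (hxP : x ∈ P') : ¬ ∃ C', IsRootCycle (reduced G r B' P') r C' := by
  rintro ⟨_, p', hp', -⟩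
  obtain ⟨p, hp, rfl⟩ := hC
  obtain ⟨_, q', hq', -⟩ := h'.exists_isCycle_deleteVerts hp'
    (Walk.mk_start_snd_mem_edges hp'.not_nil)
  obtain ⟨e, he, hxe⟩ := (Walk.mem_support_iff_exists_mem_edges_of_not_nil hp.not_nil).1 hx
  obtain ⟨_, q, hq, e', he', rfl⟩ := h.exists_isCycle_map_contract_eq hp he
  have hmem := (hG _ _ _ _ hq (hq'.mapLe (deleteVerts_le G P')) e').1 he'
  rw [Walk.edges_mapLe_eq_edges] at hmem
  obtain ⟨y, hy, hyx⟩ := Sym2.mem_map.1 hxe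
  have hyB : y ∉ B := fun hyB => hxr (hyx.symm.trans (contract_of_mem hyB))
  rw [contract_of_notMem hyB] at hyx
  subst hyx
  exact (deleteVerts_adj.1 (q'.adj_of_mem_edges
    ((Sym2.other_spec hy).symm ▸ hmem : s(y, Sym2.Mem.other hy) ∈ q'.edges))).2.1 hxP

end IsState

namespace Compared

/-- The fire of `σ` runs into a lost vertex along a path that `ω` has to block in time. -/
theorem exists_protected (h : Compared G r f σ ω) (hx : x ∈ lost G r σ ω) :
    ∃ i, ∃ y ∈ ω i, y ∉ burning G r σ i ∧ ∀ k ≤ i, ∃ w : (roundGraph G r σ k).Walk r x,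
      w.IsPath ∧ y ∈ w.support ∧ ∀ v ∈ w.support, ∀ j, v ∉ guarded σ j := by
  obtain ⟨hω, n, hn⟩ := hx
  obtain ⟨w, -, hw⟩ := exists_isFireRoute hn
  obtain ⟨j, i, hij, hj, hmem⟩ := exists_getVert_mem_of_forall_notMem_burning hω w
  refine ⟨i, _, hmem, (hw i).notMem_burning_of_le le_rfl (inf_le_left.trans_lt hij) hj,
    fun k hki => ?_⟩
  obtain ⟨w', hw', -, hget, hburning⟩ :=
    (hw k).exists_burning_path_roundGraph h.legal (by omega : k < w.length)
  refine ⟨w', hw', ?_, fun v hv _ => h.legal.notMem_guarded (hburning v hv)⟩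
  have hj' := hget (j - k) (by omega)
  rw [Nat.add_sub_cancel' (by omega)] at hj'
  exact hj' ▸ w'.getVert_mem_support _

theorem exists_mem_getVert_or_exists_mem_lt (h : Compared G r f σ ω)
    (hx : ∀ i, x ∉ burning G r ω i) {i₀ : ℕ} {w : (roundGraph G r σ i₀).Walk r x}
    (hw : w.IsPath) :
    (∃ i < i₀, ∃ y ∈ ω i, y ∉ burning G r σ i ∧ ∃ w' : (roundGraph G r σ i).Walk r x,
      w'.IsPath ∧ y ∈ w'.support) ∨
    ∃ l i, 0 < l ∧ l ≤ w.length ∧ i₀ ≤ i ∧ i < i₀ + l ∧ w.getVert l ∈ ω i := by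
  have hxr : x ≠ r := fun hxr => hx 0 hxr
  obtain ⟨m, hmi, full, hfull, hlength, hget⟩ := h.legal.exists_isFireRoute_of_path hw hxr
  obtain ⟨j, i, hij, hj, hmem⟩ := exists_getVert_mem_of_forall_notMem_burning hx full
  rcases le_or_gt i₀ i with hi | hi
  · obtain ⟨l, rfl⟩ := Nat.exists_eq_add_of_le (by omega : m ≤ j)
    exact Or.inr ⟨l, i, by omega, by omega, hi, by omega, hget l (by omega) ▸ hmem⟩
  · have hmj : i ⊓ m < j := inf_le_left.trans_lt hij
    obtain ⟨w', hw', -, hget'⟩ := hfull.exists_path_roundGraph h.legal hi.le (hmj.trans_le hj)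
    refine Or.inl ⟨i, hi, _, hmem, hfull.notMem_burning_of_le hi.le hmj hj, w', hw', ?_⟩
    have hj' := hget' (j - i ⊓ m) (by omega)
    rw [Nat.add_sub_cancel' hmj.le] at hj'
    exact hj' ▸ w'.getVert_mem_support _

end Compared

end Comparison

/-! ### Broken cycles and the tolerance -/

section Tolerance

variable {V : Type} {H : SimpleGraph V} {r u x : V} {C : Set V}

/-- The graph that is left of the root cycle `C` after it has been broken at `u`. -/
abbrev brokenGraph (H : SimpleGraph V) (r : V) (C : Set V) (u : V) : SimpleGraph V :=
  (H.induce (brokenVerts H r C u)).spanningCoe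

theorem brokenGraph_adj {a b : V} :
    (brokenGraph H r C u).Adj a b ↔
      a ∈ brokenVerts H r C u ∧ b ∈ brokenVerts H r C u ∧ H.Adj a b := by
  simp only [brokenGraph, SimpleGraph.map_adj, comap_adj, Function.Embedding.subtype_apply]
  constructor
  · rintro ⟨a, b, hab, rfl, rfl⟩
    exact ⟨a.2, b.2, hab⟩
  · rintro ⟨ha, hb, hab⟩
    exact ⟨⟨a, ha⟩, ⟨b, hb⟩, hab, rfl, rfl⟩

theorem brokenGraph_le (H : SimpleGraph V) (r : V) (C : Set V) (u : V) : brokenGraph H r C u ≤ H :=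
  fun _ _ h => (brokenGraph_adj.1 h).2.2

theorem not_reachable_brokenGraph (hu : u ≠ r) : ¬ (brokenGraph H r C u).Reachable r u := by
  rintro ⟨w⟩
  have hmem := (brokenGraph_adj.1 (w.adj_penultimate (Walk.not_nil_of_ne hu.symm))).2.1
  exact (hmem.resolve_left hu).2 (self_mem_covered hu ⟨w.mapLe (brokenGraph_le H r C u)⟩)

theorem exists_isPath_of_brokenGraph (hu : u ≠ r) (w : (brokenGraph H r C u).Walk r x) :
    ∃ w' : H.Walk r x, w'.IsPath ∧ w'.length ≤ w.length ∧ u ∉ w'.support := by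
  classical
  refine ⟨(w.mapLe (brokenGraph_le H r C u)).bypass, Walk.bypass_isPath _,
    (Walk.length_bypass_le_length _).trans (by simp), fun h => ?_⟩
  have hmem : u ∈ w.support := by simpa using Walk.support_bypass_subset_support _ h
  exact not_reachable_brokenGraph hu ⟨w.takeUntil u hmem⟩

section Finite

variable [Finite V] {m : ℝ}

theorem bddAbove_setOf_le_brokenCount (H : SimpleGraph V) (r : V) (C : Set V) (u : V)
    (hm : 0 < m) : BddAbove {d : ℕ | m ≤ brokenCount H r C u d} := by
  obtain ⟨b, hb⟩ := (Set.finite_range fun v => (brokenGraph H r C u).dist r v).bddAbove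
  refine ⟨b, fun d hd => ?_⟩
  have hpos : 0 < brokenCount H r C u d := Nat.cast_pos.1 (hm.trans_le hd)
  obtain ⟨v, -, hv⟩ := (Set.ncard_pos (Set.toFinite _)).1 hpos
  exact hv.trans (hb ⟨v, rfl⟩)

theorem brokenCount_lt_of_tol_lt (hm : 0 < m) {d : ℕ} (hd : tol H r C u m < d) :
    (brokenCount H r C u d : ℝ) < m :=
  lt_of_not_ge fun h => hd.not_ge (le_csSup (bddAbove_setOf_le_brokenCount H r C u hm) h)

theorem le_brokenCount_tol (hm : 0 < m) (h : 0 < tol H r C u m) :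
    m ≤ brokenCount H r C u (tol H r C u m) := by
  refine Nat.sSup_mem (s := {d : ℕ | m ≤ brokenCount H r C u d}) ?_
    (bddAbove_setOf_le_brokenCount H r C u hm)
  by_contra hempty
  rw [tol, Set.not_nonempty_iff_eq_empty.1 hempty, csSup_empty] at h
  exact h.false

end Finite

variable {p : H.Walk r r}

theorem IsTail.takeUntil [DecidableEq V] {e : ℕ} {τ : H.Walk (p.getVert e) x} (hτ : IsTail p e τ)
    (hu : u ∈ τ.support) : IsTail p e (τ.takeUntil u hu) :=
  ⟨hτ.lt_length, hτ.isPath.takeUntil hu, fun v hv =>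
    hτ.eq_of_mem v (τ.support_takeUntil_subset_support hu hv)⟩

theorem mem_covered_support_of_mem_support (hH : AtMostOneCycle H) (hp : p.IsCycle)
    (hu : u ∈ p.support) (hur : u ≠ r) : u ∈ covered H r {v | v ∈ p.support} := by
  obtain ⟨i, hi, rfl⟩ := exists_getVert_eq_of_isCycle hp hu
  refine ((isTail_nil hi).mem_covered_support_iff hH hp).2 (Nat.pos_of_ne_zero ?_)
  rintro rfl
  exact hur p.getVert_zero

theorem mem_covered_support_of_mem_path (hH : AtMostOneCycle H) (hp : p.IsCycle)
    (hx : x ∈ covered H r {v | v ∈ p.support}) {w : H.Walk r x} (hw : w.IsPath)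
    (hu : u ∈ w.support) (hur : u ≠ r) : u ∈ covered H r {v | v ∈ p.support} := by
  classical
  obtain ⟨e, τ, hτ⟩ := exists_isTail hp hx.1.symm
  have hmem : u ∈ p.support ∨ u ∈ τ.support := by
    rcases hτ.eq_leftPath_or_eq_rightPath hH hp hw with rfl | ⟨-, rfl⟩
    · exact (mem_support_leftPath_iff.1 hu).imp_left fun ⟨i, _, hi⟩ => hi ▸ p.getVert_mem_support i
    · exact (mem_support_rightPath_iff.1 hu).imp_left fun ⟨i, _, hi⟩ =>
        hi ▸ p.getVert_mem_support i
  rcases hmem with hup | huτ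
  · exact mem_covered_support_of_mem_support hH hp hup hur
  · exact ((hτ.takeUntil huτ).mem_covered_support_iff hH hp).2
      ((hτ.mem_covered_support_iff hH hp).1 hx)

theorem mem_brokenVerts_of_mem_path (hH : AtMostOneCycle H) (hp : p.IsCycle)
    (hx : x ∈ covered H r {v | v ∈ p.support}) {w : H.Walk r x} (hw : w.IsPath)
    (hu : u ∉ w.support) {v : V} (hv : v ∈ w.support) :
    v ∈ brokenVerts H r {v | v ∈ p.support} u := by
  classical
  refine or_iff_not_imp_left.2 fun hvr =>
    ⟨mem_covered_support_of_mem_path hH hp hx hw hv hvr, fun hvu => hu ?_⟩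
  exact w.support_takeUntil_subset_support hv
    (mem_support_of_mem_covered hvu (hw.takeUntil hv)).1

theorem exists_brokenGraph_walk_of_isPath (hH : AtMostOneCycle H) (hp : p.IsCycle)
    (hx : x ∈ covered H r {v | v ∈ p.support}) {w : H.Walk r x} (hw : w.IsPath)
    (hu : u ∉ w.support) :
    ∃ w' : (brokenGraph H r {v | v ∈ p.support} u).Walk r x, w'.length = w.length := by
  have hmem : ∀ {v}, v ∈ w.support → v ∈ brokenVerts H r {v | v ∈ p.support} u :=
    mem_brokenVerts_of_mem_path hH hp hx hw hu
  refine ⟨w.transfer _ fun e he => ?_, by simp⟩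
  induction e with
  | _ c d => exact brokenGraph_adj.2 ⟨hmem (w.fst_mem_support_of_mem_edges he),
      hmem (w.snd_mem_support_of_mem_edges he), w.adj_of_mem_edges he⟩

variable {e : ℕ} {τ : H.Walk (p.getVert e) x}

theorem getVert_rightPath_of_lt {l : ℕ} (hl : l < p.length - e) :
    (rightPath p e τ).getVert l = p.getVert (p.length - l) := by
  rw [rightPath, Walk.getVert_append, if_pos (by simpa using hl), Walk.getVert_reverse,
    Walk.drop_getVert, Walk.drop_length]
  congr 1
  omega

theorem getVert_rightPath_of_le {l : ℕ} (hl : p.length - e ≤ l) :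
    (rightPath p e τ).getVert l ∈ τ.support := by
  rw [rightPath, Walk.getVert_append, if_neg (by simpa using hl)]
  exact Walk.getVert_mem_support _ _

namespace IsTail

theorem eq_leftPath_of_penultimate_notMem (hτ : IsTail p e τ) (hH : AtMostOneCycle H)
    (hp : p.IsCycle) {w : H.Walk r x} (hw : w.IsPath) (hu : p.penultimate ∉ w.support) :
    w = leftPath p e τ := by
  refine (hτ.eq_leftPath_or_eq_rightPath hH hp hw).resolve_right ?_
  rintro ⟨-, rfl⟩
  exact hu (mem_support_rightPath_iff.2 (Or.inl ⟨_, Nat.le_sub_one_of_lt hτ.lt_length, rfl⟩))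

theorem eq_rightPath_of_snd_notMem (hτ : IsTail p e τ) (hH : AtMostOneCycle H) (hp : p.IsCycle)
    (he : 0 < e) {w : H.Walk r x} (hw : w.IsPath) (hu : p.snd ∉ w.support) :
    w = rightPath p e τ := by
  refine ((hτ.eq_leftPath_or_eq_rightPath hH hp hw).resolve_left ?_).2
  rintro rfl
  exact hu (mem_support_leftPath_iff.2 (Or.inl ⟨1, he, rfl⟩))

theorem getVert_notMem_support_rightPath (hτ : IsTail p e τ) (hp : p.IsCycle) {a : ℕ}
    (ha : 0 < a) (hae : a < e) : p.getVert a ∉ (rightPath p e τ).support := by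
  have he := hτ.lt_length
  have hne : ∀ i, e ≤ i → p.getVert i ≠ p.getVert a := by
    intro i hi heq
    rcases lt_or_ge i p.length with hil | hil
    · have := getVert_injective_of_isCycle hp hil (by omega) heq
      omega
    · exact getVert_ne_root hp ha (by omega) (heq.symm.trans (p.getVert_of_length_le hil))
  intro h
  rcases mem_support_rightPath_iff.1 h with ⟨i, hi, heq⟩ | h
  · exact hne i hi heq
  · exact hne e le_rfl (hτ.eq_of_mem _ h (p.getVert_mem_support a)).symm

theorem mem_brokenVerts_snd (hτ : IsTail p e τ) (hH : AtMostOneCycle H) (hp : p.IsCycle)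
    (he : 1 < e) : x ∈ brokenVerts H r {v | v ∈ p.support} p.snd :=
  mem_brokenVerts_of_mem_path hH hp ((hτ.mem_covered_support_iff hH hp).2 (by omega))
    (hτ.isPath_rightPath hp (by omega)) (hτ.getVert_notMem_support_rightPath hp one_pos he)
    (Walk.end_mem_support _)

theorem length_rightPath_le_dist (hτ : IsTail p e τ) (hH : AtMostOneCycle H) (hp : p.IsCycle)
    (he : 1 < e) :
    (rightPath p e τ).length ≤ (brokenGraph H r {v | v ∈ p.support} p.snd).dist r x := by
  obtain ⟨w, -⟩ := exists_brokenGraph_walk_of_isPath hH hp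
    ((hτ.mem_covered_support_iff hH hp).2 (by omega)) (hτ.isPath_rightPath hp (by omega))
    (hτ.getVert_notMem_support_rightPath hp one_pos he)
  obtain ⟨w', hw'⟩ := Reachable.exists_walk_length_eq_dist ⟨w⟩
  obtain ⟨q, hq, hlength, hsnd⟩ := exists_isPath_of_brokenGraph (snd_ne_root hp) w'
  rw [← hw', ← hτ.eq_rightPath_of_snd_notMem hH hp (by omega) hq hsnd]
  exact hlength

end IsTail

end Tolerance

/-! ### Rounds in which the root cycle is broken -/

section BreakRound

variable {V : Type} {G : SimpleGraph V} {r x y : V} {f : ℕ → ℕ} {σ ω : ℕ → Finset V}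

theorem ne_root_of_mem_lost (hx : x ∈ lost G r σ ω) : x ≠ r := by
  rintro rfl
  exact hx.1 0 (root_mem_burning G x ω 0)

theorem mem_region_of_notMem_dominated (hx : x ∈ lost G r σ ω \ dominated G r σ ω) {i : ℕ}
    (hy : y ∈ ω i) (hyB : y ∉ burning G r σ i) : x ∈ region G r (guarded σ i ∪ {y}) := by
  by_contra hxy
  exact hx.2 (Set.mem_iUnion.2 ⟨i, hx.1, y, hy, hyB, hxy⟩)

theorem IsLegal.mem_region_roundGraph_iff (hσ : IsLegal G r f σ) {i : ℕ} {P : Set V}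
    (hP : guarded σ i ⊆ P) (hPB : ∀ v ∈ P, v ∉ burning G r σ i) (hxB : x ∉ burning G r σ i) :
    x ∈ region (roundGraph G r σ i) r P ↔ x ∈ region G r P := by
  rw [(hσ.isState i).mem_region_reduced hPB hxB, Set.union_eq_self_of_subset_left hP]

theorem Compared.bypassed (h : Compared G r f σ ω)
    (hx : x ∈ lost G r σ ω \ dominated G r σ ω) {i k : ℕ} (hy : y ∈ ω i)
    (hyB : y ∉ burning G r σ i) (hki : k ≤ i) {w : (roundGraph G r σ k).Walk r x} (hw : w.IsPath)
    (hyw : y ∈ w.support) : Bypassed (roundGraph G r σ k) r y x := by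
  have hyBk : y ∉ burning G r σ k := fun hyk => hyB (burning_mono G r σ hki hyk)
  have hxB := (notMem_of_reduced_reachable ⟨w⟩ (ne_root_of_mem_lost hx.1)).1
  have hxy : x ∈ region G r (guarded σ k ∪ {y}) :=
    region_anti G r (Set.union_subset_union_left _ (guarded_mono σ hki))
      (mem_region_of_notMem_dominated hx hy hyB)
  exact ⟨fun hyr => hyB (hyr ▸ root_mem_burning G r σ i),
    ((h.legal.isState k).mem_region_reduced (by rintro _ rfl; exact hyBk) hxB).2 hxy, w, hw, hyw⟩

/-- The parameter `m` for which the algorithm computes the tolerance of the neighbours of `r` on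
the root cycle `p`. -/
noncomputable def threshold {H : SimpleGraph V} (p : H.Walk r r) : ℝ :=
  √(weight H r {v | v ∈ p.support} : ℝ)

/-- The tolerance of the vertex `u` of the root cycle `p`, with respect to `threshold p`. -/
noncomputable def tolerance {H : SimpleGraph V} (p : H.Walk r r) (u : V) : ℕ :=
  tol H r {v | v ∈ p.support} u (threshold p)

/-- In round `i₀` the algorithm breaks the root cycle `p` by protecting its last vertex, and no
vertex protected by `ω` before round `i₀` was bypassed. -/
structure BreakRound (G : SimpleGraph V) (r : V) (f : ℕ → ℕ) (σ ω : ℕ → Finset V) (i₀ : ℕ)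
    (p : (roundGraph G r σ i₀).Walk r r) : Prop where
  compared : Compared G r f σ ω
  isCycle : p.IsCycle
  le_one : f i₀ ≤ 1
  penultimate_mem : p.penultimate ∈ σ i₀
  weight_lt : ∀ y, y ≠ r → (roundGraph G r σ i₀).Reachable r y →
    (weight (roundGraph G r σ i₀) r {y} : ℝ) < threshold p
  tolerance_le : tolerance p p.snd ≤ tolerance p p.penultimate
  not_bypassed : ∀ i < i₀, ∀ y ∈ ω i, ∀ x, ¬ Bypassed (roundGraph G r σ i) r y x

variable {i₀ : ℕ}

/-- The vertices that `ω` cuts off by protecting, after round `i₀`, a vertex of the cycle `p` that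
lies between the vertex where their tail is attached and the end of `p`. -/
def blockedOnCycle {H : SimpleGraph V} (ω : ℕ → Finset V) (i₀ : ℕ) (p : H.Walk r r) : Set V :=
  {x | ∃ e, ∃ τ : H.Walk (p.getVert e) x, IsTail p e τ ∧ 0 < e ∧
    ∃ j t, 0 < t ∧ e < j ∧ j + t < p.length ∧ p.getVert j ∈ ω (i₀ + t)}

/-- The vertices whose tail `ω` blocks after round `i₀` and within the tolerance of the last vertex
of the cycle `p`. -/
def blockedOnTail {H : SimpleGraph V} (ω : ℕ → Finset V) (i₀ : ℕ) (p : H.Walk r r) : Set V :=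
  {x | ∃ e, ∃ τ : H.Walk (p.getVert e) x, IsTail p e τ ∧ 0 < e ∧
    ∃ t, 0 < t ∧ t < tolerance p p.penultimate ∧ ∃ y ∈ τ.support, y ∈ ω (i₀ + t)}

/-- The vertices whose path from `r` through the last vertex of the cycle `p` is longer than the
tolerance of that vertex. -/
def farOnRight {H : SimpleGraph V} (p : H.Walk r r) : Set V :=
  {x | ∃ e, ∃ τ : H.Walk (p.getVert e) x, IsTail p e τ ∧ 1 < e ∧
    tolerance p p.penultimate < (rightPath p e τ).length}

namespace BreakRound

variable {p : (roundGraph G r σ i₀).Walk r r} {e : ℕ}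
  {τ : (roundGraph G r σ i₀).Walk (p.getVert e) x}

theorem atMostOneCycle (h : BreakRound G r f σ ω i₀ p) : AtMostOneCycle (roundGraph G r σ i₀) :=
  (h.compared.legal.isState i₀).atMostOneCycle_reduced h.compared.atMostOneCycle

theorem penultimate_mem_guarded (h : BreakRound G r f σ ω i₀ p) {i : ℕ} (hi : i₀ < i) :
    p.penultimate ∈ guarded σ i := ⟨i₀, hi, h.penultimate_mem⟩

theorem notMem_burning_of_isTail (h : BreakRound G r f σ ω i₀ p) (hτ : IsTail p e τ)
    (he : 0 < e) : x ∉ burning G r σ i₀ := by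
  refine (notMem_of_reduced_reachable ((reachable_getVert p e).trans ⟨τ⟩) ?_).1
  rintro rfl
  exact hτ.root_notMem_support h.isCycle he (Walk.end_mem_support τ)

theorem eq_leftPath (h : BreakRound G r f σ ω i₀ p) (hτ : IsTail p e τ)
    {w : (roundGraph G r σ i₀).Walk r x} (hw : w.IsPath)
    (hwσ : ∀ v ∈ w.support, v ∉ guarded σ (i₀ + 1)) : w = leftPath p e τ :=
  hτ.eq_leftPath_of_penultimate_notMem h.atMostOneCycle h.isCycle hw
    fun hmem => hwσ _ hmem (h.penultimate_mem_guarded i₀.lt_succ_self)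

/-- After round `i₀` the fire can only follow the direction of the cycle. -/
theorem notMem_of_mem_leftPath (h : BreakRound G r f σ ω i₀ p) (hτ : IsTail p e τ) (he : 0 < e)
    {P : Set V} (hP : guarded σ (i₀ + 1) ⊆ P) (hPB : ∀ v ∈ P, v ∉ burning G r σ i₀)
    (hx : x ∈ region G r P) {v : V} (hv : v ∈ (leftPath p e τ).support) : v ∉ P := by
  have hxH := (h.compared.legal.mem_region_roundGraph_iff
    ((guarded_mono σ i₀.le_succ).trans hP) hPB (h.notMem_burning_of_isTail hτ he)).2 hx
  obtain ⟨w, hw, hwP⟩ := (mem_region_iff_exists_isPath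
    fun hr => hPB r hr (root_mem_burning G r σ i₀)).1 hxH
  exact hwP v (h.eq_leftPath hτ hw (fun v hv hvσ => hwP v hv (hP hvσ)) ▸ hv)

/-- `ω` has to answer the break at once, on the side from which the fire can still come. -/
theorem exists_getVert_mem (h : BreakRound G r f σ ω i₀ p)
    (hx : x ∈ lost G r σ ω \ dominated G r σ ω) :
    ∃ e, ∃ τ : (roundGraph G r σ i₀).Walk (p.getVert e) x, IsTail p e τ ∧
      ∃ a, 0 < a ∧ a < e ∧ p.getVert a ∈ ω i₀ := by
  have hσ := h.compared.legal
  obtain ⟨i, y, hy, hyB, hpath⟩ := h.compared.exists_protected hx.1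
  have hi : i₀ ≤ i := by
    by_contra! hi
    obtain ⟨w, hw, hyw, -⟩ := hpath i le_rfl
    exact h.not_bypassed i hi y hy x (h.compared.bypassed hx hy hyB le_rfl hw hyw)
  obtain ⟨w, hw, hyw, hwσ⟩ := hpath i₀ hi
  have hyx := h.compared.bypassed hx hy hyB hi hw hyw
  obtain ⟨e, τ, hτ⟩ := exists_isTail h.isCycle ⟨w⟩
  have he := hyx.pos_of_isTail hτ h.atMostOneCycle h.isCycle
  rw [h.eq_leftPath hτ hw fun v hv => hwσ v hv _] at hyw
  obtain rfl : i₀ = i := by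
    by_contra hne
    refine h.notMem_of_mem_leftPath hτ he (P := guarded σ i ∪ {y}) ?_ ?_
      (mem_region_of_notMem_dominated hx hy hyB) hyw (Or.inr rfl)
    · exact (guarded_mono σ (by omega)).trans Set.subset_union_left
    · rintro v (hv | rfl) hvB
      exacts [hσ.notMem_guarded hvB hv, hyB (burning_mono G r σ hi hvB)]
  obtain ⟨a, ha, hae, rfl⟩ :=
    hyx.exists_getVert_eq_of_mem_leftPath hτ h.atMostOneCycle h.isCycle hyw
  exact ⟨e, τ, hτ, a, ha, hae, hy⟩

/-- The only firefighter of round `i₀` is used on the left side, so `ω` has to block the way around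
the cycle later. -/
theorem exists_getVert_rightPath_mem (h : BreakRound G r f σ ω i₀ p)
    (hx : x ∈ lost G r σ ω \ dominated G r σ ω) :
    ∃ e, ∃ τ : (roundGraph G r σ i₀).Walk (p.getVert e) x, IsTail p e τ ∧ 1 < e ∧
      ∃ l t, 0 < t ∧ t < l ∧ l ≤ (rightPath p e τ).length ∧
        (rightPath p e τ).getVert l ∈ ω (i₀ + t) := by
  obtain ⟨e, τ, hτ, a, ha, hae, haω⟩ := h.exists_getVert_mem hx
  refine ⟨e, τ, hτ, by omega, ?_⟩
  rcases h.compared.exists_mem_getVert_or_exists_mem_lt hx.1.1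
      (hτ.isPath_rightPath h.isCycle (ha.trans hae)) with
    ⟨i, hi, y, hy, hyB, w, hw, hyw⟩ | ⟨l, i, -, hl, hi, hil, hmem⟩
  · exact absurd (h.compared.bypassed hx hy hyB le_rfl hw hyw) (h.not_bypassed i hi y hy x)
  obtain ⟨t, rfl⟩ := Nat.exists_eq_add_of_le hi
  refine ⟨l, t, Nat.pos_of_ne_zero ?_, by omega, hl, hmem⟩
  rintro rfl
  have hcard : (ω i₀).card ≤ 1 := (h.compared.legal' i₀).1.trans h.le_one
  exact hτ.getVert_notMem_support_rightPath h.isCycle ha hae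
    (Finset.card_le_one.1 hcard _ haω _ hmem ▸ Walk.getVert_mem_support _ _)

theorem threshold_pos (h : BreakRound G r f σ ω i₀ p) : 0 < threshold p :=
  (Nat.cast_nonneg _).trans_lt (h.weight_lt _ (snd_ne_root h.isCycle) (reachable_getVert p 1))

theorem notMem_burning_of_lt_length_leftPath (h : BreakRound G r f σ ω i₀ p) (hτ : IsTail p e τ)
    (he : 0 < e) {t : ℕ} (ht : t < (leftPath p e τ).length) : x ∉ burning G r σ (i₀ + t) := by
  intro hxB
  obtain ⟨w, hw, hwt, hwσ⟩ :=
    h.compared.legal.exists_short_path hxB (h.notMem_burning_of_isTail hτ he)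
  rw [h.eq_leftPath hτ hw fun v hv => hwσ v hv _] at hwt
  omega

theorem getVert_notMem_burning (h : BreakRound G r f σ ω i₀ p) {l t : ℕ} (htl : t < l)
    (hl : l < p.length) : p.getVert l ∉ burning G r σ (i₀ + t) :=
  h.notMem_burning_of_lt_length_leftPath (isTail_nil hl) (by omega) (by
    rw [leftPath, Walk.length_append, Walk.take_length, Walk.length_nil]
    omega)

theorem getVert_mem_region (h : BreakRound G r f σ ω i₀ p) {i j l : ℕ} (hi : i₀ < i)
    (hl : l < p.length) (hreg : p.getVert l ∈ region G r (guarded σ i)) (hj : 0 < j)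
    (hjl : j ≤ l) : p.getVert j ∈ region G r (guarded σ i) := by
  have hguarded : ∀ v ∈ guarded σ i, v ∉ burning G r σ i₀ :=
    fun v hv hvB => h.compared.legal.notMem_guarded hvB hv
  have hjp : IsTail p j Walk.nil := isTail_nil (hjl.trans_lt hl)
  refine (h.compared.legal.mem_region_roundGraph_iff (guarded_mono σ hi.le) hguarded
    (h.notMem_burning_of_isTail hjp hj)).1 (mem_region_of_walk (leftPath p j Walk.nil) ?_)
  refine fun v hv => h.notMem_of_mem_leftPath (isTail_nil hl) (by omega) (guarded_mono σ hi)
    hguarded hreg (mem_support_leftPath_iff.2 (Or.inl ?_))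
  rcases mem_support_leftPath_iff.1 hv with ⟨a, haj, rfl⟩ | hv
  · exact ⟨a, haj.trans hjl, rfl⟩
  · exact ⟨j, hjl, (by simpa using hv : v = p.getVert j).symm⟩

theorem getVert_notMem_region_union_singleton (h : BreakRound G r f σ ω i₀ p) {i a j : ℕ}
    (hi : i₀ < i) (ha : p.getVert a ∉ burning G r σ i) (haj : a ≤ j) (hj : j < p.length)
    (hj₀ : 0 < j) : p.getVert j ∉ region G r (guarded σ i ∪ {p.getVert a}) := by
  intro hreg
  refine h.notMem_of_mem_leftPath (isTail_nil hj) hj₀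
    ((guarded_mono σ hi).trans Set.subset_union_left) ?_ hreg
    (mem_support_leftPath_iff.2 (Or.inl ⟨a, haj, rfl⟩)) (Or.inr rfl)
  rintro v (hv | rfl) hvB
  exacts [h.compared.legal.notMem_guarded hvB hv, ha (burning_mono G r σ hi.le hvB)]

section Finite

variable [Finite V]

theorem one_le_profit (h : BreakRound G r f σ ω i₀ p) : 1 ≤ profit G r σ :=
  (Set.ncard_pos (Set.toFinite _)).2 ⟨p.penultimate, fun _ hi =>
    h.compared.legal.notMem_guarded hi (h.penultimate_mem_guarded i₀.lt_succ_self)⟩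

/-- No root cycle is left after round `i₀`, so the algorithm protects a vertex of maximum weight. -/
theorem ncard_region_sdiff_singleton_le_gain (h : BreakRound G r f σ ω i₀ p) {i : ℕ}
    (hi : i₀ < i) (hf : 0 < f i) (hyB : y ∉ burning G r σ i)
    (hy : y ∈ region G r (guarded σ i)) :
    (region G r (guarded σ i) \ region G r (guarded σ i ∪ {y})).ncard ≤ gain G r σ i := by
  have hstate := h.compared.legal.isState
  obtain ⟨Q, -, hQ, hQgain⟩ := (h.compared.round i).exists_first_choice (hstate i) hf hyB hy
  have hno := IsState.not_exists_isRootCycle h.compared.atMostOneCycle (hstate i₀) (hstate i)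
    ⟨p, h.isCycle, rfl⟩ (p.getVert_mem_support _) (penultimate_ne_root h.isCycle)
    (h.penultimate_mem_guarded hi)
  have hyr : y ≠ r := fun hyr => hyB (hyr ▸ root_mem_burning G r σ i)
  rw [← (hstate i).weight_reduced (by rintro _ rfl; exact hyB), gain, guarded_succ]
  exact (hQ.weight_le hno hyr (((hstate i).reachable_iff hyB).2 hy)).trans hQgain

theorem length_le_profit_add (h : BreakRound G r f σ ω i₀ p) {t : ℕ} (ht : 0 < t)
    (hf : 0 < f (i₀ + t)) : p.length ≤ profit G r σ + t + 1 := by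
  set i := i₀ + t
  rcases le_or_gt p.length (t + 1) with hshort | hlong
  · omega
  suffices hncard : (p.getVert '' Set.Ico (t + 1) p.length).ncard ≤
      (region G r (guarded σ i))ᶜ.ncard + gain G r σ i by
    rw [← ncard_compl_region_guarded_succ, ncard_image_getVert_Ico h.isCycle] at hncard
    have := h.compared.legal.ncard_compl_region_le (i + 1)
    omega
  have hyB : p.getVert (t + 1) ∉ burning G r σ i := h.getVert_notMem_burning t.lt_succ_self hlong
  by_cases hy : p.getVert (t + 1) ∈ region G r (guarded σ i)
  · refine le_trans ?_ (Nat.add_le_add_left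
      (h.ncard_region_sdiff_singleton_le_gain (by omega) hf hyB hy) _)
    refine (Set.ncard_le_ncard ?_ (Set.toFinite _)).trans (Set.ncard_union_le _ _)
    rintro _ ⟨j, ⟨htj, hj⟩, rfl⟩
    by_cases hjr : p.getVert j ∈ region G r (guarded σ i)
    · exact Or.inr ⟨hjr,
        h.getVert_notMem_region_union_singleton (by omega) hyB htj hj (by omega)⟩
    · exact Or.inl hjr
  · refine le_add_right (Set.ncard_le_ncard ?_ (Set.toFinite _))
    rintro _ ⟨j, ⟨htj, hj⟩, rfl⟩ hjr
    exact hy (h.getVert_mem_region (by omega) hj hjr t.succ_pos htj)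

end Finite

end BreakRound

end BreakRound

section BreakRoundCount

variable {V : Type} {G : SimpleGraph V} {r x y : V} {f : ℕ → ℕ} {σ ω : ℕ → Finset V}
  {i₀ : ℕ} {p : (roundGraph G r σ i₀).Walk r r}

theorem Compared.mem_burning_of_gain_lt [Finite V] (h : Compared G r f σ ω) {i : ℕ}
    (hgain : gain G r σ i < f i) (hy : y ∈ region G r (guarded σ (i + 1))) :
    y ∈ burning G r σ i := by
  by_contra hyB
  rw [guarded_succ] at hy
  have hle := (h.round i).le_ncard_region_sdiff (h.legal.isState i) hyB hy
  rw [← guarded_succ] at hle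
  exact hle.not_gt hgain

namespace BreakRound

theorem notMem_burning_of_lt_dist (h : BreakRound G r f σ ω i₀ p)
    (hx : x ∈ brokenVerts (roundGraph G r σ i₀) r {v | v ∈ p.support} p.penultimate) {t : ℕ}
    (ht : t < (brokenGraph (roundGraph G r σ i₀) r {v | v ∈ p.support} p.penultimate).dist r x) :
    x ∉ burning G r σ (i₀ + t) := by
  intro hxB
  obtain ⟨hxC, -⟩ := hx.resolve_left (by rintro rfl; simp at ht)
  obtain ⟨e, τ, hτ⟩ := exists_isTail h.isCycle hxC.1.symm
  have he := (hτ.mem_covered_support_iff h.atMostOneCycle h.isCycle).1 hxC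
  obtain ⟨w, hw, hwt, hwσ⟩ :=
    h.compared.legal.exists_short_path hxB (h.notMem_burning_of_isTail hτ he)
  obtain ⟨w', hw'⟩ := exists_brokenGraph_walk_of_isPath h.atMostOneCycle h.isCycle hxC hw
    fun hmem => hwσ _ hmem (i₀ + 1) (h.penultimate_mem_guarded i₀.lt_succ_self)
  exact ht.not_ge ((SimpleGraph.dist_le w').trans (hw'.trans_le hwt))

theorem weight_le_threshold (h : BreakRound G r f σ ω i₀ p) (y : V) :
    (weight (roundGraph G r σ i₀) r {y} : ℝ) ≤ threshold p := by
  classical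
  rcases Set.eq_empty_or_nonempty (covered (roundGraph G r σ i₀) r {y}) with hempty | ⟨x, hx⟩
  · rw [weight, hempty, Set.ncard_empty, Nat.cast_zero]
    exact h.threshold_pos.le
  · obtain ⟨w, hw⟩ := hx.1.symm.exists_isPath
    obtain ⟨hyw, hyr⟩ := mem_support_of_mem_covered hx hw
    exact (h.weight_lt y hyr ⟨w.takeUntil y hyw⟩).le

theorem lost_sdiff_dominated_subset (h : BreakRound G r f σ ω i₀ p) :
    lost G r σ ω \ dominated G r σ ω ⊆
      blockedOnCycle ω i₀ p ∪ blockedOnTail ω i₀ p ∪ farOnRight p := by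
  intro x hx
  obtain ⟨e, τ, hτ, he, l, t, ht, htl, hl, hmem⟩ := h.exists_getVert_rightPath_mem hx
  rcases lt_or_ge l (p.length - e) with hle | hle
  · rw [getVert_rightPath_of_lt hle] at hmem
    exact Or.inl (Or.inl ⟨e, τ, hτ, by omega, p.length - l, t, ht, by omega, by omega, hmem⟩)
  · rcases lt_or_ge t (tolerance p p.penultimate) with htd | htd
    · exact Or.inl (Or.inr ⟨e, τ, hτ, by omega, t, ht, htd, _, getVert_rightPath_of_le hle, hmem⟩)
    · exact Or.inr ⟨e, τ, hτ, he, by omega⟩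

section Finite

variable [Finite V]

/-- A round in which some firefighter saves no vertex is one after which nothing else can be saved;
if it comes within the tolerance, the fire has not yet reached the distant vertices. -/
theorem le_gain_or_threshold_le (h : BreakRound G r f σ ω i₀ p) :
    (∀ t, 0 < t → t < tolerance p p.penultimate → f (i₀ + t) ≤ gain G r σ (i₀ + t)) ∨
      threshold p ≤ profit G r σ := by
  refine or_iff_not_imp_left.2 fun hgain => ?_
  push Not at hgain
  obtain ⟨t, -, ht, hgain⟩ := hgain
  refine (le_brokenCount_tol h.threshold_pos (t.zero_le.trans_lt ht)).trans (Nat.cast_le.2 ?_)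
  refine (Set.ncard_le_ncard ?_ (Set.toFinite _)).trans
    (h.compared.legal.ncard_compl_region_le (i₀ + t + 1))
  rintro x ⟨hx, hdist⟩ hxr
  exact h.notMem_burning_of_lt_dist hx (ht.trans_le hdist)
    (h.compared.mem_burning_of_gain_lt hgain hxr)

theorem ncard_le_of_covered (h : BreakRound G r f σ ω i₀ p) {X : Set V} (T : Finset V)
    (hT : T.card ≤ profit G r σ)
    (hX : ∀ x ∈ X, ∃ y ∈ T, x ∈ covered (roundGraph G r σ i₀) r {y}) :
    (X.ncard : ℝ) ≤ profit G r σ * threshold p := by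
  have hsubset : X ⊆ ⋃ y ∈ T, covered (roundGraph G r σ i₀) r {y} := fun x hx => by
    obtain ⟨y, hy, hxy⟩ := hX x hx
    exact Set.mem_biUnion (Finset.mem_coe.2 hy) hxy
  calc (X.ncard : ℝ)
      ≤ ∑ y ∈ T, (weight (roundGraph G r σ i₀) r {y} : ℝ) := by
        exact_mod_cast (Set.ncard_le_ncard hsubset (Set.toFinite _)).trans
          (Finset.set_ncard_biUnion_le _ _)
    _ ≤ ∑ _y ∈ T, threshold p := Finset.sum_le_sum fun y _ => h.weight_le_threshold y
    _ = T.card * threshold p := by rw [Finset.sum_const, nsmul_eq_mul]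
    _ ≤ profit G r σ * threshold p :=
        mul_le_mul_of_nonneg_right (Nat.cast_le.2 hT) h.threshold_pos.le

theorem ncard_blockedOnCycle_le (h : BreakRound G r f σ ω i₀ p) :
    ((blockedOnCycle ω i₀ p).ncard : ℝ) ≤ profit G r σ * threshold p := by
  classical
  set T := (Finset.Ico 1 p.length).filter fun e =>
    ∃ j t, 0 < t ∧ e < j ∧ j + t < p.length ∧ p.getVert j ∈ ω (i₀ + t)
  have hT : (T.image p.getVert).card ≤ profit G r σ := by
    refine Finset.card_image_le.trans ?_
    rcases T.eq_empty_or_nonempty with hempty | hne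
    · simp [hempty]
    obtain ⟨-, j, t, ht, hej, hjt, hmem⟩ := Finset.mem_filter.1 (T.max'_mem hne)
    have hf : 0 < f (i₀ + t) :=
      (Finset.card_pos.2 ⟨_, hmem⟩).trans_le (h.compared.legal' (i₀ + t)).1
    have hlength := h.length_le_profit_add ht hf
    have hcard : T.card ≤ T.max' hne := by
      refine (Finset.card_le_card (t := Finset.Icc 1 (T.max' hne)) fun e he => ?_).trans (by simp)
      exact Finset.mem_Icc.2 ⟨(Finset.mem_Ico.1 (Finset.mem_filter.1 he).1).1, T.le_max' e he⟩
    omega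
  refine h.ncard_le_of_covered (T.image p.getVert) hT fun x hx => ?_
  obtain ⟨e, τ, hτ, he, hj⟩ := hx
  exact ⟨_, Finset.mem_image_of_mem _
    (Finset.mem_filter.2 ⟨Finset.mem_Ico.2 ⟨he, hτ.lt_length⟩, hj⟩),
    hτ.mem_covered_of_mem_support h.atMostOneCycle h.isCycle he τ.start_mem_support⟩

theorem card_biUnion_le_profit (h : BreakRound G r f σ ω i₀ p) [DecidableEq V] {d : ℕ}
    (hgain : ∀ t, 0 < t → t < d → f (i₀ + t) ≤ gain G r σ (i₀ + t)) :
    ((Finset.Ico 1 d).biUnion fun t => ω (i₀ + t)).card ≤ profit G r σ :=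
  calc ((Finset.Ico 1 d).biUnion fun t => ω (i₀ + t)).card
      ≤ ∑ t ∈ Finset.Ico 1 d, (ω (i₀ + t)).card := Finset.card_biUnion_le
    _ ≤ ∑ t ∈ Finset.Ico 1 d, gain G r σ (i₀ + t) := Finset.sum_le_sum fun t ht =>
        (h.compared.legal' (i₀ + t)).1.trans
          (hgain t (Finset.mem_Ico.1 ht).1 (Finset.mem_Ico.1 ht).2)
    _ = ∑ i ∈ Finset.Ico (1 + i₀) (d + i₀), gain G r σ i := Finset.sum_Ico_add _ 1 d i₀
    _ ≤ ∑ i ∈ Finset.range (d + i₀), gain G r σ i :=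
        Finset.sum_le_sum_of_subset fun _ hi => Finset.mem_range.2 (Finset.mem_Ico.1 hi).2
    _ ≤ profit G r σ := h.compared.legal.sum_gain_le _

theorem ncard_blockedOnTail_le (h : BreakRound G r f σ ω i₀ p) :
    ((blockedOnTail ω i₀ p).ncard : ℝ) ≤ profit G r σ * threshold p := by
  classical
  rcases h.le_gain_or_threshold_le with hgain | hle
  · refine h.ncard_le_of_covered _ (h.card_biUnion_le_profit hgain) fun x hx => ?_
    obtain ⟨e, τ, hτ, he, t, ht, htd, y, hyτ, hy⟩ := hx
    exact ⟨y, Finset.mem_biUnion.2 ⟨t, Finset.mem_Ico.2 ⟨ht, htd⟩, hy⟩,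
      hτ.mem_covered_of_mem_support h.atMostOneCycle h.isCycle he hyτ⟩
  · calc ((blockedOnTail ω i₀ p).ncard : ℝ)
        ≤ weight (roundGraph G r σ i₀) r {v | v ∈ p.support} := by
          refine Nat.cast_le.2 (Set.ncard_le_ncard ?_ (Set.toFinite _))
          rintro x ⟨e, τ, hτ, he, -⟩
          exact (hτ.mem_covered_support_iff h.atMostOneCycle h.isCycle).2 he
      _ = threshold p * threshold p := (Real.mul_self_sqrt (Nat.cast_nonneg _)).symm
      _ ≤ profit G r σ * threshold p := mul_le_mul_of_nonneg_right hle h.threshold_pos.le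

/-- The algorithm chose the larger tolerance, so breaking the cycle at its first vertex would leave
fewer than `threshold p` vertices this far away. -/
theorem ncard_farOnRight_le (h : BreakRound G r f σ ω i₀ p) :
    ((farOnRight p).ncard : ℝ) ≤ profit G r σ * threshold p := by
  have hcount : (farOnRight p).ncard ≤ brokenCount (roundGraph G r σ i₀) r {v | v ∈ p.support}
      p.snd (tolerance p p.penultimate + 1) := by
    refine Set.ncard_le_ncard ?_ (Set.toFinite _)
    rintro x ⟨e, τ, hτ, he, hlength⟩
    exact ⟨hτ.mem_brokenVerts_snd h.atMostOneCycle h.isCycle he,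
      hlength.trans_le (hτ.length_rightPath_le_dist h.atMostOneCycle h.isCycle he)⟩
  calc ((farOnRight p).ncard : ℝ)
      ≤ threshold p := (Nat.cast_le.2 hcount).trans
        (brokenCount_lt_of_tol_lt h.threshold_pos (Nat.lt_succ_of_le h.tolerance_le)).le
    _ ≤ profit G r σ * threshold p :=
        le_mul_of_one_le_left h.threshold_pos.le (Nat.one_le_cast.2 h.one_le_profit)

theorem ncard_lost_sdiff_dominated_le (h : BreakRound G r f σ ω i₀ p) :
    ((lost G r σ ω \ dominated G r σ ω).ncard : ℝ) ≤ 3 * √(Nat.card V : ℝ) * profit G r σ := by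
  have hunion : ((lost G r σ ω \ dominated G r σ ω).ncard : ℝ) ≤
      (blockedOnCycle ω i₀ p).ncard + (blockedOnTail ω i₀ p).ncard + (farOnRight p).ncard := by
    exact_mod_cast (Set.ncard_le_ncard h.lost_sdiff_dominated_subset (Set.toFinite _)).trans
      ((Set.ncard_union_le _ _).trans (Nat.add_le_add_right (Set.ncard_union_le _ _) _))
  have hthreshold : (profit G r σ : ℝ) * threshold p ≤ profit G r σ * √(Nat.card V : ℝ) :=
    mul_le_mul_of_nonneg_left (sqrt_weight_le _ _ _) (Nat.cast_nonneg _)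
  linarith [h.ncard_blockedOnCycle_le, h.ncard_blockedOnTail_le, h.ncard_farOnRight_le]

end Finite

end BreakRound

end BreakRoundCount

/-! ### The competitive ratio -/

section Competitive

variable {V : Type} {G : SimpleGraph V} {r x : V} {f : ℕ → ℕ} {σ ω : ℕ → Finset V}

theorem exists_isCycle_penultimate_eq {H : SimpleGraph V} {C : Set V} {u : V}
    (hH : AtMostOneCycle H) (hC : IsRootCycle H r C) (hu : u ∈ H.neighborSet r ∩ C) :
    ∃ p : H.Walk r r, p.IsCycle ∧ C = {v | v ∈ p.support} ∧ u = p.penultimate := by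
  obtain ⟨p, hp, rfl⟩ := hC
  rw [hH.neighborSet_inter_support hp] at hu
  rcases hu with rfl | rfl
  · exact ⟨p.reverse, hp.reverse, by simp, by simp⟩
  · exact ⟨p, hp, rfl, rfl⟩

namespace Compared

theorem exists_forall_bypassed (h : Compared G r f σ ω)
    (hx : x ∈ lost G r σ ω \ dominated G r σ ω) :
    ∃ i, ∃ y ∈ ω i, ∀ k ≤ i, Bypassed (roundGraph G r σ k) r y x := by
  obtain ⟨i, y, hy, hyB, hpath⟩ := h.exists_protected hx.1
  refine ⟨i, y, hy, fun k hki => ?_⟩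
  obtain ⟨w, hw, hyw, -⟩ := hpath k hki
  exact h.bypassed hx hy hyB hki hw hyw

theorem exists_first_bypassed_round (h : Compared G r f σ ω)
    (hne : (lost G r σ ω \ dominated G r σ ω).Nonempty) :
    ∃ i₀, 0 < f i₀ ∧
      (∀ i < i₀, ∀ y ∈ ω i, ∀ x, ¬ Bypassed (roundGraph G r σ i) r y x) ∧
      ∀ x ∈ lost G r σ ω \ dominated G r σ ω, ∃ y, Bypassed (roundGraph G r σ i₀) r y x := by
  classical
  have hex : ∃ i, ∃ y ∈ ω i, ∃ x, Bypassed (roundGraph G r σ i) r y x := by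
    obtain ⟨x, hx⟩ := hne
    obtain ⟨i, y, hy, hby⟩ := h.exists_forall_bypassed hx
    exact ⟨i, y, hy, x, hby i le_rfl⟩
  obtain ⟨y₀, hy₀, -⟩ := Nat.find_spec hex
  have hmin : ∀ i < Nat.find hex, ∀ y ∈ ω i, ∀ x, ¬ Bypassed (roundGraph G r σ i) r y x :=
    fun i hi y hy x hby => Nat.find_min hex hi ⟨y, hy, x, hby⟩
  refine ⟨Nat.find hex, (Finset.card_pos.2 ⟨_, hy₀⟩).trans_le (h.legal' _).1, hmin,
    fun x hx => ?_⟩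
  obtain ⟨i, y, hy, hby⟩ := h.exists_forall_bypassed hx
  exact ⟨y, hby _ (not_lt.1 fun hi => hmin i hi y hy x (hby i le_rfl))⟩

theorem ncard_lost_sdiff_dominated_le [Finite V] (h : Compared G r f σ ω) :
    ((lost G r σ ω \ dominated G r σ ω).ncard : ℝ) ≤ 3 * √(Nat.card V : ℝ) * profit G r σ := by
  rcases (lost G r σ ω \ dominated G r σ ω).eq_empty_or_nonempty with hempty | hne
  · rw [hempty, Set.ncard_empty, Nat.cast_zero]
    positivity
  obtain ⟨i₀, hf, hmin, hbyp⟩ := h.exists_first_bypassed_round hne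
  have hstate := h.legal.isState i₀
  have hH := hstate.atMostOneCycle_reduced h.atMostOneCycle
  obtain ⟨x, hx⟩ := hne
  obtain ⟨y, hxy⟩ := hbyp x hx
  have hxB := (notMem_of_reduced_reachable hxy.reachable (ne_root_of_mem_lost hx.1)).1
  obtain ⟨Q, hQσ, hQ, hQgain⟩ := (h.round i₀).exists_first_choice hstate hf hxB
    ((hstate.reachable_iff hxB).1 hxy.reachable)
  rcases hQ.ncard_le_or_breaks hH hbyp with hle | ⟨hf1, C, u, hbreaks, rfl⟩
  · have hQprofit : weight (roundGraph G r σ i₀) r Q ≤ profit G r σ := by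
      rw [← guarded_succ] at hQgain
      exact hQgain.trans (h.legal.gain_le i₀)
    calc ((lost G r σ ω \ dominated G r σ ω).ncard : ℝ)
        ≤ 2 * √(Nat.card V : ℝ) * weight (roundGraph G r σ i₀) r Q := hle
      _ ≤ 3 * √(Nat.card V : ℝ) * profit G r σ := by gcongr; norm_num
  · obtain ⟨p, hp, rfl, rfl⟩ := exists_isCycle_penultimate_eq hH hbreaks.isRootCycle hbreaks.mem
    have hsnd : p.snd ∈ (roundGraph G r σ i₀).neighborSet r ∩ {v | v ∈ p.support} := by
      rw [hH.neighborSet_inter_support hp]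
      exact Or.inl rfl
    exact BreakRound.ncard_lost_sdiff_dominated_le
      ⟨h, hp, hf1.le, hQσ rfl, hbreaks.weight_lt, hbreaks.tol_le _ hsnd, hmin⟩

theorem profit_le [Finite V] (h : Compared G r f σ ω) :
    (profit G r ω : ℝ) ≤ (6 * √(Nat.card V : ℝ) + 1) * profit G r σ := by
  have hlost : ((lost G r σ ω).ncard : ℝ) ≤
      (dominated G r σ ω).ncard + (lost G r σ ω \ dominated G r σ ω).ncard := by
    have hunion := Set.ncard_union_le (dominated G r σ ω) (lost G r σ ω \ dominated G r σ ω)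
    rw [Set.union_sdiff_self] at hunion
    exact_mod_cast (Set.ncard_le_ncard Set.subset_union_right (Set.toFinite _)).trans hunion
  have hprofit : (profit G r ω : ℝ) ≤ profit G r σ + (lost G r σ ω).ncard := by
    exact_mod_cast profit_le_add G r σ ω
  have hnonneg : 0 ≤ √(Nat.card V : ℝ) * profit G r σ := by positivity
  linarith [h.ncard_dominated_le, h.ncard_lost_sdiff_dominated_le]

end Compared

theorem bddAbove_profit [Finite V] (G : SimpleGraph V) (r : V) (f : ℕ → ℕ) :
    BddAbove {k | ∃ σ, IsLegal G r f σ ∧ profit G r σ = k} := by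
  refine ⟨Nat.card V, ?_⟩
  rintro _ ⟨σ, -, rfl⟩
  exact Set.ncard_le_card _

theorem profit_le_opt [Finite V] (hσ : IsLegal G r f σ) : profit G r σ ≤ opt G r f :=
  le_csSup (bddAbove_profit G r f) ⟨σ, hσ, rfl⟩

theorem exists_profit_eq_opt [Finite V] (hσ : IsLegal G r f σ) :
    ∃ ω, IsLegal G r f ω ∧ profit G r ω = opt G r f :=
  Nat.sSup_mem (s := {k | ∃ σ, IsLegal G r f σ ∧ profit G r σ = k}) ⟨_, σ, hσ, rfl⟩
    (bddAbove_profit G r f)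

theorem OnlineAlgorithm.IsAlgA.isCompetitiveOn {A : OnlineAlgorithm} (hA : A.IsAlgA) :
    A.IsCompetitiveOn (fun _ G => IsOneAlmostTree G) (fun n => 6 * √(n : ℝ) + 1) := by
  intro V _ G hG r f
  obtain ⟨ω, hω, hopt⟩ := exists_profit_eq_opt (A.legal V G r f)
  rw [← hopt]
  exact Compared.profit_le ⟨hG.2, A.legal V G r f, hω, hA V G hG r f⟩

end Competitive

/-! ### Tadpole graphs -/

section AtMostOneCycle

variable {V W : Type*} {G : SimpleGraph V} {H : SimpleGraph W} {u v x y : V}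

theorem AtMostOneCycle.comap (φ : G →g H) (hφ : Function.Injective φ) (hH : AtMostOneCycle H) :
    AtMostOneCycle G := by
  intro u v p q hp hq e
  have hmap := hH _ _ (p.map φ) (q.map φ) (hp.map hφ) (hq.map hφ) (e.map φ)
  simpa only [Walk.edges_map, List.mem_map_of_injective (Sym2.map.injective hφ)] using hmap

theorem reachable_of_reachable_sup_edge (huv : G.Reachable u v)
    (h : (G ⊔ edge u v).Reachable x y) : G.Reachable x y := by
  obtain ⟨w⟩ := h
  induction w with
  | nil => exact Reachable.refl _
  | cons hadj _ ih =>
    refine Reachable.trans ?_ ih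
    rcases sup_adj .. |>.1 hadj with hG | hedge
    · exact hG.reachable
    · rcases edge_adj .. |>.1 hedge with ⟨⟨rfl, rfl⟩ | ⟨rfl, rfl⟩, -⟩
      exacts [huv, huv.symm]

theorem isAcyclic_hasse (α : Type*) [LinearOrder α] : (hasse α).IsAcyclic := by
  have hbridge : ∀ a b : α, a ⋖ b → (hasse α).IsBridge s(a, b) := by
    rintro a b hab ⟨w⟩
    suffices ∀ {x y} (_ : ((hasse α).deleteEdges {s(a, b)}).Walk x y), x ≤ a → y ≤ a from
      hab.lt.not_ge (this w le_rfl)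
    intro x y w
    induction w with
    | nil => exact id
    | @cons x y _ hxy _ ih =>
      refine fun hx => ih (not_lt.1 fun hy => ?_)
      rw [deleteEdges_adj, hasse_adj] at hxy
      have hcov : x ⋖ y := hxy.1.resolve_right fun hyx => (hx.trans_lt hy).not_gt hyx.lt
      obtain rfl : x = a := hx.eq_of_not_lt fun hxa => hcov.2 hxa hy
      exact hxy.2 (congrArg _ (hcov.unique_right hab))
  rw [isAcyclic_iff_forall_adj_isBridge]
  rintro a b (hab | hba)
  · exact hbridge a b hab
  · rw [Sym2.eq_swap]
    exact hbridge b a hba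

theorem mem_edges_of_isCycle_sup_edge (hG : G.IsAcyclic) {p : (G ⊔ edge u v).Walk x x}
    (hp : p.IsCycle) : s(u, v) ∈ p.edges := by
  by_contra huv
  refine hG (p.transfer G fun e he => ?_) (hp.transfer _)
  have hmem := p.edges_subset_edgeSet he
  rw [edgeSet_sup] at hmem
  exact hmem.resolve_right fun hedge =>
    huv (Set.mem_singleton_iff.1 (edgeSet_edge_subset hedge) ▸ he)

theorem mem_edges_iff_of_isCycle_sup_edge (hG : G.IsAcyclic) {p : (G ⊔ edge u v).Walk x x}
    (hp : p.IsCycle) {e : Sym2 V} :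
    e ∈ p.edges ↔ e = s(u, v) ∨ ¬ (G.deleteEdges {e}).Reachable u v := by
  refine ⟨fun he => or_iff_not_imp_left.2 fun hne huv => ?_, fun he => ?_⟩
  · obtain ⟨c, d⟩ := e
    have hcd : G.Adj c d := (p.edges_subset_edgeSet he).resolve_right fun hedge =>
      hne (edgeSet_edge_subset hedge)
    have hle : (G ⊔ edge u v).deleteEdges {s(c, d)} ≤ G.deleteEdges {s(c, d)} ⊔ edge u v := by
      rw [deleteEdges_sup]
      exact sup_le_sup_left (deleteEdges_le _) _
    have hreach := (adj_and_reachable_delete_edges_iff_exists_cycle.2 ⟨x, p, hp, he⟩).2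
    exact isAcyclic_iff_forall_adj_isBridge.1 hG hcd
      (reachable_of_reachable_sup_edge huv (hreach.mono hle))
  · by_contra hep
    have hsep := he.resolve_left fun heq => hep (heq ▸ mem_edges_of_isCycle_sup_edge hG hp)
    refine (hG.anti (deleteEdges_le {e})).sup_edge_of_not_reachable hsep
      (p.transfer _ fun e' he' => ?_) (hp.transfer _)
    have hne : e' ≠ e := fun heq => hep (heq ▸ he')
    have hmem := p.edges_subset_edgeSet he'
    rw [edgeSet_sup] at hmem ⊢
    rw [edgeSet_deleteEdges]
    exact hmem.imp_left fun hmemG => ⟨hmemG, hne⟩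

theorem atMostOneCycle_sup_edge (hG : G.IsAcyclic) (u v : V) : AtMostOneCycle (G ⊔ edge u v) :=
  fun _ _ _ _ hp hq _ =>
    (mem_edges_iff_of_isCycle_sup_edge hG hp).trans (mem_edges_iff_of_isCycle_sup_edge hG hq).symm

end AtMostOneCycle

section Tadpole

variable {k l : ℕ}

theorem cycleGraph_adj_iff {a b : Fin (k + 3)} : (cycleGraph (k + 3)).Adj a b ↔
    b.val = a.val + 1 ∨ a.val = b.val + 1 ∨ (a.val = 0 ∧ b.val = k + 2) ∨
      (b.val = 0 ∧ a.val = k + 2) := by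
  rw [cycleGraph_adj']
  rcases lt_trichotomy a b with hab | rfl | hab
  · have hba := Fin.coe_sub_iff_lt.2 hab
    have hba' := Fin.coe_sub_iff_le.2 hab.le
    omega
  · rw [sub_self, Fin.val_zero]
    omega
  · have hba := Fin.coe_sub_iff_lt.2 hab
    have hba' := Fin.coe_sub_iff_le.2 hab.le
    omega

theorem tadpoleGraph_adj_inl {a b : Fin (k + 3)} :
    (tadpoleGraph k l).Adj (.inl a) (.inl b) ↔ b.val = a.val + 1 ∨ a.val = b.val + 1 ∨
      (a.val = 0 ∧ b.val = k + 2) ∨ (b.val = 0 ∧ a.val = k + 2) := by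
  rw [← cycleGraph_adj_iff]
  simp [tadpoleGraph, edge_adj]

theorem tadpoleGraph_adj_inr {a b : Fin (l + 1)} :
    (tadpoleGraph k l).Adj (.inr a) (.inr b) ↔ b.val = a.val + 1 ∨ a.val = b.val + 1 := by
  trans (pathGraph (l + 1)).Adj a b
  · simp [tadpoleGraph, edge_adj]
  · rw [pathGraph_adj]
    omega

theorem tadpoleGraph_adj_inl_inr {a : Fin (k + 3)} {b : Fin (l + 1)} :
    (tadpoleGraph k l).Adj (.inl a) (.inr b) ↔ a.val = 0 ∧ b.val = 0 := by
  simp [tadpoleGraph, edge_adj]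

theorem tadpoleGraph_connected (k l : ℕ) : (tadpoleGraph k l).Connected :=
  cycleGraph_connected.sum_sup_edge (pathGraph_connected l)

theorem tadpoleGraph_atMostOneCycle (k l : ℕ) : AtMostOneCycle (tadpoleGraph k l) := by
  let position : Fin (k + 3) ⊕ Fin (l + 1) → ℤ :=
    Sum.elim (fun a => -(a.val : ℤ)) fun b => (b.val : ℤ) + 1
  have hinjective : Function.Injective position := by
    rintro (a | a) (b | b) hab <;> simp only [position, Sum.elim_inl, Sum.elim_inr] at hab
    · exact congrArg _ (Fin.ext (by omega))
    · omega
    · omega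
    · exact congrArg _ (Fin.ext (by omega))
  have hadj : ∀ {a b}, (tadpoleGraph k l).Adj a b →
      (hasse ℤ ⊔ edge (-(k + 2) : ℤ) 0).Adj (position a) (position b) := by
    rintro (a | a) (b | b) hab <;>
      simp only [position, sup_adj, hasse_adj, Order.covBy_iff_add_one_eq, edge_adj, Sum.elim_inl,
        Sum.elim_inr]
    · have hab := tadpoleGraph_adj_inl.1 hab
      omega
    · have hab := tadpoleGraph_adj_inl_inr.1 hab
      omega
    · have hab := tadpoleGraph_adj_inl_inr.1 hab.symm
      omega
    · have hab := tadpoleGraph_adj_inr.1 hab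
      omega
  exact (atMostOneCycle_sup_edge (isAcyclic_hasse ℤ) _ _).comap ⟨position, hadj⟩ hinjective

end Tadpole

theorem IsTadpole.isOneAlmostTree {V : Type} {G : SimpleGraph V} (h : IsTadpole G) :
    IsOneAlmostTree G := by
  obtain ⟨k, l, ⟨φ⟩⟩ := h
  exact ⟨φ.connected_iff.2 (tadpoleGraph_connected k l),
    (tadpoleGraph_atMostOneCycle k l).comap φ.toHom φ.injective⟩

/-! ### The lower bound on tadpole graphs -/

section Play

variable {V : Type} {G : SimpleGraph V} {r : V} {f : ℕ → ℕ} {σ : ℕ → Finset V}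

theorem exists_mem_burning_of_mem_region {S : Set V} {x : V} (hσ : ∀ t, ∀ v ∈ σ t, v ∈ S)
    (hx : x ∈ region G r S) : ∃ t, x ∈ burning G r σ t := by
  induction (reachable_iff_reflTransGen r x).1 hx with
  | refl => exact ⟨0, rfl⟩
  | tail hy hadj ih =>
    obtain ⟨t, ht⟩ := ih ((reachable_iff_reflTransGen r _).2 hy)
    obtain ⟨hadj, -, hxS⟩ := deleteVerts_adj.1 hadj
    exact ⟨t + 1, mem_burning_succ ht hadj fun ⟨t', _, hmem⟩ => hxS (hσ t' _ hmem)⟩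

theorem ncard_compl_region_singleton_le_opt [Finite V] {v : V} (hf : 0 < f 0) (hv : v ≠ r) :
    (region G r {v})ᶜ.ncard ≤ opt G r f := by
  let ω : ℕ → Finset V := fun i => if i = 0 then {v} else ∅
  have hω : IsLegal G r f ω := by
    rintro (_ | i)
    · simpa [ω, burning] using ⟨hf, hv⟩
    · simp [ω]
  have hguarded : guarded ω 1 = {v} := by
    ext
    simp [guarded, ω]
  refine le_trans (Set.ncard_le_ncard ?_ (Set.toFinite _)) (profit_le_opt hω)
  exact fun x hx i hxi => hx (hguarded ▸ hω.burning_subset_region i 1 hxi)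

theorem OnlineAlgorithm.move_eq_empty (A : OnlineAlgorithm) {t : ℕ} (ht : f t = 0) :
    A.move V G r f t = ∅ :=
  Finset.card_eq_zero.1 (Nat.le_zero.1 (ht ▸ (A.legal V G r f t).1))

theorem OnlineAlgorithm.IsCompetitiveOn.le_mul [Finite V] {A : OnlineAlgorithm}
    {cls : (V : Type) → SimpleGraph V → Prop} {c : ℕ → ℝ} (hA : A.IsCompetitiveOn cls c)
    (hG : cls V G) {a b : ℕ} (ha : 0 < a) (hopt : a ≤ opt G r f)
    (hprofit : profit G r (A.move V G r f) ≤ b) : (a : ℝ) ≤ c (Nat.card V) * b := by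
  have hle : (a : ℝ) ≤ c (Nat.card V) * profit G r (A.move V G r f) :=
    (Nat.cast_le.2 hopt).trans (hA V G hG r f)
  have hc : 0 < c (Nat.card V) :=
    pos_of_mul_pos_left ((Nat.cast_pos.2 ha).trans_le hle) (Nat.cast_nonneg _)
  exact hle.trans (mul_le_mul_of_nonneg_left (Nat.cast_le.2 hprofit) hc.le)

end Play

section TadpoleGame

variable {k l h : ℕ}

theorem ncard_insert_range_inr (k l : ℕ) :
    (insert (Sum.inl 0) (Set.range (Sum.inr : Fin (l + 1) → Fin (k + 3) ⊕ Fin (l + 1)))).ncard =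
      l + 2 := by
  rw [Set.ncard_insert_of_notMem (by simp), ← Set.image_univ,
    Set.ncard_image_of_injective _ Sum.inr_injective, Set.ncard_univ, Nat.card_fin]

theorem exists_inl_of_mem_region_tadpoleGraph {j : Fin (k + 3)} (hj : j ≠ 0)
    {x : Fin (k + 3) ⊕ Fin (l + 1)} (hx : x ∈ region (tadpoleGraph k l) (.inl j) {.inl 0}) :
    ∃ a ≠ 0, x = .inl a := by
  induction (reachable_iff_reflTransGen _ x).1 hx with
  | refl => exact ⟨j, hj, rfl⟩
  | @tail y x hy hadj ih =>
    obtain ⟨a, ha, rfl⟩ := ih ((reachable_iff_reflTransGen _ y).2 hy)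
    obtain ⟨hadj, -, hx0⟩ := deleteVerts_adj.1 hadj
    rcases x with b | b
    · exact ⟨b, fun hb => hx0 (congrArg _ hb), rfl⟩
    · exact absurd (Fin.ext (tadpoleGraph_adj_inl_inr.1 hadj).1) ha

theorem add_two_le_opt_tadpoleGraph {j : Fin (k + 3)} (hj : j ≠ 0) {f : ℕ → ℕ} (hf : 0 < f 0) :
    l + 2 ≤ opt (tadpoleGraph k l) (.inl j) f := by
  have hopt := ncard_compl_region_singleton_le_opt (G := tadpoleGraph k l) (r := .inl j)
    (v := .inl 0) hf fun h0 => hj (Sum.inl_injective h0).symm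
  rw [← ncard_insert_range_inr k l]
  refine (Set.ncard_le_ncard (fun x hx hxr => ?_) (Set.toFinite _)).trans hopt
  obtain ⟨a, ha, rfl⟩ := exists_inl_of_mem_region_tadpoleGraph hj hxr
  simp [ha] at hx

theorem inl_mem_region_tadpoleGraph_of_lt {i a : Fin (k + 3)} (ha : a < i) :
    .inl a ∈ region (tadpoleGraph k l) (.inl 0) {.inl i} := by
  obtain ⟨n, hn⟩ := a
  have hni : n < i.val := ha
  clear ha
  induction n with
  | zero => exact self_mem_region _ _ _
  | succ n ih =>
    refine mem_region_of_adj (ih (by omega) (by omega)) ?_ (tadpoleGraph_adj_inl.2 (.inl rfl)) ?_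
    all_goals simp only [Set.mem_singleton_iff, Sum.inl.injEq, Fin.ext_iff]; omega

theorem inl_mem_region_tadpoleGraph_of_gt {i a : Fin (k + 3)} (hi : i ≠ 0) (ha : i < a) :
    .inl a ∈ region (tadpoleGraph k l) (.inl 0) {.inl i} := by
  obtain ⟨n, hn⟩ : ∃ n, a.val + n = k + 2 := ⟨k + 2 - a, by omega⟩
  induction n generalizing a with
  | zero =>
    exact mem_region_of_adj (self_mem_region _ _ _) (by simpa using hi.symm)
      (tadpoleGraph_adj_inl.2 (.inr (.inr (.inl ⟨rfl, hn⟩)))) (by simpa using ha.ne')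
  | succ n ih =>
    have hlt : i < (⟨a + 1, by omega⟩ : Fin (k + 3)) := ha.trans (Nat.lt_succ_self a.val)
    exact mem_region_of_adj (ih hlt (by simp only; omega)) (by simpa using hlt.ne')
      (tadpoleGraph_adj_inl.2 (.inr (.inl rfl))) (by simpa using ha.ne')

theorem inr_mem_region_tadpoleGraph {i : Fin (k + 3)} (hi : i ≠ 0) (b : Fin (l + 1)) :
    .inr b ∈ region (tadpoleGraph k l) (.inl 0) {.inl i} := by
  obtain ⟨n, hn⟩ := b
  induction n with
  | zero =>
    exact mem_region_of_adj (self_mem_region _ _ _) (by simpa using hi.symm)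
      (tadpoleGraph_adj_inl_inr.2 ⟨rfl, rfl⟩) (by simp)
  | succ n ih =>
    exact mem_region_of_adj (ih (by omega)) (by simp) (tadpoleGraph_adj_inr.2 (.inl rfl)) (by simp)

theorem mem_region_tadpoleGraph {i : Fin (k + 3)} (hi : i ≠ 0) {x : Fin (k + 3) ⊕ Fin (l + 1)}
    (hx : x ≠ .inl i) : x ∈ region (tadpoleGraph k l) (.inl 0) {.inl i} := by
  rcases x with a | b
  · rcases lt_or_gt_of_ne fun hai => hx (congrArg _ hai) with hai | hai
    · exact inl_mem_region_tadpoleGraph_of_lt hai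
    · exact inl_mem_region_tadpoleGraph_of_gt hi hai
  · exact inr_mem_region_tadpoleGraph hi b

theorem profit_tadpoleGraph_le_one {i j : Fin (k + 3)} (hi : i ≠ 0) (hij : i ≠ j)
    {σ : ℕ → Finset (Fin (k + 3) ⊕ Fin (l + 1))} (hσ : ∀ t, ∀ v ∈ σ t, v = .inl i) :
    profit (tadpoleGraph k l) (.inl j) σ ≤ 1 := by
  refine (Set.ncard_le_ncard (fun x hx => ?_) (Set.toFinite _)).trans
    (Set.ncard_singleton (Sum.inl i : Fin (k + 3) ⊕ Fin (l + 1))).le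
  by_contra hxi
  have hj : (.inl j : Fin (k + 3) ⊕ Fin (l + 1)) ≠ .inl i := fun hji =>
    hij (Sum.inl_injective hji).symm
  have hreach : x ∈ region (tadpoleGraph k l) (.inl j) {.inl i} :=
    (mem_region_tadpoleGraph hi hj).symm.trans (mem_region_tadpoleGraph hi hxi)
  obtain ⟨t, ht⟩ := exists_mem_burning_of_mem_region hσ hreach
  exact hx t ht

/-- The optimum's defence of the vertices `h + 1, …, k + 2` of the cycle against a fire at `h`: it
protects the first of them at once, and the last one in round `h`, when the fire reaches the
junction on the other way around. -/
def arcDefence (l : ℕ) (hk : h + 1 < k + 3) (i : ℕ) : Finset (Fin (k + 3) ⊕ Fin (l + 1)) :=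
  if i = 0 then {.inl ⟨h + 1, hk⟩} else if i = h then {.inl (Fin.last (k + 2))} else ∅

theorem burning_arcDefence (hh : 0 < h) (hk : h + 1 < k + 3) (t : ℕ) :
    (∀ j, .inl j ∈ burning (tadpoleGraph k l) (.inl ⟨h, by omega⟩) (arcDefence l hk) t →
      j.val ≤ h ∧ h ≤ j.val + t) ∧
    ∀ b, .inr b ∈ burning (tadpoleGraph k l) (.inl ⟨h, by omega⟩) (arcDefence l hk) t → h < t := by
  induction t with
  | zero =>
    refine ⟨fun j hj => ?_, fun b hb => absurd (show Sum.inr b = _ from hb) Sum.inr_ne_inl⟩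
    rw [Sum.inl_injective (show Sum.inl j = _ from hj)]
    exact ⟨le_rfl, le_rfl⟩
  | succ t ih =>
    refine ⟨fun j hj => ?_, fun b hb => ?_⟩
    · rcases hj with hj | ⟨hj, x | x, hx, hxj⟩
      · have := ih.1 j hj
        omega
      · have hbound := ih.1 x hx
        have hadj := tadpoleGraph_adj_inl.1 hxj
        have hfirst : j.val ≠ h + 1 := fun hjh => hj ⟨0, by omega, by
          rw [show j = ⟨h + 1, hk⟩ from Fin.ext hjh]
          simp [arcDefence]⟩
        have hlast : h ≤ t → j.val ≠ k + 2 := fun ht hjk => hj ⟨h, by omega, by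
          rw [show j = Fin.last (k + 2) from Fin.ext hjk]
          simp [arcDefence, hh.ne']⟩
        omega
      · have hbound := ih.2 x hx
        have hadj := tadpoleGraph_adj_inl_inr.1 hxj.symm
        omega
    · rcases hb with hb | ⟨-, x | x, hx, hxb⟩
      · have := ih.2 b hb
        omega
      · have hbound := ih.1 x hx
        have hadj := tadpoleGraph_adj_inl_inr.1 hxb
        omega
      · have := ih.2 x hx
        omega

theorem isLegal_arcDefence (hh : 0 < h) (hk : h + 1 < k + 3) {f : ℕ → ℕ} (hf₀ : 0 < f 0)
    (hf : 0 < f h) : IsLegal (tadpoleGraph k l) (.inl ⟨h, by omega⟩) f (arcDefence l hk) := by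
  intro i
  have hsafe : ∀ j : Fin (k + 3), h < j.val →
      .inl j ∉ burning (tadpoleGraph k l) (.inl ⟨h, by omega⟩) (arcDefence l hk) i :=
    fun j hj hburn => hj.not_ge ((burning_arcDefence hh hk i).1 j hburn).1
  rw [arcDefence]
  split_ifs with h0 hi
  · subst h0
    exact ⟨(Finset.card_singleton _).le.trans hf₀,
      fun v hv => Finset.mem_singleton.1 hv ▸ hsafe _ (Nat.lt_succ_self h)⟩
  · subst hi
    refine ⟨(Finset.card_singleton _).le.trans hf,
      fun v hv => Finset.mem_singleton.1 hv ▸ hsafe _ ?_⟩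
    simp only [Fin.val_last]
    omega
  · simp

theorem sub_le_opt_tadpoleGraph (hh : 0 < h) (hk : h + 1 < k + 3) {f : ℕ → ℕ} (hf₀ : 0 < f 0)
    (hf : 0 < f h) : k + 2 - h ≤ opt (tadpoleGraph k l) (.inl ⟨h, by omega⟩) f := by
  have hcard : ((Sum.inl : Fin (k + 3) → Fin (k + 3) ⊕ Fin (l + 1)) ''
      ↑(Finset.Ioi (⟨h, by omega⟩ : Fin (k + 3)))).ncard = k + 2 - h := by
    rw [Set.ncard_image_of_injective _ Sum.inl_injective, Set.ncard_coe_finset, Fin.card_Ioi]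
    simp
  refine le_trans ?_ (profit_le_opt (isLegal_arcDefence hh hk hf₀ hf))
  rw [← hcard]
  refine Set.ncard_le_ncard ?_ (Set.toFinite _)
  rintro _ ⟨j, hj, rfl⟩ i hi
  rw [Finset.mem_coe, Finset.mem_Ioi] at hj
  exact (show h < j.val from hj).not_ge ((burning_arcDefence hh hk i).1 j hi).1

theorem inl_mem_burning_tadpoleGraph (hk : h < k + 3)
    {σ : ℕ → Finset (Fin (k + 3) ⊕ Fin (l + 1))}
    (hσ : ∀ t < h, ∀ j : Fin (k + 3), j.val ≠ 0 → .inl j ∉ σ t) {t : ℕ} (ht : t ≤ h)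
    {j : Fin (k + 3)} (hj : j.val ≠ 0) (hjt : j.val + t = h ∨ j.val = h + t) :
    .inl j ∈ burning (tadpoleGraph k l) (.inl ⟨h, hk⟩) σ t := by
  induction t generalizing j with
  | zero =>
    rw [show j = ⟨h, hk⟩ from Fin.ext (by simp only; omega)]
    exact rfl
  | succ t ih =>
    have hunguarded : (.inl j : Fin (k + 3) ⊕ Fin (l + 1)) ∉ guarded σ (t + 1) :=
      fun ⟨t', _, hmem⟩ => hσ t' (by omega) j hj hmem
    rcases hjt with hjt | hjt
    · exact mem_burning_succ (ih (j := ⟨j.val + 1, by omega⟩) (by omega) (by simp)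
        (.inl (by simp only; omega))) (tadpoleGraph_adj_inl.2 (.inr (.inl rfl))) hunguarded
    · exact mem_burning_succ (ih (j := ⟨j.val - 1, by omega⟩) (by omega)
        (by simp only; omega) (.inr (by simp only; omega)))
        (tadpoleGraph_adj_inl.2 (.inl (by simp only; omega))) hunguarded

theorem profit_tadpoleGraph_le_add_two (hk : h < k + 3) (hh : k + 2 ≤ 2 * h)
    {σ : ℕ → Finset (Fin (k + 3) ⊕ Fin (l + 1))}
    (hσ : ∀ t < h, ∀ j : Fin (k + 3), j.val ≠ 0 → .inl j ∉ σ t) :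
    profit (tadpoleGraph k l) (.inl ⟨h, hk⟩) σ ≤ l + 2 := by
  rw [← ncard_insert_range_inr k l]
  refine Set.ncard_le_ncard (fun v hv => ?_) (Set.toFinite _)
  rcases v with j | b
  · left
    by_contra hj
    have hj : j.val ≠ 0 := fun h0 => hj (congrArg _ (Fin.ext h0))
    rcases le_total j.val h with hjh | hjh
    · exact hv (h - j) (inl_mem_burning_tadpoleGraph hk hσ (by omega) hj (by omega))
    · exact hv (j - h) (inl_mem_burning_tadpoleGraph hk hσ (by omega) hj (by omega))
  · exact Or.inr ⟨b, rfl⟩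

end TadpoleGame

namespace OnlineAlgorithm

variable {A : OnlineAlgorithm} {c : ℕ → ℝ}

/-- The adversary stops after the first firefighter if that one is placed on the cycle away from
the junction, since it should have saved the path. Otherwise it sends one further firefighter, with
which half of the cycle could have been saved. -/
theorem exists_opt_ge_and_profit_le (A : OnlineAlgorithm) (l : ℕ) {k : ℕ} {h : Fin (k + 3)}
    (hk : h.val + 1 < k + 3) (hh : k + 2 ≤ 2 * h.val) :
    ∃ f, l + 2 ≤ opt (tadpoleGraph k l) (.inl h) f ∧
        profit (tadpoleGraph k l) (.inl h) (A.move _ (tadpoleGraph k l) (.inl h) f) ≤ 1 ∨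
      k + 2 - h.val ≤ opt (tadpoleGraph k l) (.inl h) f ∧
        profit (tadpoleGraph k l) (.inl h) (A.move _ (tadpoleGraph k l) (.inl h) f) ≤ l + 2 := by
  set move := A.move _ (tadpoleGraph k l) (.inl h)
  let f₁ : ℕ → ℕ := fun i => if i = 0 then 1 else 0
  let f₂ : ℕ → ℕ := fun i => if i = 0 ∨ i = h.val then 1 else 0
  by_cases hcycle : ∃ j : Fin (k + 3), j.val ≠ 0 ∧ .inl j ∈ move f₁ 0
  · obtain ⟨j, hj, hmem⟩ := hcycle
    have hlegal := A.legal _ (tadpoleGraph k l) (.inl h) f₁ 0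
    have hjh : j ≠ h := fun hjh => hlegal.2 _ hmem (congrArg _ hjh)
    have hroot : h ≠ 0 := Fin.ne_of_val_ne (by rw [Fin.val_zero]; omega)
    refine ⟨f₁, .inl ⟨add_two_le_opt_tadpoleGraph hroot one_pos,
      profit_tadpoleGraph_le_one (Fin.ne_of_val_ne hj) hjh fun t v hv => ?_⟩⟩
    rcases t with _ | t
    · exact Finset.card_le_one.1 hlegal.1 v hv _ hmem
    · rw [show move f₁ (t + 1) = ∅ from A.move_eq_empty rfl] at hv
      exact absurd hv (Finset.notMem_empty v)
  · have hmove : move f₁ 0 = move f₂ 0 :=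
      A.online _ _ _ _ _ _ fun j hj => by simp [f₁, f₂, Nat.le_zero.1 hj]
    refine ⟨f₂, .inr ⟨sub_le_opt_tadpoleGraph (by omega) hk (by simp [f₂]) (by simp [f₂]),
      profit_tadpoleGraph_le_add_two (by omega) hh fun t ht j hj hmem => ?_⟩⟩
    rcases t with _ | t
    · exact hcycle ⟨j, hj, hmove ▸ hmem⟩
    · rw [show move f₂ (t + 1) = ∅ from A.move_eq_empty (by simp [f₂, ht.ne])] at hmem
      exact absurd hmem (Finset.notMem_empty _)

theorem IsCompetitiveOn.le_or_le_mul_of_isTadpole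
    (hA : A.IsCompetitiveOn (fun _ G => IsTadpole G) c) {k l h : ℕ} (hk : h + 1 < k + 3)
    (hh : k + 2 ≤ 2 * h) : (l : ℝ) + 2 ≤ c (k + 3 + (l + 1)) ∨
      ((k + 2 - h : ℕ) : ℝ) ≤ c (k + 3 + (l + 1)) * (l + 2) := by
  have hG : IsTadpole (tadpoleGraph k l) := ⟨k, l, ⟨Iso.refl⟩⟩
  have hcard : Nat.card (Fin (k + 3) ⊕ Fin (l + 1)) = k + 3 + (l + 1) := by simp
  obtain ⟨f, ⟨hopt, hprofit⟩ | ⟨hopt, hprofit⟩⟩ :=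
    A.exists_opt_ge_and_profit_le l (h := ⟨h, by omega⟩) hk hh
  · left
    have hle := hA.le_mul hG (by omega) hopt hprofit
    rw [hcard] at hle
    simpa using hle
  · right
    have hle := hA.le_mul hG (by simp only; omega) hopt hprofit
    rw [hcard] at hle
    exact_mod_cast hle

theorem IsCompetitiveOn.sqrt_le_of_isTadpole
    (hA : A.IsCompetitiveOn (fun _ G => IsTadpole G) c) {n : ℕ} (hn : 16 ≤ n) :
    1 / 8 * √(n : ℝ) ≤ c n := by
  have hs : 4 ≤ n.sqrt := Nat.le_sqrt.2 hn
  have hsn : 4 * n.sqrt ≤ n := (Nat.mul_le_mul_right _ hs).trans (Nat.sqrt_le n)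
  obtain ⟨l, hl⟩ : ∃ l, n.sqrt = l + 1 := ⟨n.sqrt - 1, by omega⟩
  obtain ⟨k, hk⟩ : ∃ k, n = k + 3 + (l + 1) := ⟨n - (l + 1) - 3, by omega⟩
  have hsqrt : √(n : ℝ) ≤ l + 2 := by
    have hlt := Real.real_sqrt_le_nat_sqrt_succ (a := n)
    rw [hl] at hlt
    push_cast at hlt
    linarith
  have hsqrt' : (l : ℝ) + 2 ≤ 2 * √(n : ℝ) := by
    have hle := Real.nat_sqrt_le_real_sqrt (a := n)
    rw [hl] at hle
    push_cast at hle
    linarith [Nat.cast_nonneg (α := ℝ) l]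
  have hpos : 0 < √(n : ℝ) := by positivity
  have hcases := hA.le_or_le_mul_of_isTadpole (k := k) (l := l) (h := (k + 3) / 2) (by omega)
    (by omega)
  rw [← hk] at hcases
  rcases hcases with hle | hle
  · linarith
  · have hquarter : (n : ℝ) / 4 ≤ ((k + 2 - (k + 3) / 2 : ℕ) : ℝ) := by
      rw [div_le_iff₀ (by norm_num)]
      exact_mod_cast (by omega : n ≤ (k + 2 - (k + 3) / 2) * 4)
    have hc : 0 ≤ c n := by
      refine nonneg_of_mul_nonneg_left ((Nat.cast_nonneg _).trans hle) ?_
      positivity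
    refine le_of_mul_le_mul_right ?_ hpos
    calc 1 / 8 * √(n : ℝ) * √(n : ℝ) = (n : ℝ) / 4 / 2 := by
          rw [mul_assoc, Real.mul_self_sqrt (Nat.cast_nonneg n)]
          ring
      _ ≤ c n * (2 * √(n : ℝ)) / 2 := by
          gcongr
          exact (hquarter.trans hle).trans (mul_le_mul_of_nonneg_left hsqrt' hc)
      _ = c n * √(n : ℝ) := by ring

end OnlineAlgorithm

end Firefighting

theorem mainTheorem2 :
    (∃ A : Firefighting.OnlineAlgorithm, A.IsAlgA) ∧
    (∀ A : Firefighting.OnlineAlgorithm, A.IsAlgA →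
      A.IsCompetitiveOn (fun _ G => Firefighting.IsOneAlmostTree G)
        (fun n => 6 * √(n : ℝ) + 1)) ∧
    (∀ (V : Type) (G : SimpleGraph V),
      Firefighting.IsTadpole G → Firefighting.IsOneAlmostTree G) ∧
    (∃ ε : ℝ, 0 < ε ∧ ∀ (A : Firefighting.OnlineAlgorithm) (c : ℕ → ℝ),
      A.IsCompetitiveOn (fun _ G => Firefighting.IsTadpole G) c →
        ∀ᶠ n : ℕ in Filter.atTop, ε * √(n : ℝ) ≤ c n) :=
  ⟨Firefighting.exists_isAlgA, fun _ hA => hA.isCompetitiveOn, fun _ _ h => h.isOneAlmostTree,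
    1 / 8, by norm_num, fun _ _ hA => Filter.eventually_atTop.2
      ⟨16, fun _ hn => hA.sqrt_le_of_isTadpole hn⟩⟩
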